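/- Let $k=\mathbb R$ or $\mathbb C$, let $V$ be a $k$-vector space of finite dimension $n>2$ with basis $x_1,\dots,x_n$, and let $S:V\otimes V\to V\otimes V$ be a linear map with $S^2=\mathrm{Id}$ and $S^{12}S^{23}S^{12}=S^{23}S^{12}S^{23}$. Assume that $S$ is even of rank $2$: for $\wedge_-(V)=T(V)/(\mathrm{Im}(\mathrm{Id}+S))$ the Poincaré series $P_-(t)=\sum_l \dim\wedge_-^l(V)\,t^l$ is a monic polynomial of degree $2$ (so $P_-(t)=1+nt+t^2$). Assume also that the determinant is central: writing $\tfrac12(\mathrm{Id}-S)(x_i\otimes x_j)=u_{ij}\,v$ with $v=v^{kl}x_k\otimes x_l$ and $u_{ij}v^{ij}=1$, one has $-2\,u_{ai}v^{ja}=\delta_i^j=-2\,u_{ia}v^{aj}$ (repeated indices are summed). Extend $S$ to the left dual $V^*$ by invariance of the evaluation $V^*\otimes V\to k$, and by $S_{V,V^*}=S_{V^*,V}^{-1}$, and hence to $\mathrm{End}\,V=V\otimes V^*$. Put $\mathrm{tr}=\mathrm{ev}\circ S_{V,V^*}$ and $[\,,]=\circ\,(\mathrm{Id}-S)$ on $\mathrm{End}\,V$,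 and $\mathfrak g=sl(V_S)=\ker\mathrm{tr}$. Let $e_i^j(x_m)=\delta_m^j x_i$, $C_i^j=\mathrm{tr}(e_i^j)$, $B=C^{-1}$ and $f_i^j=e_i^j-\tfrac12 C_i^j\,\mathrm{Id}\in\mathfrak g$. For $c\in k$, $c\ne0$, the twisted hyperboloid is the algebra $$\mathcal A_c=T(\mathfrak g)\big/\big(t-S(t)\ (t\in\mathfrak g\otimes\mathfrak g),\ \ B_i^j\,f_l^i f_j^l-c\big).$$ Then these constructions are well defined: $S_{V^*,V}$ is bijective, $\mathrm{tr}\,\mathrm{Id}=2$, $C$ is invertible, and $\mathfrak g$ is stable under the twist and the bracket. There is a unique pair consisting of an extension of the twist to a map $\mathfrak g\otimes\mathcal A_c\to\mathcal A_c\otimes\mathfrak g$ compatible with the unit and the product of $\mathcal A_c$, and an action map $\mathfrak g\otimes\mathcal A_c\to\mathcal A_c$ by twisted vector fields (operators that kill $1$ and satisfy the twisted Leibniz rule $X(ab)=X(a)b+\sum a'X'(b)$, where $\sum a'\otimes X'=S(X\otimes a)$) which extends the adjoint action $Y\mapsto[X,Y]$ on $\mathfrak g$. Let $\mathcal C_{sl}=B_i^jF_l^iF_j^l$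 be the Casimir operator on $\mathcal A_c$, where $F_i^j$ is the operator by which $f_i^j$ acts. The operator $\mathcal C_{sl}$ on $\mathcal A_c$ is diagonalizable, that is, $\mathcal A_c$ is the sum of its eigenspaces. Its eigenvalues are exactly $$\lambda_l=\frac{(2l)^2}{2}+2l,\qquad l=0,1,2,\dots,$$ and the multiplicity (the dimension of the eigenspace) of $\lambda_l$ is $$m_l=\frac{\alpha_2^{2l+1}-\alpha_1^{2l+1}}{\alpha_2-\alpha_1},$$ where $\alpha_1\neq\alpha_2$ are the two (real) roots of $P_-(-t)=1-nt+t^2=0$. -/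

import Mathlib

open scoped TensorProduct

noncomputable section

namespace TwistedHyperboloid

/-! ### Symmetries, skew-symmetric algebra, rank, central determinant -/

section Symmetry

variable {k V : Type*} [Field k] [AddCommGroup V] [Module k V]

/-- `S ⊗ Id` on `V ⊗ V ⊗ V`. -/
def S12 (S : V ⊗[k] V →ₗ[k] V ⊗[k] V) : (V ⊗[k] V) ⊗[k] V →ₗ[k] (V ⊗[k] V) ⊗[k] V :=
  S.rTensor V

/-- `Id ⊗ S` on `V ⊗ V ⊗ V`. -/
def S23 (S : V ⊗[k] V →ₗ[k] V ⊗[k] V) : (V ⊗[k] V) ⊗[k] V →ₗ[k] (V ⊗[k] V) ⊗[k] V :=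
  (TensorProduct.assoc k V V V).symm.toLinearMap ∘ₗ S.lTensor V ∘ₗ
    (TensorProduct.assoc k V V V).toLinearMap

/-- A symmetry: an involutive solution of the quantum Yang-Baxter equation. -/
structure IsSymmetry (S : V ⊗[k] V →ₗ[k] V ⊗[k] V) : Prop where
  involutive : S ∘ₗ S = LinearMap.id
  yangBaxter : S12 S ∘ₗ S23 S ∘ₗ S12 S = S23 S ∘ₗ S12 S ∘ₗ S23 S

/-- The embedding `V ⊗ V → T(V)` of degree two tensors into the tensor algebra. -/
def quadratic (k V : Type*) [Field k] [AddCommGroup V] [Module k V] :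
    V ⊗[k] V →ₗ[k] TensorAlgebra k V :=
  LinearMap.mul' k (TensorAlgebra k V) ∘ₗ
    TensorProduct.map (TensorAlgebra.ι k) (TensorAlgebra.ι k)

/-- The relations `t + S t = 0`, `t ∈ V ⊗ V`. -/
inductive SkewRel (S : V ⊗[k] V →ₗ[k] V ⊗[k] V) : TensorAlgebra k V → TensorAlgebra k V → Prop
  | skew (t : V ⊗[k] V) : SkewRel S (quadratic k V (t + S t)) 0

/-- The skew-symmetric algebra `Λ₋(V) = T(V) / (Im (Id + S))`. -/
abbrev SkewAlgebra (S : V ⊗[k] V →ₗ[k] V ⊗[k] V) : Type _ := RingQuot (SkewRel S)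

/-- The homogeneous component of degree `l` of `Λ₋(V)`: the image of `V^{⊗ l} ⊆ T(V)`. -/
def skewComponent (S : V ⊗[k] V →ₗ[k] V ⊗[k] V) (l : ℕ) : Submodule k (SkewAlgebra S) :=
  ((LinearMap.range (TensorAlgebra.ι k (M := V))) ^ l).map
    (RingQuot.mkAlgHom k (SkewRel S)).toLinearMap

/-- The Poincaré series `P₋(t) = ∑ dim Λ₋^l(V) t^l`. -/
def poincareSkew (S : V ⊗[k] V →ₗ[k] V ⊗[k] V) : PowerSeries ℕ :=
  PowerSeries.mk fun l => Module.finrank k (skewComponent S l)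

/-- `S` is even of rank `p`: its series `P₋(t)` is a monic polynomial of degree `p`. -/
def IsEvenOfRank (S : V ⊗[k] V →ₗ[k] V ⊗[k] V) (p : ℕ) : Prop :=
  ∃ P : Polynomial ℕ, P.Monic ∧ P.natDegree = p ∧ (P : PowerSeries ℕ) = poincareSkew S

/-- The operator `M`, `M_i^j = u_{a i} v^{j a}`, of a determinant `v` and codeterminant `u`
(rank two). -/
def opM (u : V ⊗[k] V →ₗ[k] k) (v : V ⊗[k] V) : V →ₗ[k] V :=
  (TensorProduct.rid k V).toLinearMap ∘ₗ u.lTensor V ∘ₗ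
    (TensorProduct.assoc k V V V).toLinearMap ∘ₗ TensorProduct.mk k (V ⊗[k] V) V v

/-- The operator `N`, `N_i^j = u_{i a} v^{a j}`, of a determinant `v` and codeterminant `u`
(rank two). -/
def opN (u : V ⊗[k] V →ₗ[k] k) (v : V ⊗[k] V) : V →ₗ[k] V :=
  (TensorProduct.lid k V).toLinearMap ∘ₗ u.rTensor V ∘ₗ
    (TensorProduct.assoc k V V V).symm.toLinearMap ∘ₗ (TensorProduct.mk k V (V ⊗[k] V)).flip v

/-- The determinant of a symmetry of rank two is central. The skew-symmetrizer `(Id - S) / 2`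
is written as `t ↦ u(t) v` with `u(v) = 1` (this determines the determinant `v` and the
codeterminant `u` up to `v ↦ a v`, `u ↦ a⁻¹ u`), and centrality is
`(-1)^{p-1} p M = Id = (-1)^{p-1} p N` with `p = 2`. -/
def HasCentralDeterminant (S : V ⊗[k] V →ₗ[k] V ⊗[k] V) : Prop :=
  ∃ (u : V ⊗[k] V →ₗ[k] k) (v : V ⊗[k] V),
    (∀ t, (2 : k)⁻¹ • (t - S t) = u t • v) ∧ u v = 1 ∧
    (-2 : k) • opM u v = LinearMap.id ∧ (-2 : k) • opN u v = LinearMap.id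

end Symmetry

/-! ### Extension of the symmetry to the left dual space and to `End V = V ⊗ V*` -/

section Extension

variable {k V : Type*} [Field k] [AddCommGroup V] [Module k V] [FiniteDimensional k V]

/-- The identification `V ⊗ V* = End V`, `x ⊗ φ ↦ (y ↦ φ(y) x)`. -/
def endEquiv (k V : Type*) [Field k] [AddCommGroup V] [Module k V] [FiniteDimensional k V] :
    V ⊗[k] Module.Dual k V ≃ₗ[k] Module.End k V :=
  (TensorProduct.comm k V (Module.Dual k V)).trans (dualTensorHomEquiv k V V)

/-- The endomorphism `y ↦ (φ ⊗ Id) (S (x ⊗ y))` of `V`. -/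
def slice (S : V ⊗[k] V →ₗ[k] V ⊗[k] V) (φ : Module.Dual k V) (x : V) : Module.End k V :=
  (TensorProduct.lid k V).toLinearMap ∘ₗ φ.rTensor V ∘ₗ S ∘ₗ TensorProduct.mk k V V x

/-- The extension `V* ⊗ V → V ⊗ V*` of `S`. Invariance of the evaluation `ev : V* ⊗ V → k`
(left duality), i.e. `(Id ⊗ ev) S_{V*,V}^{12} S^{23} = ev ⊗ Id` on `V* ⊗ V ⊗ V`, says
that `S_{V*,V}(φ ⊗ x)`, seen as an endomorphism of `V`, is `y ↦ (φ ⊗ Id) (S (x ⊗ y))`. -/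
def braidDualLeft (S : V ⊗[k] V →ₗ[k] V ⊗[k] V) :
    Module.Dual k V ⊗[k] V →ₗ[k] V ⊗[k] Module.Dual k V :=
  (endEquiv k V).symm.toLinearMap ∘ₗ TensorProduct.lift
    (LinearMap.mk₂ k (slice S)
      (fun φ ψ x => by ext y; simp [slice, LinearMap.rTensor_add])
      (fun a φ x => by ext y; simp [slice, LinearMap.rTensor_smul])
      (fun φ x y => by ext z; simp [slice])
      (fun a φ x => by ext y; simp [slice]))

open Classical in
/-- The extension `V ⊗ V* → V* ⊗ V` of `S`: the inverse of `S_{V*,V}` (the extended twist is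
involutive). It exists as soon as `S` is invertible by column. -/
def braidDualRight (S : V ⊗[k] V →ₗ[k] V ⊗[k] V) :
    V ⊗[k] Module.Dual k V →ₗ[k] Module.Dual k V ⊗[k] V :=
  if h : Function.Bijective (braidDualLeft S) then
    (LinearEquiv.ofBijective (braidDualLeft S) h).symm.toLinearMap
  else 0

/-- The extension `V* ⊗ V* → V* ⊗ V*` of `S`: the transpose of `S` for the invariant pairing
`⟨φ ⊗ ψ, x ⊗ y⟩ = φ(y) ψ(x)`. -/
def braidDualDual (S : V ⊗[k] V →ₗ[k] V ⊗[k] V) :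
    Module.Dual k V ⊗[k] Module.Dual k V →ₗ[k] Module.Dual k V ⊗[k] Module.Dual k V :=
  let e : Module.Dual k V ⊗[k] Module.Dual k V ≃ₗ[k] Module.Dual k (V ⊗[k] V) :=
    (TensorProduct.comm k (Module.Dual k V) (Module.Dual k V)).trans
      (TensorProduct.dualDistribEquiv k V V)
  e.symm.toLinearMap ∘ₗ S.dualMap ∘ₗ e.toLinearMap

/-- Apply a map to the two middle factors of a fourfold tensor product. -/
def middle {A B C B' C' D : Type*} [AddCommGroup A] [Module k A] [AddCommGroup B] [Module k B]
    [AddCommGroup C] [Module k C] [AddCommGroup B'] [Module k B'] [AddCommGroup C'] [Module k C']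
    [AddCommGroup D] [Module k D] (f : B ⊗[k] C →ₗ[k] B' ⊗[k] C') :
    (A ⊗[k] B) ⊗[k] (C ⊗[k] D) →ₗ[k] (A ⊗[k] B') ⊗[k] (C' ⊗[k] D) :=
  (TensorProduct.tensorTensorTensorAssoc k A B' C' D).symm.toLinearMap ∘ₗ
    TensorProduct.map (f.lTensor A) LinearMap.id ∘ₗ
    (TensorProduct.tensorTensorTensorAssoc k A B C D).toLinearMap

/-- The extension of `S` to `End V ⊗ End V = V ⊗ V* ⊗ V ⊗ V*`. -/
def braidEnd (S : V ⊗[k] V →ₗ[k] V ⊗[k] V) :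
    Module.End k V ⊗[k] Module.End k V →ₗ[k] Module.End k V ⊗[k] Module.End k V :=
  TensorProduct.map (endEquiv k V).toLinearMap (endEquiv k V).toLinearMap ∘ₗ
    middle (braidDualRight S) ∘ₗ
    TensorProduct.map S (braidDualDual S) ∘ₗ
    middle (braidDualLeft S) ∘ₗ
    TensorProduct.map (endEquiv k V).symm.toLinearMap (endEquiv k V).symm.toLinearMap

/-- The `S`-trace `tr = ⟨ , ⟩ S : End V = V ⊗ V* → V* ⊗ V → k`. -/
def traceS (S : V ⊗[k] V →ₗ[k] V ⊗[k] V) : Module.End k V →ₗ[k] k :=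
  contractLeft k V ∘ₗ braidDualRight S ∘ₗ (endEquiv k V).symm.toLinearMap

/-- The twisted Lie bracket `[ , ] = ∘ (Id - S)` on `End V`. -/
def bracketEnd (S : V ⊗[k] V →ₗ[k] V ⊗[k] V) :
    Module.End k V ⊗[k] Module.End k V →ₗ[k] Module.End k V :=
  LinearMap.mul' k (Module.End k V) ∘ₗ (LinearMap.id - braidEnd S)

/-- `sl(V_S)`: the endomorphisms of vanishing `S`-trace. -/
def sl (S : V ⊗[k] V →ₗ[k] V ⊗[k] V) : Submodule k (Module.End k V) :=
  LinearMap.ker (traceS S)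

open Classical in
/-- The projection `X ↦ X - p⁻¹ tr(X) Id` of `End V` onto `sl(V_S)` for `p = tr Id = 2`. -/
def slProj (S : V ⊗[k] V →ₗ[k] V ⊗[k] V) : Module.End k V →ₗ[k] sl S :=
  if h : ∀ X, X - ((2 : k)⁻¹ * traceS S X) • (1 : Module.End k V) ∈ sl S then
    LinearMap.codRestrict (sl S)
      (LinearMap.id - ((2 : k)⁻¹ • traceS S).smulRight (1 : Module.End k V))
      (fun X => by simpa using h X)
  else 0

/-- The twist of `sl(V_S)`: the restriction of the twist of `End V`. (The projection only
serves to land in `sl ⊗ sl`.) -/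
def braidSl (S : V ⊗[k] V →ₗ[k] V ⊗[k] V) : sl S ⊗[k] sl S →ₗ[k] sl S ⊗[k] sl S :=
  TensorProduct.map (slProj S) (slProj S) ∘ₗ braidEnd S ∘ₗ
    TensorProduct.map (sl S).subtype (sl S).subtype

/-- The bracket of `sl(V_S)`: the restriction of the bracket of `End V`. -/
def bracketSl (S : V ⊗[k] V →ₗ[k] V ⊗[k] V) : sl S ⊗[k] sl S →ₗ[k] sl S :=
  slProj S ∘ₗ bracketEnd S ∘ₗ TensorProduct.map (sl S).subtype (sl S).subtype

end Extension

/-! ### Casimir element, hyperboloid, action, Casimir operator -/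

section Hyperboloid

variable {k V : Type*} [Field k] [AddCommGroup V] [Module k V] [FiniteDimensional k V] {n : ℕ}

/-- The matrix unit `e_i^j`, with `e_i^j (x_m) = δ_m^j x_i` (lower index first). -/
def matUnit (b : Module.Basis (Fin n) k V) (i j : Fin n) : Module.End k V :=
  endEquiv k V (b i ⊗ₜ[k] b.coord j)

/-- The matrix `C_i^j = tr (e_i^j)`, with row index `i` and column index `j`. -/
def matC (S : V ⊗[k] V →ₗ[k] V ⊗[k] V) (b : Module.Basis (Fin n) k V) :
    Matrix (Fin n) (Fin n) k :=
  Matrix.of fun i j => traceS S (matUnit b i j)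

/-- The matrix `B = C⁻¹`. -/
def matB (S : V ⊗[k] V →ₗ[k] V ⊗[k] V) (b : Module.Basis (Fin n) k V) :
    Matrix (Fin n) (Fin n) k :=
  (matC S b)⁻¹

/-- The generators `f_i^j = e_i^j - p⁻¹ C_i^j Id` of `sl(V_S)` (lower index first). -/
def slGen (S : V ⊗[k] V →ₗ[k] V ⊗[k] V) (b : Module.Basis (Fin n) k V) (i j : Fin n) : sl S :=
  slProj S (matUnit b i j)

/-- The tensor `∑ B_i^j f_l^i ⊗ f_j^l` in `sl(V_S) ⊗ sl(V_S)`. -/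
def casimirTensor (S : V ⊗[k] V →ₗ[k] V ⊗[k] V) (b : Module.Basis (Fin n) k V) :
    sl S ⊗[k] sl S :=
  ∑ i, ∑ j, ∑ l, matB S b i j • (slGen S b l i ⊗ₜ[k] slGen S b j l)

/-- The relations `t = S t` (`t ∈ sl ⊗ sl`) and `∑ B_i^j f_l^i f_j^l = c`. -/
inductive HypRel (S : V ⊗[k] V →ₗ[k] V ⊗[k] V) (b : Module.Basis (Fin n) k V) (c : k) :
    TensorAlgebra k (sl S) → TensorAlgebra k (sl S) → Prop
  | comm (t : sl S ⊗[k] sl S) :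
      HypRel S b c (quadratic k (sl S) t) (quadratic k (sl S) (braidSl S t))
  | quadric :
      HypRel S b c (quadratic k (sl S) (casimirTensor S b)) (algebraMap k _ c)

/-- The algebra `A_c` of functions on the twisted hyperboloid (for `c ≠ 0`). -/
abbrev Hyperboloid (S : V ⊗[k] V →ₗ[k] V ⊗[k] V) (b : Module.Basis (Fin n) k V) (c : k) :
    Type _ :=
  RingQuot (HypRel S b c)

/-- The canonical map `sl(V_S) → A_c`. -/
def hypGen (S : V ⊗[k] V →ₗ[k] V ⊗[k] V) (b : Module.Basis (Fin n) k V) (c : k) :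
    sl S →ₗ[k] Hyperboloid S b c :=
  (RingQuot.mkAlgHom k (HypRel S b c)).toLinearMap ∘ₗ TensorAlgebra.ι k

/-- `σ : sl ⊗ A_c → A_c ⊗ sl` is the extension of the twist of `sl(V_S)` to `A_c`, and
`ρ : sl ⊗ A_c → A_c` is the action of `sl(V_S)` on `A_c` by twisted vector fields which extends
the adjoint action `X ↦ [X, ·]` by means of the twisted Leibniz rule
`X(ab) = X(a) b + ∘ ev (X ⊗ Id) S (a ⊗ b)`, that is, `X(ab) = X(a) b + ∑ a' X'(b)`
where `∑ a' ⊗ X' = σ(X ⊗ a)`. -/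
structure IsAdjointAction (S : V ⊗[k] V →ₗ[k] V ⊗[k] V) (b : Module.Basis (Fin n) k V) (c : k)
    (σ : sl S ⊗[k] Hyperboloid S b c →ₗ[k] Hyperboloid S b c ⊗[k] sl S)
    (ρ : sl S ⊗[k] Hyperboloid S b c →ₗ[k] Hyperboloid S b c) : Prop where
  braid_one : ∀ X : sl S, σ (X ⊗ₜ[k] 1) = 1 ⊗ₜ[k] X
  braid_gen : ∀ X Y : sl S,
    σ (X ⊗ₜ[k] hypGen S b c Y) = (hypGen S b c).rTensor (sl S) (braidSl S (X ⊗ₜ[k] Y))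
  braid_mul : ∀ (X : sl S) (f g : Hyperboloid S b c),
    σ (X ⊗ₜ[k] (f * g)) =
      (LinearMap.mul' k (Hyperboloid S b c)).rTensor (sl S)
        ((TensorProduct.assoc k _ _ _).symm
          (σ.lTensor (Hyperboloid S b c)
            (TensorProduct.assoc k _ _ _ (σ (X ⊗ₜ[k] f) ⊗ₜ[k] g))))
  act_one : ∀ X : sl S, ρ (X ⊗ₜ[k] 1) = 0
  act_gen : ∀ X Y : sl S, ρ (X ⊗ₜ[k] hypGen S b c Y) = hypGen S b c (bracketSl S (X ⊗ₜ[k] Y))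
  leibniz : ∀ (X : sl S) (f g : Hyperboloid S b c),
    ρ (X ⊗ₜ[k] (f * g)) =
      ρ (X ⊗ₜ[k] f) * g +
        LinearMap.mul' k (Hyperboloid S b c)
          (ρ.lTensor (Hyperboloid S b c)
            (TensorProduct.assoc k _ _ _ (σ (X ⊗ₜ[k] f) ⊗ₜ[k] g)))

/-- The Casimir operator `∑ B_i^j F_l^i F_j^l`, where `F_i^j` is the operator by which `f_i^j`
acts. -/
def casimirOp (S : V ⊗[k] V →ₗ[k] V ⊗[k] V) (b : Module.Basis (Fin n) k V) (c : k)
    (ρ : sl S ⊗[k] Hyperboloid S b c →ₗ[k] Hyperboloid S b c) :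
    Module.End k (Hyperboloid S b c) :=
  ∑ i, ∑ j, ∑ l, matB S b i j •
    (TensorProduct.curry ρ (slGen S b l i) ∘ₗ TensorProduct.curry ρ (slGen S b j l))

/-- The constructions above make sense for `S`: the extension of `S` to the dual space exists,
`tr Id = 2`, the matrix `C` is invertible, and `sl(V_S)` is stable under the twist and under
the bracket of `End V`. -/
structure IsWellDefined (S : V ⊗[k] V →ₗ[k] V ⊗[k] V) (b : Module.Basis (Fin n) k V) :
    Prop where
  dual : Function.Bijective (braidDualLeft S)
  trace_one : traceS S 1 = 2
  matC_unit : IsUnit (matC S b).det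
  braid_mem : ∀ t : sl S ⊗[k] sl S,
    braidEnd S (TensorProduct.map (sl S).subtype (sl S).subtype t) =
      TensorProduct.map (sl S).subtype (sl S).subtype (braidSl S t)
  bracket_mem : ∀ t : sl S ⊗[k] sl S,
    bracketEnd S (TensorProduct.map (sl S).subtype (sl S).subtype t) = (bracketSl S t : sl S)

end Hyperboloid

end TwistedHyperboloid

end

open TwistedHyperboloid

/-!
Write `v = ∑ b i ⊗ d i` for the determinant and `u` for the codeterminant. Centrality of the
determinant says that `u` and `v` satisfy the zigzag identities (`IsCup`), so
`S = Id - 2 u ⊗ v` is a symmetry of Temperley-Lieb type with loop value `1`.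

*From `sl(V_S)` to bilinear generators.* The form `u` identifies `V` with `V*`, hence `End V` with
`V ⊗ V` (`toEnd`). Under this identification all extensions of `S` are built from copies of `S`
(`braidEnd_toEnd`), the trace is `-u` (`traceS_toEnd`), the identity is `-2 v`, and `sl(V_S)` is
the kernel of `u`, that is, the quotient of `V ⊗ V` by `v`. The hyperboloid therefore is generated
by elements `[x y]`, bilinear in `x, y ∈ V`, and its relations amount to
`∑ [b i d i] = 0` and `∑ [x b i] [d i y] = K u(x, y)` with `K = -c / 4` (`IsHyp`,
`isHyp_hypGen`, `exists_algHom_hyperboloid`).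

*The model.* Let `Sym(V) = T(V) / (v)`, with its twisted partial derivatives `∂_y` and its number
operator `N`. The operators `x y + κ(N) ∂_x ∂_y` on the even part of `Sym(V)` satisfy the relations
of the hyperboloid for a suitable rational function `κ` (`TwistedSym.isHyp_evenL`). So `A_c` acts
on the even part, and the orbit map `a ↦ a · 1` is bijective: Euler's formula yields an explicit
inverse (`TwistedSym.invOrbit_orbit`, `TwistedSym.orbit_invOrbit`).

*The action.* Under the orbit map the generators of `sl(V_S)` act by the twisted vector
fields `x ∂_y + u(x, y) N / 2` of `Sym(V)`, which satisfy the twisted Leibniz rule for the product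
of a generator and a function (`TwistedSym.field_hypL`); the rule for arbitrary products follows
by induction. The twist `sl ⊗ A_c → A_c ⊗ sl` comes from a twist that passes a single vector
through a function (`pass`, `exists_passHom`), applied twice (`passTwo`). Since the values on
generators determine the twist and the action, the pair is unique (`IsAdjointAction.unique`).

*The spectrum.* The Casimir operator becomes `N² / 2 + N` (`TwistedSym.sum_field_field`), so its
eigenspaces are the components `Sym^{2l}(V)` (`IsModel.mem_eigenspace_iff`). Their dimensions
follow from `V ⊗ Sym^{m+1}(V) = Sym^m(V) ⊕ Sym^{m+2}(V)`, that is, from the recursion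
`n s_{m+1} = s_m + s_{m+2}` (`TwistedSym.finrank_grade`).
-/

set_option autoImplicit false

noncomputable section

namespace TwistedHyperboloid

/-! ### Generators of algebras -/

/-- If `A` is generated by the image of `g`, a subspace that contains `1` and is stable under
left multiplication by the generators is everything. -/
theorem eq_top_of_left_stable {k A W : Type*} [CommRing k] [Ring A] [Algebra k A]
    [AddCommGroup W] [Module k W] (g : W →ₗ[k] A)
    (hg : Algebra.adjoin k (Set.range g) = ⊤) (M : Submodule k A) (h1 : (1 : A) ∈ M)
    (hM : ∀ w, ∀ f ∈ M, g w * f ∈ M) : M = ⊤ := by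
  have key : ∀ a ∈ Algebra.adjoin k (Set.range g), ∀ f ∈ M, a * f ∈ M := by
    intro a ha
    induction ha using Algebra.adjoin_induction with
    | mem x hx => obtain ⟨w, rfl⟩ := hx; exact hM w
    | algebraMap r => intro f hf; rw [← Algebra.smul_def]; exact M.smul_mem r hf
    | add x y _ _ hx hy => intro f hf; rw [add_mul]; exact M.add_mem (hx f hf) (hy f hf)
    | mul x y _ _ hx hy => intro f hf; rw [mul_assoc]; exact hx _ (hy f hf)
  rw [eq_top_iff]
  intro a _
  simpa using key a (by rw [hg]; trivial) 1 h1

/-- The image of `V` generates any quotient of the tensor algebra `T(V)`. -/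
theorem adjoin_range_mkAlgHom_ι {k W : Type*} [CommRing k] [AddCommGroup W] [Module k W]
    (r : TensorAlgebra k W → TensorAlgebra k W → Prop) :
    Algebra.adjoin k (Set.range ((RingQuot.mkAlgHom k r).toLinearMap ∘ₗ
      TensorAlgebra.ι k)) = ⊤ := by
  have h : (Algebra.adjoin k (Set.range (TensorAlgebra.ι k (M := W)))).map
      (RingQuot.mkAlgHom k r) = ⊤ := by
    rw [TensorAlgebra.adjoin_range_ι, Algebra.map_top, AlgHom.range_eq_top]
    exact RingQuot.mkAlgHom_surjective k r
  rw [AlgHom.map_adjoin, ← Set.range_comp] at h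
  exact h

/-! ### Cups, caps and the twisted symmetric algebra -/

section Cup

variable {k V ι : Type*} [Field k] [AddCommGroup V] [Module k V] [Fintype ι]

/-- The bilinear form `u` (a cap) and the tensor `∑ b i ⊗ d i` (a cup) satisfy the zigzag
identities with loop value one: `∑ u(x, b i) d i = -x/2`, `∑ u(d i, x) b i = -x/2` and
`∑ u(b i, d i) = 1`. -/
structure IsCup (u : V →ₗ[k] V →ₗ[k] k) (b d : ι → V) : Prop where
  left : ∀ x, ∑ i, u x (b i) • d i = -(2⁻¹ : k) • x
  right : ∀ x, ∑ i, u (d i) x • b i = -(2⁻¹ : k) • x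
  loop : ∑ i, u (b i) (d i) = 1

variable {u : V →ₗ[k] V →ₗ[k] k} {b d : ι → V}

theorem IsCup.sum_left (h : IsCup u b d) {W : Type*} [AddCommGroup W] [Module k W]
    (F : V →ₗ[k] W) (x : V) : ∑ i, u x (b i) • F (d i) = -(2⁻¹ : k) • F x := by
  rw [← map_smul, ← h.left, map_sum]; simp

theorem IsCup.sum_right (h : IsCup u b d) {W : Type*} [AddCommGroup W] [Module k W]
    (F : V →ₗ[k] W) (x : V) : ∑ i, u (d i) x • F (b i) = -(2⁻¹ : k) • F x := by
  rw [← map_smul, ← h.right, map_sum]; simp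

/-- The defining relation `∑ b i d i = 0` of the symmetric algebra. -/
inductive CupRel (k : Type*) {V ι : Type*} [Field k] [AddCommGroup V] [Module k V] [Fintype ι]
    (b d : ι → V) : TensorAlgebra k V → TensorAlgebra k V → Prop
  | cup : CupRel k b d (∑ i, TensorAlgebra.ι k (b i) * TensorAlgebra.ι k (d i)) 0

/-- The symmetric algebra `T(V) / (∑ b i d i)` of the symmetry `Id - 2 u ⊗ v`,
`v = ∑ b i ⊗ d i`. -/
def TwistedSym (k : Type*) {V ι : Type*} [Field k] [AddCommGroup V] [Module k V] [Fintype ι]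
    (b d : ι → V) : Type _ :=
  RingQuot (CupRel k b d)

namespace TwistedSym

instance instRing : Ring (TwistedSym k b d) := inferInstanceAs (Ring (RingQuot (CupRel k b d)))

instance instAlgebra : Algebra k (TwistedSym k b d) :=
  inferInstanceAs (Algebra k (RingQuot (CupRel k b d)))

variable (k b d) in
/-- The quotient map `T(V) → Sym(V)`. -/
def proj : TensorAlgebra k V →ₐ[k] TwistedSym k b d := RingQuot.mkAlgHom k (CupRel k b d)

variable (k b d) in
/-- The inclusion `V → Sym(V)`. -/
def X : V →ₗ[k] TwistedSym k b d :=
  (proj k b d).toLinearMap ∘ₗ TensorAlgebra.ι k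

theorem sum_X_mul_X : ∑ i, X k b d (b i) * X k b d (d i) = 0 := by
  have : proj k b d (∑ i, TensorAlgebra.ι k (b i) * TensorAlgebra.ι k (d i)) = proj k b d 0 :=
    RingQuot.mkAlgHom_rel k CupRel.cup
  rw [map_sum, map_zero] at this
  rw [← this]
  exact Finset.sum_congr rfl fun i _ => (map_mul (proj k b d) _ _).symm

theorem sum_X_mul_X_mul (f : TwistedSym k b d) :
    ∑ i, X k b d (b i) * (X k b d (d i) * f) = 0 := by
  simp only [← mul_assoc, ← Finset.sum_mul, sum_X_mul_X, zero_mul]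

/-- Linear maps `F` from `V` to an algebra with `∑ F (b i) F (d i) = 0` extend to `Sym(V)`. -/
def lift {B : Type*} [Ring B] [Algebra k B] (F : V →ₗ[k] B)
    (hF : ∑ i, F (b i) * F (d i) = 0) : TwistedSym k b d →ₐ[k] B :=
  RingQuot.liftAlgHom k ⟨TensorAlgebra.lift k F, by
    rintro _ _ ⟨⟩
    simpa [map_sum] using hF⟩

@[simp]
theorem lift_X {B : Type*} [Ring B] [Algebra k B] (F : V →ₗ[k] B)
    (hF : ∑ i, F (b i) * F (d i) = 0) (x : V) : lift F hF (X k b d x) = F x := by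
  have : lift F hF (X k b d x) = TensorAlgebra.lift k F (TensorAlgebra.ι k x) :=
    RingQuot.liftAlgHom_mkAlgHom_apply k _ _ _
  rw [this, TensorAlgebra.lift_ι_apply]

theorem adjoin_range_X : Algebra.adjoin k (Set.range (X k b d)) = ⊤ :=
  adjoin_range_mkAlgHom_ι _

-- Unfolding the quotient construction is never needed from here on.
attribute [irreducible] TwistedSym instRing instAlgebra proj X lift

theorem eq_top_of_X_mul_mem (M : Submodule k (TwistedSym k b d)) (h1 : (1 : TwistedSym k b d) ∈ M)
    (hM : ∀ x, ∀ f ∈ M, X k b d x * f ∈ M) : M = ⊤ :=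
  eq_top_of_left_stable (X k b d) adjoin_range_X M h1 hM

/-- Linear maps on `Sym(V)` agree if they agree at `1` and if agreement at `f` implies
agreement at `x f`. -/
theorem linearMap_ext {W : Type*} [AddCommGroup W] [Module k W] {F G : TwistedSym k b d →ₗ[k] W}
    (h1 : F 1 = G 1)
    (hX : ∀ x f, F f = G f → F (X k b d x * f) = G (X k b d x * f)) : F = G := by
  have := eq_top_of_X_mul_mem (LinearMap.eqLocus F G) h1 hX
  ext f
  have hf : f ∈ LinearMap.eqLocus F G := by rw [this]; trivial
  exact hf

/-! ### Twisted partial derivatives -/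

variable (u b d) in
/-- The operator by which `x` acts on pairs `(f, ∂ f)`: the twisted Leibniz rule
`∂_y (x f) = u(y, x) f + x' ∂_{y'} f` with `x' ⊗ y' = y ⊗ x - 2 u(y, x) ∑ b i ⊗ d i`. -/
def jetX (x : V) :
    Module.End k (TwistedSym k b d × (V →ₗ[k] TwistedSym k b d)) where
  toFun p := (X k b d x * p.1,
    (u.flip x).smulRight (p.1 - (2 : k) • ∑ i, X k b d (b i) * p.2 (d i)) +
      (LinearMap.mul k (TwistedSym k b d)).flip (p.2 x) ∘ₗ X k b d)
  map_add' p q := by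
    refine Prod.ext (mul_add _ _ _) (LinearMap.ext fun y => ?_)
    simp [mul_add, Finset.sum_add_distrib]; module
  map_smul' a p := by
    refine Prod.ext (mul_smul_comm _ _ _) (LinearMap.ext fun y => ?_)
    simp [← Finset.smul_sum]; module

variable (u b d) in
/-- `jetX` as a linear map in `x`. -/
def jet : V →ₗ[k] Module.End k (TwistedSym k b d × (V →ₗ[k] TwistedSym k b d)) where
  toFun := jetX u b d
  map_add' x y := by
    refine LinearMap.ext fun p => Prod.ext ?_ (LinearMap.ext fun z => ?_)
    · simp [jetX, add_mul]
    · simp [jetX]; module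
  map_smul' a x := by
    refine LinearMap.ext fun p => Prod.ext ?_ (LinearMap.ext fun z => ?_)
    · simp [jetX]
    · simp [jetX]; module

theorem jet_apply_fst (x : V) (p) : (jet u b d x p).1 = X k b d x * p.1 := rfl

theorem jet_apply_snd (x : V) (p : TwistedSym k b d × (V →ₗ[k] TwistedSym k b d)) (y : V) :
    (jet u b d x p).2 y = u y x • (p.1 - (2 : k) • ∑ i, X k b d (b i) * p.2 (d i)) +
      X k b d y * p.2 x := rfl

variable [CharZero k]

theorem sum_jet_mul_jet (h : IsCup u b d) : ∑ i, jet u b d (b i) * jet u b d (d i) = 0 := by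
  refine LinearMap.ext fun p => Prod.ext ?_ (LinearMap.ext fun y => ?_)
  · simp only [LinearMap.sum_apply, Module.End.mul_apply, Prod.fst_sum, jet_apply_fst]
    exact sum_X_mul_X_mul _
  · set e := ∑ i, X k b d (b i) * p.2 (d i) with he
    -- the Euler operator applied to the second component of `jet x p`
    have h1 : ∀ x, ∑ j, X k b d (b j) * (jet u b d x p).2 (d j) =
        -(2⁻¹ : k) • (X k b d x * (p.1 - (2 : k) • e)) := by
      intro x
      simp only [jet_apply_snd, mul_add, Finset.sum_add_distrib, mul_smul_comm, sum_X_mul_X_mul,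
        add_zero, ← he]
      exact h.sum_right ((LinearMap.mul k _).flip (p.1 - (2 : k) • e) ∘ₗ X k b d) x
    have h2 : ∑ i, u y (b i) • (X k b d (d i) * ((2 : k) • p.1 - (2 : k) • e)) =
        -(2⁻¹ : k) • (X k b d y * ((2 : k) • p.1 - (2 : k) • e)) :=
      h.sum_left ((LinearMap.mul k _).flip ((2 : k) • p.1 - (2 : k) • e) ∘ₗ X k b d) y
    have h3 : ∑ i, X k b d y * (jet u b d (d i) p).2 (b i) =
        X k b d y * (p.1 - (2 : k) • e) + X k b d y * e := by
      rw [← Finset.mul_sum, ← mul_add]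
      simp only [jet_apply_snd, Finset.sum_add_distrib, ← Finset.sum_smul, h.loop, one_smul, ← he]
    have h4 : ∑ i, (jet u b d (b i) (jet u b d (d i) p)).2 y =
        ∑ i, (u y (b i) • (X k b d (d i) * ((2 : k) • p.1 - (2 : k) • e)) +
          X k b d y * (jet u b d (d i) p).2 (b i)) := by
      refine Finset.sum_congr rfl fun i _ => ?_
      rw [jet_apply_snd, h1, jet_apply_fst]
      congr 2
      simp only [mul_sub, mul_smul_comm]
      module
    simp only [LinearMap.sum_apply, Module.End.mul_apply, Prod.snd_sum, LinearMap.zero_apply,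
      Prod.snd_zero]
    rw [h4, Finset.sum_add_distrib, h2, h3]
    simp only [mul_sub, mul_smul_comm]
    module

/-- The action of `Sym(V)` on jets. -/
def jetHom (h : IsCup u b d) :
    TwistedSym k b d →ₐ[k] Module.End k (TwistedSym k b d × (V →ₗ[k] TwistedSym k b d)) :=
  lift (B := Module.End k (TwistedSym k b d × (V →ₗ[k] TwistedSym k b d))) (jet u b d)
    (sum_jet_mul_jet h)

/-- The first jet `(f, ∂ f)` of `f`. -/
def jetOf (h : IsCup u b d) :
    TwistedSym k b d →ₗ[k] TwistedSym k b d × (V →ₗ[k] TwistedSym k b d) where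
  toFun f := jetHom h f (1, 0)
  map_add' f g := by rw [map_add, LinearMap.add_apply]
  map_smul' a f := by rw [map_smul, LinearMap.smul_apply, RingHom.id_apply]

theorem jetOf_one (h : IsCup u b d) : jetOf h 1 = (1, 0) := by
  change jetHom h 1 (1, 0) = _
  rw [map_one, Module.End.one_apply]

theorem jetOf_X_mul (h : IsCup u b d) (x : V) (f : TwistedSym k b d) :
    jetOf h (X k b d x * f) = jet u b d x (jetOf h f) := by
  change jetHom h (X k b d x * f) (1, 0) = jet u b d x (jetHom h f (1, 0))
  rw [map_mul, Module.End.mul_apply, jetHom, lift_X]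

theorem jetOf_fst (h : IsCup u b d) (f : TwistedSym k b d) : (jetOf h f).1 = f := by
  have : LinearMap.fst k _ _ ∘ₗ jetOf h = LinearMap.id := by
    refine linearMap_ext ?_ fun x f hf => ?_
    · rw [LinearMap.comp_apply, jetOf_one]; rfl
    · rw [LinearMap.comp_apply, jetOf_X_mul, LinearMap.fst_apply, jet_apply_fst]
      exact congrArg _ hf
  exact LinearMap.congr_fun this f

/-- The twisted partial derivatives `∂_y` of `Sym(V)`, determined by `∂_y 1 = 0` and the
twisted Leibniz rule. -/
def pd (h : IsCup u b d) : V →ₗ[k] Module.End k (TwistedSym k b d) :=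
  LinearMap.flip (LinearMap.snd k _ _ ∘ₗ jetOf h)

variable (h : IsCup u b d)

@[simp]
theorem pd_one (y : V) : pd h y 1 = 0 := by
  change (jetOf h 1).2 y = 0
  rw [jetOf_one]; rfl

/-- The number operator, `-2 ∑ b i ∂_{d i}`. -/
def num (h : IsCup u b d) : Module.End k (TwistedSym k b d) :=
  -(2 : k) • ∑ i, LinearMap.mulLeft k (X k b d (b i)) ∘ₗ pd h (d i)

theorem sum_X_pd (f : TwistedSym k b d) :
    ∑ i, X k b d (b i) * pd h (d i) f = -(2⁻¹ : k) • num h f := by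
  simp [num, LinearMap.sum_apply, smul_smul]

theorem pd_X_mul (y x : V) (f : TwistedSym k b d) :
    pd h y (X k b d x * f) = X k b d y * pd h x f + u y x • (num h f + f) := by
  have h2 : ∀ f y, (jetOf h f).2 y = pd h y f := fun _ _ => rfl
  rw [← h2, jetOf_X_mul, jet_apply_snd, jetOf_fst]
  simp only [h2, sum_X_pd]
  module

theorem num_one : num h 1 = 0 := by simp [num]

theorem num_X_mul (x : V) (f : TwistedSym k b d) :
    num h (X k b d x * f) = X k b d x * num h f + X k b d x * f := by
  have h1 := h.sum_right ((LinearMap.mul k _).flip (num h f + f) ∘ₗ X k b d) x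
  have h2 := sum_X_pd h (X k b d x * f)
  simp only [pd_X_mul, mul_add, Finset.sum_add_distrib, mul_smul_comm, sum_X_mul_X_mul,
    zero_add] at h2
  simp only [LinearMap.comp_apply, LinearMap.flip_apply, LinearMap.mul_apply', mul_add, smul_add,
    Finset.sum_add_distrib] at h1
  simp only [smul_add, Finset.sum_add_distrib] at h2
  rw [h1] at h2
  have h3 : -(2⁻¹ : k) • num h (X k b d x * f) =
      -(2⁻¹ : k) • (X k b d x * num h f + X k b d x * f) := by rw [← h2, smul_add]
  exact smul_right_injective _ (by simp : -(2⁻¹ : k) ≠ 0) h3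

theorem pd_num (y : V) (f : TwistedSym k b d) : pd h y (num h f) = num h (pd h y f) + pd h y f := by
  have : (pd h).flip ∘ₗ num h = ((pd h).compr₂ (num h + LinearMap.id)).flip := by
    refine linearMap_ext (LinearMap.ext fun y => by simp [num_one])
      fun x f hf => LinearMap.ext fun y => ?_
    have hf' : ∀ y, pd h y (num h f) = num h (pd h y f) + pd h y f :=
      fun y => LinearMap.congr_fun hf y
    simp only [LinearMap.comp_apply, LinearMap.flip_apply, LinearMap.compr₂_apply,
      LinearMap.add_apply, LinearMap.id_apply, num_X_mul, map_add, map_smul, pd_X_mul, hf',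
      mul_add]
    module
  exact LinearMap.congr_fun (LinearMap.congr_fun this f) y

theorem sum_pd_X (f : TwistedSym k b d) :
    ∑ i, pd h (b i) (X k b d (d i) * f) = (2⁻¹ : k) • num h f + f := by
  simp only [pd_X_mul, Finset.sum_add_distrib, sum_X_pd, ← Finset.sum_smul, h.loop]
  module

theorem sum_pd_pd (f : TwistedSym k b d) : ∑ i, pd h (b i) (pd h (d i) f) = 0 := by
  have : ∑ i, pd h (b i) ∘ₗ pd h (d i) = 0 := by
    refine linearMap_ext (by simp) fun x f _ => ?_
    have h1 := h.sum_right ((pd h).flip (num h f + f)) x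
    simp only [LinearMap.flip_apply] at h1
    simp only [LinearMap.sum_apply, LinearMap.comp_apply, pd_X_mul h _ x, map_add, map_smul,
      Finset.sum_add_distrib, sum_pd_X, LinearMap.zero_apply]
    simp only [map_add, smul_add, Finset.sum_add_distrib] at h1 ⊢
    rw [h1, pd_num]
    module
  simpa using LinearMap.congr_fun this f

end TwistedSym
end Cup

section Cup

variable {k V ι : Type*} [Field k] [AddCommGroup V] [Module k V] [Fintype ι]
variable {u : V →ₗ[k] V →ₗ[k] k} {b d : ι → V}

namespace TwistedSym

/-! ### The grading of the symmetric algebra -/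

variable (k b d) in
/-- The augmentation `Sym(V) → k`. -/
def aug : TwistedSym k b d →ₐ[k] k := lift 0 (by simp)

variable (k b d) in
/-- The grading of `Sym(V)`, as the coaction `x ↦ x t` with values in `Sym(V)[t]`. -/
def dec : TwistedSym k b d →ₐ[k] Polynomial (TwistedSym k b d) :=
  lift ((Polynomial.monomial 1).restrictScalars k ∘ₗ X k b d) (by
    simp only [LinearMap.comp_apply, LinearMap.restrictScalars_apply,
      Polynomial.monomial_mul_monomial, ← map_sum, sum_X_mul_X, map_zero])

theorem dec_X (x : V) : dec k b d (X k b d x) = Polynomial.monomial 1 (X k b d x) := by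
  simp [dec]

variable (k b d) in
/-- The homogeneous component of degree `m` of `Sym(V)`. -/
def grade (m : ℕ) : Submodule k (TwistedSym k b d) :=
  LinearMap.eqLocus (dec k b d).toLinearMap ((Polynomial.monomial m).restrictScalars k)

theorem mem_grade {m : ℕ} {f : TwistedSym k b d} :
    f ∈ grade k b d m ↔ dec k b d f = Polynomial.monomial m f := Iff.rfl

theorem one_mem_grade : (1 : TwistedSym k b d) ∈ grade k b d 0 := by
  rw [mem_grade, map_one]; rfl

theorem X_mul_mem_grade {m : ℕ} {f : TwistedSym k b d} (x : V) (hf : f ∈ grade k b d m) :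
    X k b d x * f ∈ grade k b d (m + 1) := by
  rw [mem_grade] at *
  rw [map_mul, dec_X, hf, Polynomial.monomial_mul_monomial, add_comm]

theorem iSup_grade : ⨆ m, grade k b d m = ⊤ := by
  refine eq_top_of_X_mul_mem _ (Submodule.mem_iSup_of_mem 0 one_mem_grade) fun x f hf => ?_
  induction hf using Submodule.iSup_induction' with
  | mem m f hf => exact Submodule.mem_iSup_of_mem _ (X_mul_mem_grade x hf)
  | zero => simp
  | add f g _ _ hf hg => rw [mul_add]; exact add_mem hf hg

/-- Linear maps on `Sym(V)` agree if they agree on homogeneous elements. -/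
theorem linearMap_ext_grade {W : Type*} [AddCommGroup W] [Module k W]
    {F G : TwistedSym k b d →ₗ[k] W} (h : ∀ m, ∀ f ∈ grade k b d m, F f = G f) : F = G := by
  have : (⊤ : Submodule k (TwistedSym k b d)) ≤ LinearMap.eqLocus F G := by
    rw [← iSup_grade, iSup_le_iff]
    exact h
  exact LinearMap.ext fun f => this trivial

variable (k b d) in
/-- The component of degree `m`. -/
def comp (m : ℕ) : TwistedSym k b d →ₗ[k] TwistedSym k b d :=
  (Polynomial.lcoeff (TwistedSym k b d) m).restrictScalars k ∘ₗ (dec k b d).toLinearMap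

theorem comp_of_mem {m : ℕ} {f : TwistedSym k b d} (hf : f ∈ grade k b d m) (j : ℕ) :
    comp k b d j f = if m = j then f else 0 := by
  change (dec k b d f).coeff j = _
  rw [mem_grade.1 hf, Polynomial.coeff_monomial]

/-- The linear map that is `φ m` in degree `m`. -/
def gsum {W : Type*} [AddCommGroup W] [Module k W] (φ : ℕ → TwistedSym k b d →ₗ[k] W) :
    TwistedSym k b d →ₗ[k] W where
  toFun f := (dec k b d f).sum fun m a => φ m a
  map_add' f g := by
    rw [map_add]
    exact Polynomial.sum_add_index _ _ _ (fun m => map_zero (φ m)) (fun m => map_add (φ m))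
  map_smul' a f := by
    rw [map_smul, Polynomial.sum_smul_index' _ _ _ (fun m => map_zero (φ m)), RingHom.id_apply,
      Polynomial.sum_def, Polynomial.sum_def, Finset.smul_sum]
    simp only [map_smul]

theorem gsum_of_mem {W : Type*} [AddCommGroup W] [Module k W]
    (φ : ℕ → TwistedSym k b d →ₗ[k] W) {m : ℕ} {f : TwistedSym k b d} (hf : f ∈ grade k b d m) :
    gsum φ f = φ m f := by
  change (dec k b d f).sum _ = _
  rw [mem_grade.1 hf]
  exact Polynomial.sum_monomial_index _ _ (map_zero (φ m))

/-- An element of `Sym(V)` all of whose components vanish is zero. -/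
theorem eq_zero_of_comp (f : TwistedSym k b d) (hf : ∀ m, comp k b d m f = 0) : f = 0 := by
  have h1 : gsum (fun _ => LinearMap.id) =
      (LinearMap.id : TwistedSym k b d →ₗ[k] TwistedSym k b d) :=
    linearMap_ext_grade fun m f hf => gsum_of_mem _ hf
  have h2 : dec k b d f = 0 := Polynomial.ext hf
  rw [← LinearMap.id_apply (R := k) f, ← h1]
  change (dec k b d f).sum _ = _
  rw [h2, Polynomial.sum_zero_index]

theorem eq_aug_smul_one {f : TwistedSym k b d} (hf : f ∈ grade k b d 0) : f = aug k b d f • 1 := by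
  have h1 : gsum (fun m => if m = 0 then (aug k b d).toLinearMap.smulRight 1 else LinearMap.id) =
      (LinearMap.id : TwistedSym k b d →ₗ[k] TwistedSym k b d) := by
    refine linearMap_ext ?_ fun x f _ => ?_
    · rw [gsum_of_mem _ one_mem_grade]; simp
    · have : gsum (fun m => if m = 0 then (aug k b d).toLinearMap.smulRight 1
            else LinearMap.id) ∘ₗ LinearMap.mulLeft k (X k b d x) =
          LinearMap.mulLeft k (X k b d x) :=
        linearMap_ext_grade fun m f hf => by
          rw [LinearMap.comp_apply, LinearMap.mulLeft_apply,
            gsum_of_mem _ (X_mul_mem_grade x hf)]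
          simp
      exact LinearMap.congr_fun this f
  have h2 := LinearMap.congr_fun h1 f
  rw [gsum_of_mem _ hf] at h2
  simpa using h2.symm

theorem finrank_grade_zero : Module.finrank k (grade k b d 0) = 1 := by
  refine finrank_eq_one_iff'.2 ⟨⟨1, one_mem_grade⟩, fun h0 => ?_, fun f => ?_⟩
  · have h1 : (1 : TwistedSym k b d) = 0 := congrArg Subtype.val h0
    have := congrArg (aug k b d) h1
    simp at this
  · exact ⟨aug k b d f, Subtype.ext (eq_aug_smul_one f.2).symm⟩

variable [CharZero k] (h : IsCup u b d)

theorem num_of_mem {m : ℕ} {f : TwistedSym k b d} (hf : f ∈ grade k b d m) :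
    num h f = (m : k) • f := by
  have h1 : num h = gsum (fun m => (m : k) • LinearMap.id) := by
    refine linearMap_ext ?_ fun x f hf => ?_
    · rw [gsum_of_mem _ one_mem_grade, num_one]; simp
    · have : gsum (fun m => (m : k) • LinearMap.id) ∘ₗ LinearMap.mulLeft k (X k b d x) =
          LinearMap.mulLeft k (X k b d x) ∘ₗ gsum (fun m => (m : k) • LinearMap.id) +
            LinearMap.mulLeft k (X k b d x) :=
        linearMap_ext_grade fun m f hf => by
          rw [LinearMap.comp_apply, LinearMap.mulLeft_apply,
            gsum_of_mem _ (X_mul_mem_grade x hf), LinearMap.add_apply, LinearMap.comp_apply,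
            gsum_of_mem _ hf]
          simp [add_smul]
      rw [num_X_mul, hf]
      exact (LinearMap.congr_fun this f).symm
  rw [h1, gsum_of_mem _ hf]; rfl

theorem comp_num (j : ℕ) (f : TwistedSym k b d) :
    comp k b d j (num h f) = (j : k) • comp k b d j f := by
  have : comp k b d j ∘ₗ num h = (j : k) • comp k b d j :=
    linearMap_ext_grade fun m f hf => by
      rw [LinearMap.comp_apply, num_of_mem h hf, map_smul, LinearMap.smul_apply, comp_of_mem hf]
      split_ifs with hm
      · rw [hm]
      · simp
  exact LinearMap.congr_fun this f

theorem mem_grade_iff_num {m : ℕ} {f : TwistedSym k b d} :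
    f ∈ grade k b d m ↔ num h f = (m : k) • f := by
  refine ⟨num_of_mem h, fun hf => ?_⟩
  have h1 : ∀ j, j ≠ m → comp k b d j f = 0 := by
    intro j hj
    have h2 := comp_num h j f
    rw [hf, map_smul, ← sub_eq_zero, ← sub_smul, smul_eq_zero, sub_eq_zero, Nat.cast_inj] at h2
    exact h2.resolve_left hj.symm
  have h3 : dec k b d f = Polynomial.monomial m (comp k b d m f) := by
    ext j
    rw [Polynomial.coeff_monomial]
    split_ifs with hj
    · rw [hj]; rfl
    · exact h1 j (Ne.symm hj)
  have h4 : comp k b d m f = f := by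
    have hz : (LinearMap.id : TwistedSym k b d →ₗ[k] TwistedSym k b d) 0 = 0 := map_zero _
    have h1 : gsum (fun _ => LinearMap.id) =
        (LinearMap.id : TwistedSym k b d →ₗ[k] TwistedSym k b d) :=
      linearMap_ext_grade fun m f hf => gsum_of_mem _ hf
    have h2 := LinearMap.congr_fun h1 f
    change (dec k b d f).sum _ = _ at h2
    rw [h3, Polynomial.sum_monomial_index _ _ hz] at h2
    exact h2
  rw [mem_grade, h3, h4]

theorem pd_mem_grade {m : ℕ} {f : TwistedSym k b d} (y : V) (hf : f ∈ grade k b d (m + 1)) :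
    pd h y f ∈ grade k b d m := by
  rw [mem_grade_iff_num h] at *
  have := pd_num h y f
  rw [hf, map_smul] at this
  rw [← add_right_cancel_iff (a := pd h y f), ← this]
  push_cast; module

theorem pd_of_mem_grade_zero {f : TwistedSym k b d} (y : V) (hf : f ∈ grade k b d 0) :
    pd h y f = 0 := by
  rw [eq_aug_smul_one hf]; simp

/-- Euler's formula. -/
theorem eq_sum_X_pd {m : ℕ} {f : TwistedSym k b d} (hf : f ∈ grade k b d (m + 1)) :
    f = -(2 / (m + 1) : k) • ∑ i, X k b d (b i) * pd h (d i) f := by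
  have : (m + 1 : k) ≠ 0 := by exact_mod_cast Nat.succ_ne_zero m
  rw [sum_X_pd, num_of_mem h hf, smul_smul, smul_smul]
  push_cast
  field_simp
  simp

/-! ### Dimensions of the homogeneous components -/

theorem finite_grade (h : IsCup u b d) (m : ℕ) : Module.Finite k (grade k b d m) := by
  induction m with
  | zero => exact Module.finite_of_finrank_eq_succ finrank_grade_zero
  | succ m ih =>
    let F : (ι → grade k b d m) →ₗ[k] grade k b d (m + 1) :=
      LinearMap.codRestrict _ (∑ i, LinearMap.mulLeft k (X k b d (b i)) ∘ₗ
        (grade k b d m).subtype ∘ₗ LinearMap.proj i) (fun c => by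
          simp only [LinearMap.sum_apply]
          exact sum_mem fun i _ => X_mul_mem_grade _ (c i).2)
    refine Module.Finite.of_surjective F fun f => ?_
    refine ⟨fun i => ⟨-(2 / (m + 1) : k) • pd h (d i) f,
      Submodule.smul_mem _ _ (pd_mem_grade h _ f.2)⟩, Subtype.ext ?_⟩
    conv_rhs => rw [eq_sum_X_pd h f.2]
    simp [F, LinearMap.sum_apply, Finset.smul_sum]

variable [DecidableEq ι]

/-- `V ⊗ Sym^{m+1}(V) = Sym^m(V) ⊕ Sym^{m+2}(V)`, by `x ⊗ f ↦ (∂_x f, x f)`. -/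
theorem finrank_grade_succ_succ (h : IsCup u b d)
    (hu : ∀ i j, u (d j) (b i) = if i = j then -(2⁻¹ : k) else 0)
    (m : ℕ) : Fintype.card ι * Module.finrank k (grade k b d (m + 1)) =
      Module.finrank k (grade k b d m) + Module.finrank k (grade k b d (m + 2)) := by
  have := finite_grade h
  have h2 : (m + 2 : k) ≠ 0 := by exact_mod_cast Nat.succ_ne_zero (m + 1)
  let F : (ι → grade k b d (m + 1)) →ₗ[k] grade k b d m × grade k b d (m + 2) :=
    LinearMap.prod
      (LinearMap.codRestrict _ (∑ i, pd h (b i) ∘ₗ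
        (grade k b d (m + 1)).subtype ∘ₗ LinearMap.proj i) (fun c => by
          simp only [LinearMap.sum_apply]
          exact sum_mem fun i _ => pd_mem_grade h _ (c i).2))
      (LinearMap.codRestrict _ (∑ i, LinearMap.mulLeft k (X k b d (b i)) ∘ₗ
        (grade k b d (m + 1)).subtype ∘ₗ LinearMap.proj i) (fun c => by
          simp only [LinearMap.sum_apply]
          exact sum_mem fun i _ => X_mul_mem_grade _ (c i).2))
  have hF1 : ∀ c, ((F c).1 : TwistedSym k b d) = ∑ i, pd h (b i) (c i) := by
    intro c; simp [F, LinearMap.sum_apply]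
  have hF2 : ∀ c, ((F c).2 : TwistedSym k b d) = ∑ i, X k b d (b i) * (c i) := by
    intro c; simp [F, LinearMap.sum_apply]
  have hinj : Function.Injective F := by
    rw [← LinearMap.ker_eq_bot, LinearMap.ker_eq_bot']
    intro c hc
    funext j
    refine Subtype.ext ?_
    have e1 : ∑ i, pd h (b i) (c i) = 0 := by rw [← hF1, hc]; rfl
    have e2 : ∑ i, X k b d (b i) * (c i : TwistedSym k b d) = 0 := by rw [← hF2, hc]; rfl
    have e3 := congrArg (pd h (d j)) e2
    simp only [map_sum, pd_X_mul, Finset.sum_add_distrib, ← Finset.mul_sum, e1, hu,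
      num_of_mem h (c _).2] at e3
    simp only [ite_smul, zero_smul, Finset.sum_ite_eq', Finset.mem_univ, if_true, map_zero,
      mul_zero, zero_add] at e3
    have e4 : (m + 2 : k) • (c j : TwistedSym k b d) = 0 := by
      have e5 := congrArg (fun z => (-2 : k) • z) e3
      simp only [smul_zero] at e5
      rw [← e5]
      push_cast; module
    simpa [h2] using e4
  have hsurj : Function.Surjective F := by
    rintro ⟨g, f⟩
    refine ⟨fun i => ⟨(2 / (m + 2) : k) • (X k b d (d i) * g - pd h (d i) f),
      Submodule.smul_mem _ _ (sub_mem (X_mul_mem_grade _ g.2) (pd_mem_grade h _ f.2))⟩,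
      Prod.ext (Subtype.ext ?_) (Subtype.ext ?_)⟩
    · rw [hF1]
      simp only [map_smul, map_sub, ← Finset.smul_sum, Finset.sum_sub_distrib, sum_pd_pd,
        sum_pd_X, num_of_mem h g.2]
      have h3 : (2⁻¹ * m + 1 : k) * (2 / (m + 2)) = 1 := by field_simp
      have h4 : (2⁻¹ : k) • (m : k) • (g : TwistedSym k b d) + g =
          (2⁻¹ * m + 1 : k) • (g : TwistedSym k b d) := by
        module
      rw [sub_zero, h4, smul_smul, mul_comm, h3, one_smul]
    · rw [hF2]
      simp only [mul_smul_comm, mul_sub, ← Finset.smul_sum, Finset.sum_sub_distrib,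
        sum_X_mul_X_mul, sum_X_pd, num_of_mem h f.2]
      rw [zero_sub, smul_smul, ← neg_smul, smul_smul]
      push_cast
      field_simp
      simp
  have := (LinearEquiv.ofBijective F ⟨hinj, hsurj⟩).finrank_eq
  rw [Module.finrank_pi_fintype, Module.finrank_prod] at this
  simpa using this

theorem finrank_grade_one (h : IsCup u b d)
    (hu : ∀ i j, u (d j) (b i) = if i = j then -(2⁻¹ : k) else 0) :
    Module.finrank k (grade k b d 1) = Fintype.card ι := by
  have := finite_grade h
  let F : (ι → k) →ₗ[k] grade k b d 1 :=
    LinearMap.codRestrict _ (∑ i, (LinearMap.proj i).smulRight (X k b d (b i))) (fun c => by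
      simp only [LinearMap.sum_apply]
      refine sum_mem fun i _ => Submodule.smul_mem _ _ ?_
      simpa using X_mul_mem_grade (b i) (one_mem_grade (k := k) (b := b) (d := d)))
  have hF : ∀ c, (F c : TwistedSym k b d) = ∑ i, c i • X k b d (b i) := by
    intro c; simp [F, LinearMap.sum_apply]
  have hpd : ∀ x y, pd h y (X k b d x) = u y x • 1 := by
    intro x y
    have := pd_X_mul h y x 1
    simpa [num_one] using this
  have hinj : Function.Injective F := by
    rw [← LinearMap.ker_eq_bot, LinearMap.ker_eq_bot']
    intro c hc
    funext j
    have e2 : ∑ i, c i • X k b d (b i) = 0 := by rw [← hF, hc]; rfl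
    have e3 := congrArg (aug k b d) (congrArg (pd h (d j)) e2)
    simpa [map_sum, hpd, hu] using e3
  have hsurj : Function.Surjective F := by
    intro f
    refine ⟨fun i => -2 * aug k b d (pd h (d i) f), Subtype.ext ?_⟩
    rw [hF]
    conv_rhs => rw [eq_sum_X_pd h f.2]
    rw [Finset.smul_sum]
    refine Finset.sum_congr rfl fun i _ => ?_
    have := eq_aug_smul_one (pd_mem_grade h (d i) f.2)
    conv_rhs => rw [this]
    rw [mul_smul_comm, mul_one, smul_smul]
    simp
  have := (LinearEquiv.ofBijective F ⟨hinj, hsurj⟩).finrank_eq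
  rw [← this]; simp

/-- The dimensions of the homogeneous components of `Sym(V)` in terms of the roots of
`1 - n t + t²`. -/
theorem finrank_grade (h : IsCup u b d)
    (hu : ∀ i j, u (d j) (b i) = if i = j then -(2⁻¹ : k) else 0)
    {α₁ α₂ : ℝ} (hα : α₁ ≠ α₂) (hα₁ : 1 - (Fintype.card ι : ℝ) * α₁ + α₁ ^ 2 = 0)
    (hα₂ : 1 - (Fintype.card ι : ℝ) * α₂ + α₂ ^ 2 = 0) (m : ℕ) :
    (Module.finrank k (grade k b d m) : ℝ) = (α₂ ^ (m + 1) - α₁ ^ (m + 1)) / (α₂ - α₁) := by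
  have hne : α₂ - α₁ ≠ 0 := sub_ne_zero.2 hα.symm
  have hn : α₁ + α₂ = Fintype.card ι := by
    have : (α₂ - α₁) * (α₁ + α₂ - Fintype.card ι) = 0 := by linear_combination hα₂ - hα₁
    linarith [(mul_eq_zero.1 this).resolve_left hne]
  induction m using Nat.strong_induction_on with
  | _ m ih =>
    match m, ih with
    | 0, _ => rw [finrank_grade_zero]; simp [hne]
    | 1, _ =>
      rw [finrank_grade_one h hu, eq_div_iff hne, ← hn]; ring
    | m + 2, ih =>
      have h1 := ih m (by omega)
      have h2 := ih (m + 1) (by omega)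
      have h3 := congrArg (Nat.cast (R := ℝ)) (finrank_grade_succ_succ h hu m)
      push_cast at h3
      rw [h1, h2] at h3
      rw [eq_div_iff hne]
      field_simp at h3
      linear_combination -h3 + α₁ ^ (m + 1) * hα₁ - α₂ ^ (m + 1) * hα₂

end TwistedSym
end Cup

/-- Variant of `eq_top_of_left_stable` for generators `g x y` that are bilinear in `x`, `y`. -/
theorem eq_top_of_left_stable₂ {k A V : Type*} [CommRing k] [Ring A] [Algebra k A]
    [AddCommGroup V] [Module k V] (g : V →ₗ[k] V →ₗ[k] A)
    (hg : Algebra.adjoin k (Set.range (TensorProduct.lift g)) = ⊤) (M : Submodule k A)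
    (h1 : (1 : A) ∈ M) (hM : ∀ x y, ∀ f ∈ M, g x y * f ∈ M) : M = ⊤ := by
  refine eq_top_of_left_stable (TensorProduct.lift g) hg M h1 fun w f hf => ?_
  induction w with
  | zero => simp
  | tmul x y => simpa using hM x y f hf
  | add w w' hw hw' => rw [map_add, add_mul]; exact add_mem hw hw'

section Cup

variable {k V ι : Type*} [Field k] [AddCommGroup V] [Module k V] [Fintype ι]
variable {u : V →ₗ[k] V →ₗ[k] k} {b d : ι → V}

/-- Bilinear elements `g x y` of an algebra which satisfy the defining relations of the twisted
hyperboloid: `∑ g (b i) (d i) = 0` and `∑ g x (b i) g (d i) y = K u(x, y)`. -/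
structure IsHyp (u : V →ₗ[k] V →ₗ[k] k) (b d : ι → V) (K : k) {A : Type*} [Ring A] [Algebra k A]
    (g : V →ₗ[k] V →ₗ[k] A) : Prop where
  cup : ∑ i, g (b i) (d i) = 0
  zigzag : ∀ x y, ∑ i, g x (b i) * g (d i) y = (K * u x y) • 1

namespace TwistedSym

/-! ### The model of the hyperboloid on the even part of the symmetric algebra -/

variable (k b d) in
/-- The even part of `Sym(V)`. -/
def even : Submodule k (TwistedSym k b d) := ⨆ j : ℕ, grade k b d (2 * j)

theorem mem_even {j : ℕ} {f : TwistedSym k b d} (hf : f ∈ grade k b d (2 * j)) :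
    f ∈ even k b d := Submodule.mem_iSup_of_mem j hf

/-- Linear maps agree on the even part if they agree on its homogeneous elements. -/
theorem eq_of_mem_even {W : Type*} [AddCommGroup W] [Module k W]
    {F G : TwistedSym k b d →ₗ[k] W} (h : ∀ j, ∀ f ∈ grade k b d (2 * j), F f = G f)
    {f : TwistedSym k b d} (hf : f ∈ even k b d) : F f = G f := by
  have : even k b d ≤ LinearMap.eqLocus F G := by
    rw [even, iSup_le_iff]
    exact h
  exact this hf

/-- The coefficient of `∂_x ∂_y` in degree `m` in the action of the generators of the
hyperboloid. The operator `x y + κ(N) ∂_x ∂_y` is used on the even part only, where the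
denominator does not vanish. -/
def kap (K : k) (m : ℕ) : k := 2 * K / ((m - 1) * (m + 1))

variable (b d) in
/-- The operator that multiplies by `kap K m` in degree `m`. -/
def kapOp (K : k) : Module.End k (TwistedSym k b d) := gsum fun m => kap K m • LinearMap.id

theorem kapOp_of_mem (K : k) {m : ℕ} {f : TwistedSym k b d} (hf : f ∈ grade k b d m) :
    kapOp b d K f = kap K m • f := by
  rw [kapOp, gsum_of_mem _ hf]; rfl

variable [CharZero k] (h : IsCup u b d)

/-- The operator `x y + κ(N) ∂_x ∂_y` by which a generator of the hyperboloid acts. -/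
def hypL (K : k) : V →ₗ[k] V →ₗ[k] Module.End k (TwistedSym k b d) :=
  LinearMap.mk₂ k (fun x y => LinearMap.mulLeft k (X k b d x * X k b d y) +
      pd h x ∘ₗ pd h y ∘ₗ kapOp b d K)
    (fun _ _ _ => LinearMap.ext fun _ => by simp [add_mul, mul_assoc]; abel)
    (fun _ _ _ => LinearMap.ext fun _ => by simp [smul_add, mul_assoc])
    (fun _ _ _ => LinearMap.ext fun _ => by simp [mul_add, add_mul, mul_assoc]; abel)
    (fun _ _ _ => LinearMap.ext fun _ => by simp [smul_add, mul_assoc])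

theorem hypL_apply (K : k) (x y : V) (f : TwistedSym k b d) :
    hypL h K x y f = X k b d x * (X k b d y * f) + pd h x (pd h y (kapOp b d K f)) := by
  simp [hypL]

theorem hypL_of_mem (K : k) (x y : V) {m : ℕ} {f : TwistedSym k b d} (hf : f ∈ grade k b d m) :
    hypL h K x y f = X k b d x * (X k b d y * f) + kap K m • pd h x (pd h y f) := by
  simp [hypL_apply, kapOp_of_mem K hf]

theorem pd_pd_mem (x y : V) {j : ℕ} {f : TwistedSym k b d} (hf : f ∈ grade k b d (2 * (j + 1))) :
    pd h x (pd h y f) ∈ grade k b d (2 * j) :=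
  pd_mem_grade h x (pd_mem_grade h y hf)

theorem hypL_mem_even (K : k) (x y : V) {f : TwistedSym k b d} (hf : f ∈ even k b d) :
    hypL h K x y f ∈ even k b d := by
  have : even k b d ≤ (even k b d).comap (hypL h K x y) := by
    conv_lhs => rw [even]
    refine iSup_le fun j f hf => ?_
    rw [Submodule.mem_comap, hypL_of_mem h K x y hf]
    refine add_mem (mem_even (j := j + 1) (X_mul_mem_grade x (X_mul_mem_grade y hf)))
      (Submodule.smul_mem _ _ ?_)
    cases j with
    | zero => rw [pd_of_mem_grade_zero h y hf]; simp
    | succ j => exact mem_even (pd_pd_mem h x y hf)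
  exact this hf

/-- The action of the generators of the hyperboloid on the even part. -/
def evenL (K : k) : V →ₗ[k] V →ₗ[k] Module.End k (even k b d) :=
  LinearMap.mk₂ k (fun x y => (hypL h K x y).restrict fun _ hf => hypL_mem_even h K x y hf)
    (fun _ _ _ => LinearMap.ext fun _ => Subtype.ext (by simp [LinearMap.restrict_apply]))
    (fun _ _ _ => LinearMap.ext fun _ => Subtype.ext (by simp [LinearMap.restrict_apply]))
    (fun _ _ _ => LinearMap.ext fun _ => Subtype.ext (by simp [LinearMap.restrict_apply]))
    (fun _ _ _ => LinearMap.ext fun _ => Subtype.ext (by simp [LinearMap.restrict_apply]))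

theorem coe_evenL (K : k) (x y : V) (f : even k b d) :
    (evenL h K x y f : TwistedSym k b d) = hypL h K x y f := rfl

theorem two_mul_sub_one_ne_zero (j : ℕ) : (2 * j - 1 : k) ≠ 0 := by
  have : ((2 * j - 1 : ℤ) : k) ≠ 0 := Int.cast_ne_zero.2 (by omega)
  simpa using this

theorem two_mul_add_one_ne_zero (j : ℕ) : (2 * j + 1 : k) ≠ 0 := by
  exact_mod_cast Nat.succ_ne_zero (2 * j)

theorem two_mul_add_three_ne_zero (j : ℕ) : (2 * j + 3 : k) ≠ 0 := by
  exact_mod_cast Nat.succ_ne_zero (2 * j + 2)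

theorem num_pd {m : ℕ} {f : TwistedSym k b d} (hf : f ∈ grade k b d m) (y : V) :
    num h (pd h y f) = (m - 1 : k) • pd h y f := by
  have := pd_num h y f
  rw [num_of_mem h hf, map_smul] at this
  rw [sub_smul, this]; module

/-- The operators `x y + κ(N) ∂_x ∂_y` satisfy the relations of the hyperboloid. -/
theorem isHyp_evenL (K : k) :
    IsHyp (A := Module.End k (even k b d)) u b d K (evenL h K) where
  cup := by
    refine LinearMap.ext fun f => Subtype.ext ?_
    simp only [LinearMap.sum_apply, Submodule.coe_sum, coe_evenL, hypL_apply,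
      Finset.sum_add_distrib, sum_X_mul_X_mul, sum_pd_pd, add_zero]
    rfl
  zigzag x y := by
    refine LinearMap.ext fun f => Subtype.ext ?_
    simp only [LinearMap.sum_apply, Submodule.coe_sum, Module.End.mul_apply, coe_evenL,
      LinearMap.smul_apply, Module.End.one_apply, Submodule.coe_smul]
    have key : ∀ j, ∀ f ∈ grade k b d (2 * j),
        (∑ i, hypL h K x (b i) ∘ₗ hypL h K (d i) y) f =
          ((K * u x y) • (LinearMap.id : TwistedSym k b d →ₗ[k] TwistedSym k b d)) f := by
      intro j f hf
      obtain ⟨a, ha⟩ : ∃ a : k, ∀ z, kapOp b d K (pd h z (pd h y f)) =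
          a • pd h z (pd h y f) := by
        cases j with
        | zero => exact ⟨0, fun z => by rw [pd_of_mem_grade_zero h y hf]; simp⟩
        | succ j => exact ⟨_, fun z => kapOp_of_mem K (pd_pd_mem h z y hf)⟩
      have hyf := X_mul_mem_grade y hf
      have e1 := two_mul_sub_one_ne_zero (k := k) j
      have e2 := two_mul_add_one_ne_zero (k := k) j
      have e3 := two_mul_add_three_ne_zero (k := k) j
      have expand : ∀ i, hypL h K x (b i) (hypL h K (d i) y f) =
          X k b d x * (X k b d (b i) * (X k b d (d i) * (X k b d y * f))) +
          kap K (2 * j) • (X k b d x * (X k b d (b i) * pd h (d i) (pd h y f))) +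
          kap K (2 * j + 1 + 1) • pd h x (pd h (b i) (X k b d (d i) * (X k b d y * f))) +
          (kap K (2 * j) * a) • pd h x (pd h (b i) (pd h (d i) (pd h y f))) := by
        intro i
        simp only [hypL_of_mem h K _ _ hf, hypL_apply, map_add, map_smul, ha,
          kapOp_of_mem K (X_mul_mem_grade (d _) hyf)]
        module
      simp only [LinearMap.sum_apply, LinearMap.comp_apply, expand, Finset.sum_add_distrib,
        ← Finset.smul_sum, ← Finset.mul_sum, ← map_sum, sum_X_mul_X_mul, sum_X_pd, sum_pd_pd,
        sum_pd_X]
      simp only [map_add, map_smul, num_of_mem h hyf, num_pd h hf, pd_X_mul, num_of_mem h hf,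
        LinearMap.smul_apply, LinearMap.id_apply, map_zero, mul_zero, smul_zero, mul_smul_comm]
      simp only [kap]
      push_cast
      have e4 : (2 * j + 1 + 1 - 1 : k) ≠ 0 := by
        have : (2 * j + 1 + 1 - 1 : k) = 2 * j + 1 := by ring
        rwa [this]
      have e5 : (2 * j + 1 + 1 + 1 : k) ≠ 0 := by
        have : (2 * j + 1 + 1 + 1 : k) = 2 * j + 3 := by ring
        rwa [this]
      match_scalars <;> field_simp <;> ring
    have := eq_of_mem_even key f.2
    simpa [LinearMap.sum_apply] using this

/-! ### The even part is the regular representation -/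

variable {A : Type*} [Ring A] [Algebra k A] {K : k} {g : V →ₗ[k] V →ₗ[k] A}

/-- The components of the linear map from the even part of `Sym(V)` to the hyperboloid that
is inverse to `a ↦ a · 1`. Euler's formula, applied twice, dictates the recursion. -/
def sect (h : IsCup u b d) (g : V →ₗ[k] V →ₗ[k] A) : ℕ → (TwistedSym k b d →ₗ[k] A)
  | 0 => (aug k b d).toLinearMap.smulRight 1
  | j + 1 => (4 / ((2 * j + 2) * (2 * j + 1)) : k) • ∑ i, ∑ l,
      LinearMap.mulLeft k (g (b i) (b l)) ∘ₗ sect h g j ∘ₗ pd h (d l) ∘ₗ pd h (d i)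

/-- `sect` with its index lowered by one. -/
def sectPred (h : IsCup u b d) (g : V →ₗ[k] V →ₗ[k] A) : ℕ → (TwistedSym k b d →ₗ[k] A)
  | 0 => 0
  | j + 1 => sect h g j

theorem sectPred_zero : sectPred h g 0 = 0 := rfl

theorem sectPred_succ (j : ℕ) : sectPred h g (j + 1) = sect h g j := rfl

theorem sect_succ (j : ℕ) (f : TwistedSym k b d) : sect h g (j + 1) f =
    (4 / ((2 * j + 2) * (2 * j + 1)) : k) • ∑ i, ∑ l,
      g (b i) (b l) * sect h g j (pd h (d l) (pd h (d i) f)) := by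
  simp [sect, LinearMap.sum_apply]

theorem sum_sectPred (j : ℕ) (f : TwistedSym k b d) :
    ∑ i, ∑ l, g (b i) (b l) * sectPred h g j (pd h (d l) (pd h (d i) f)) =
      (2 * j * (2 * j - 1) / 4 : k) • sect h g j f := by
  cases j with
  | zero => simp [sectPred]
  | succ j =>
    have e1 : (2 * j + 2 : k) ≠ 0 := by exact_mod_cast Nat.succ_ne_zero (2 * j + 1)
    have e2 := two_mul_add_one_ne_zero (k := k) j
    rw [sect_succ, smul_smul]
    simp only [sectPred]
    have : (2 * ((j + 1 : ℕ) : k) * (2 * ((j + 1 : ℕ) : k) - 1) / 4 *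
        (4 / ((2 * j + 2) * (2 * j + 1)))) = 1 := by
      push_cast; field_simp; ring
    rw [this, one_smul]

/-- The commutation of two derivatives with the product `x y`, in degree `m`. -/
theorem pd_pd_X_mul_X_mul (a e x y : V) {m : ℕ} {f : TwistedSym k b d}
    (hf : f ∈ grade k b d m) :
    pd h a (pd h e (X k b d x * (X k b d y * f))) =
      X k b d a * (X k b d e * pd h x (pd h y f)) +
      ((2 * m + 2) * u e x) • (X k b d a * pd h y f) +
      ((m + 1) * u a e) • (X k b d x * pd h y f + ((m + 1) * u x y) • f) +
      ((m + 1) * u x y) • (X k b d a * pd h e f) +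
      ((m + 2) * (m + 1) * u e x * u a y) • f := by
  simp only [pd_X_mul, map_add, map_smul, num_X_mul, num_of_mem h hf, num_pd h hf, mul_add,
    mul_smul_comm]
  module

/-- The compatibility of `sect` with the generators in degree `2 j`. -/
def SectCompat (h : IsCup u b d) (K : k) (g : V →ₗ[k] V →ₗ[k] A) (j : ℕ) : Prop :=
  ∀ f ∈ grade k b d (2 * j), ∀ x y, sect h g (j + 1) (X k b d x * (X k b d y * f)) =
    g x y * sect h g j f - kap K (2 * j) • sectPred h g j (pd h x (pd h y f))

/-- The zigzag relation of the hyperboloid, contracted with `sect`. -/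
theorem sum_mul_sect_X_mul (hg : IsHyp u b d K g) {j : ℕ} (hj : SectCompat h K g j)
    {w : TwistedSym k b d} (hw : w ∈ grade k b d (2 * j + 1)) (x : V) :
    ∑ l, g x (b l) * sect h g (j + 1) (X k b d (d l) * w) =
      (K / (2 * j + 1)) • sect h g j (pd h x w) := by
  have e2 := two_mul_add_one_ne_zero (k := k) j
  have h1 : ∀ l, sect h g (j + 1) (X k b d (d l) * w) = -(2 / (2 * j + 1) : k) •
      ∑ t, g (d l) (b t) * sect h g j (pd h (d t) w) := by
    intro l
    conv_lhs => rw [eq_sum_X_pd h hw]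
    simp only [mul_smul_comm, map_smul, Finset.mul_sum, map_sum,
      hj _ (pd_mem_grade h _ hw), Finset.sum_sub_distrib, ← Finset.smul_sum]
    simp only [← map_sum, sum_pd_pd, map_zero, smul_zero, sub_zero]
    push_cast; rfl
  simp only [h1, mul_smul_comm, ← Finset.smul_sum, Finset.mul_sum]
  rw [Finset.sum_comm]
  simp only [← mul_assoc, ← Finset.sum_mul, hg.zigzag, smul_mul_assoc, one_mul, mul_smul,
    ← Finset.smul_sum]
  have := h.sum_left (sect h g j ∘ₗ (pd h).flip w) x
  simp only [LinearMap.comp_apply, LinearMap.flip_apply] at this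
  rw [this, smul_smul, smul_smul]
  congr 1
  field_simp

theorem sum_mul_sect (hg : IsHyp u b d K g) (x y : V) {m : ℕ} {f : TwistedSym k b d}
    (hf : f ∈ grade k b d m) (j : ℕ) :
    ∑ i, ∑ l, g (b i) (b l) *
        sect h g j (pd h (d l) (pd h (d i) (X k b d x * (X k b d y * f)))) =
      ∑ i, ∑ l, g (b i) (b l) * sect h g j (X k b d (d l) * (X k b d (d i) * pd h x (pd h y f))) -
      (m + 1 : k) • ∑ l, g x (b l) * sect h g j (X k b d (d l) * pd h y f) +
      ((m + 1) * u x y) • ∑ i, ∑ l, g (b i) (b l) * sect h g j (X k b d (d l) * pd h (d i) f) +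
      ((m + 2) * (m + 1) / 4 : k) • (g x y * sect h g j f) := by
  have h2 : ∑ i, ∑ l, u (d i) x • (g (b i) (b l) * sect h g j (X k b d (d l) * pd h y f)) =
      -(2⁻¹ : k) • ∑ l, g x (b l) * sect h g j (X k b d (d l) * pd h y f) := by
    rw [Finset.sum_comm, Finset.smul_sum]
    exact Finset.sum_congr rfl fun l _ => h.sum_right
      ((LinearMap.mul k A).flip (sect h g j (X k b d (d l) * pd h y f)) ∘ₗ g.flip (b l)) x
  have h3 : ∀ z, ∑ i, ∑ l, u (d l) (d i) • (g (b i) (b l) * z) = 0 := by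
    intro z
    have : ∀ i, ∑ l, u (d l) (d i) • (g (b i) (b l) * z) =
        -(2⁻¹ : k) • (g (b i) (d i) * z) := fun i =>
      h.sum_right ((LinearMap.mul k A).flip z ∘ₗ g (b i)) (d i)
    simp only [this, ← Finset.smul_sum, ← Finset.sum_mul, hg.cup, zero_mul, smul_zero]
  have h6 : ∑ i, ∑ l, (u (d i) x * u (d l) y) • (g (b i) (b l) * sect h g j f) =
      (4⁻¹ : k) • (g x y * sect h g j f) := by
    have : ∀ i, ∑ l, u (d l) y • (g (b i) (b l) * sect h g j f) =
        -(2⁻¹ : k) • (g (b i) y * sect h g j f) := fun i =>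
      h.sum_right ((LinearMap.mul k A).flip (sect h g j f) ∘ₗ g (b i)) y
    simp only [mul_smul, ← Finset.smul_sum, this]
    have := h.sum_right ((LinearMap.mul k A).flip (sect h g j f) ∘ₗ g.flip y) x
    simp only [LinearMap.comp_apply, LinearMap.flip_apply, LinearMap.mul_apply'] at this
    simp only [fun i => smul_comm (u (d i) x) (-(2⁻¹ : k)) (g (b i) y * sect h g j f),
      ← Finset.smul_sum, this]
    module
  simp only [← Finset.smul_sum] at h2 h6
  set z := sect h g j (X k b d x * pd h y f) + ((m + 1) * u x y) • sect h g j f with hz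
  have expand : ∀ i l, g (b i) (b l) *
      sect h g j (pd h (d l) (pd h (d i) (X k b d x * (X k b d y * f)))) =
      g (b i) (b l) * sect h g j (X k b d (d l) * (X k b d (d i) * pd h x (pd h y f))) +
      (2 * m + 2 : k) • u (d i) x • (g (b i) (b l) * sect h g j (X k b d (d l) * pd h y f)) +
      (m + 1 : k) • u (d l) (d i) • (g (b i) (b l) * z) +
      ((m + 1) * u x y) • (g (b i) (b l) * sect h g j (X k b d (d l) * pd h (d i) f)) +
      ((m + 2) * (m + 1) : k) • (u (d i) x * u (d l) y) • (g (b i) (b l) * sect h g j f) := by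
    intro i l
    rw [pd_pd_X_mul_X_mul h _ _ x y hf, hz]
    simp only [map_add, map_smul, mul_add, mul_smul_comm]
    module
  simp only [expand, Finset.sum_add_distrib, ← Finset.smul_sum, h2, h3, h6]
  module

theorem sectCompat (hg : IsHyp u b d K g) (j : ℕ) : SectCompat h K g j := by
  induction j with
  | zero =>
    intro f hf x y
    have h0 := fun y => pd_of_mem_grade_zero h y hf
    rw [sect_succ, sum_mul_sect h hg x y hf]
    simp only [h0, map_zero, mul_zero, Finset.sum_const_zero, smul_zero, sectPred_zero]
    match_scalars
    norm_num
  | succ j ih =>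
    intro f hf x y
    have e1 := two_mul_sub_one_ne_zero (k := k) j
    have e2 := two_mul_add_one_ne_zero (k := k) j
    have e3 := two_mul_add_three_ne_zero (k := k) j
    have e4 : (2 * (j + 1) + 2 : k) ≠ 0 := by exact_mod_cast Nat.succ_ne_zero (2 * (j + 1) + 1)
    have e7 : (j + 1 + 1 : k) ≠ 0 := by exact_mod_cast Nat.succ_ne_zero (j + 1)
    have e5 : (2 * (j + 1) + 1 : k) ≠ 0 := by exact_mod_cast Nat.succ_ne_zero (2 * (j + 1))
    have e6 : (2 * (j + 1) - 1 : k) ≠ 0 := by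
      have : (2 * (j + 1) - 1 : k) = 2 * j + 1 := by ring
      rwa [this]
    have h1 : ∑ i, ∑ l, g (b i) (b l) *
        (g (d l) (d i) * sect h g j (pd h x (pd h y f))) =
        K • sect h g j (pd h x (pd h y f)) := by
      simp only [← mul_assoc, ← Finset.sum_mul, hg.zigzag, smul_mul_assoc, one_mul, mul_smul,
        ← Finset.smul_sum, ← Finset.sum_smul, h.loop, one_smul]
    rw [sect_succ, sum_mul_sect h hg x y hf]
    simp only [ih _ (pd_pd_mem h x y hf), mul_sub, Finset.sum_sub_distrib, h1, mul_smul_comm,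
      ← Finset.smul_sum, sum_sectPred, sum_mul_sect_X_mul h hg ih (pd_mem_grade h _ hf),
      sectPred_succ]
    simp only [← map_sum, sum_pd_pd, map_zero, smul_zero, add_zero, kap]
    push_cast
    match_scalars <;> field_simp
    ring

end TwistedSym
end Cup

section Cup

variable {k V ι : Type*} [Field k] [AddCommGroup V] [Module k V] [Fintype ι]
variable {u : V →ₗ[k] V →ₗ[k] k} {b d : ι → V}

namespace TwistedSym

variable {A : Type*} [Ring A] [Algebra k A]

/-! ### The hyperboloid is the even part of the symmetric algebra -/

/-- The orbit map `a ↦ a · 1` into the even part of `Sym(V)`. -/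
def orbit (Q : A →ₐ[k] Module.End k (even k b d)) : A →ₗ[k] TwistedSym k b d where
  toFun a := (Q a ⟨1, mem_even (j := 0) one_mem_grade⟩ : even k b d)
  map_add' _ _ := by simp
  map_smul' _ _ := by simp

variable {Q : A →ₐ[k] Module.End k (even k b d)}

theorem orbit_one : orbit Q 1 = 1 := by simp [orbit]

theorem orbit_mem (a : A) : orbit Q a ∈ even k b d := Subtype.property _

variable [CharZero k] (h : IsCup u b d) {K : k} {g : V →ₗ[k] V →ₗ[k] A}

/-- The inverse of `a ↦ a · 1`. -/
def invOrbit (h : IsCup u b d) (g : V →ₗ[k] V →ₗ[k] A) : TwistedSym k b d →ₗ[k] A :=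
  gsum fun m => if Even m then sect h g (m / 2) else 0

theorem invOrbit_of_mem {j : ℕ} {f : TwistedSym k b d} (hf : f ∈ grade k b d (2 * j)) :
    invOrbit h g f = sect h g j f := by
  rw [invOrbit, gsum_of_mem _ hf, if_pos (even_two_mul j)]
  simp

/-- `invOrbit` is a map of modules over the hyperboloid. -/
theorem invOrbit_hypL (hg : IsHyp u b d K g) (x y : V) {f : TwistedSym k b d}
    (hf : f ∈ even k b d) : invOrbit h g (hypL h K x y f) = g x y * invOrbit h g f := by
  refine eq_of_mem_even (F := invOrbit h g ∘ₗ hypL h K x y)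
    (G := LinearMap.mulLeft k (g x y) ∘ₗ invOrbit h g) (fun j f hf => ?_) hf
  simp only [LinearMap.comp_apply, LinearMap.mulLeft_apply, hypL_of_mem h K x y hf, map_add,
    map_smul, invOrbit_of_mem h hf]
  rw [invOrbit_of_mem h (j := j + 1) (X_mul_mem_grade x (X_mul_mem_grade y hf)),
    sectCompat h hg j f hf]
  cases j with
  | zero => simp [pd_of_mem_grade_zero h y hf]
  | succ j => rw [invOrbit_of_mem h (pd_pd_mem h x y hf), sectPred_succ, sub_add_cancel]

theorem orbit_mul (hQ : ∀ x y, Q (g x y) = evenL h K x y) (x y : V) (a : A) :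
    orbit Q (g x y * a) = hypL h K x y (orbit Q a) := by
  simp [orbit, hQ, coe_evenL]

theorem invOrbit_orbit (hg : IsHyp u b d K g)
    (hgen : Algebra.adjoin k (Set.range (TensorProduct.lift g)) = ⊤)
    (hQ : ∀ x y, Q (g x y) = evenL h K x y) (a : A) : invOrbit h g (orbit Q a) = a := by
  have : LinearMap.eqLocus (invOrbit h g ∘ₗ orbit Q) LinearMap.id = ⊤ := by
    refine eq_top_of_left_stable₂ g hgen _ ?_ fun x y f hf => ?_
    · rw [LinearMap.mem_eqLocus, LinearMap.comp_apply, orbit_one,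
        invOrbit_of_mem h (j := 0) one_mem_grade]
      simp [sect]
    · rw [LinearMap.mem_eqLocus, LinearMap.comp_apply, LinearMap.id_apply] at *
      rw [orbit_mul h hQ, invOrbit_hypL h hg x y (orbit_mem f), hf]
  have ha : a ∈ LinearMap.eqLocus (invOrbit h g ∘ₗ orbit Q) LinearMap.id := by
    rw [this]; trivial
  exact ha

theorem orbit_sect (hQ : ∀ x y, Q (g x y) = evenL h K x y) (j : ℕ) {f : TwistedSym k b d}
    (hf : f ∈ grade k b d (2 * j)) : orbit Q (sect h g j f) = f := by
  induction j generalizing f with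
  | zero =>
    conv_rhs => rw [eq_aug_smul_one hf]
    simp [sect, orbit_one]
  | succ j ih =>
    have e1 : (2 * j + 2 : k) ≠ 0 := by exact_mod_cast Nat.succ_ne_zero (2 * j + 1)
    have e2 := two_mul_add_one_ne_zero (k := k) j
    have h1 := fun x y => pd_pd_mem h x y hf
    simp only [sect_succ, map_smul, map_sum, orbit_mul h hQ, ih (h1 _ _),
      hypL_of_mem h K _ _ (h1 _ _)]
    simp only [Finset.sum_add_distrib, ← Finset.smul_sum,
      ← Finset.mul_sum, ← map_sum, sum_pd_pd, sum_X_pd, num_pd h hf, mul_smul_comm]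
    simp only [map_zero, smul_zero, Finset.sum_const_zero, add_zero,
      num_of_mem h hf]
    push_cast
    match_scalars
    field_simp
    ring

theorem orbit_invOrbit (hQ : ∀ x y, Q (g x y) = evenL h K x y) {f : TwistedSym k b d}
    (hf : f ∈ even k b d) : orbit Q (invOrbit h g f) = f := by
  refine eq_of_mem_even (F := orbit Q ∘ₗ invOrbit h g) (G := LinearMap.id)
    (fun j f hf => ?_) hf
  rw [LinearMap.comp_apply, invOrbit_of_mem h hf, orbit_sect h hQ j hf]; rfl

/-! ### The twisted vector fields on the symmetric algebra -/

/-- The twisted vector field `x ∂_y + u(x, y) N / 2`. -/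
def field : V →ₗ[k] V →ₗ[k] Module.End k (TwistedSym k b d) :=
  LinearMap.mk₂ k (fun x y => LinearMap.mulLeft k (X k b d x) ∘ₗ pd h y +
      (2⁻¹ * u x y) • num h)
    (fun _ _ _ => LinearMap.ext fun _ => by simp [add_mul]; module)
    (fun _ _ _ => LinearMap.ext fun _ => by simp; module)
    (fun _ _ _ => LinearMap.ext fun _ => by simp [mul_add]; module)
    (fun _ _ _ => LinearMap.ext fun _ => by simp; module)

theorem field_of_mem (x y : V) {m : ℕ} {f : TwistedSym k b d} (hf : f ∈ grade k b d m) :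
    field h x y f = X k b d x * pd h y f + (2⁻¹ * u x y * m) • f := by
  simp [field, num_of_mem h hf, smul_smul]

theorem field_mem_grade (x y : V) {m : ℕ} {f : TwistedSym k b d} (hf : f ∈ grade k b d m) :
    field h x y f ∈ grade k b d m := by
  rw [field_of_mem h x y hf]
  refine add_mem ?_ (Submodule.smul_mem _ _ hf)
  cases m with
  | zero => rw [pd_of_mem_grade_zero h y hf]; simp
  | succ m => exact X_mul_mem_grade x (pd_mem_grade h y hf)

theorem field_mem_even (x y : V) {f : TwistedSym k b d} (hf : f ∈ even k b d) :
    field h x y f ∈ even k b d := by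
  have : even k b d ≤ (even k b d).comap (field h x y) := by
    conv_lhs => rw [even]
    exact iSup_le fun j f hf => mem_even (field_mem_grade h x y hf)
  exact this hf

theorem field_one (x y : V) : field h x y 1 = 0 := by
  simp [field_of_mem h x y one_mem_grade]

theorem sum_field : ∑ i, field h (b i) (d i) = 0 := by
  refine linearMap_ext_grade fun m f hf => ?_
  simp only [LinearMap.sum_apply, field_of_mem h _ _ hf, Finset.sum_add_distrib, sum_X_pd,
    ← Finset.sum_smul, ← Finset.sum_mul, ← Finset.mul_sum, h.loop, num_of_mem h hf]
  rw [LinearMap.zero_apply]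
  module

/-- The contraction of a generator of the hyperboloid with a vector field. -/
theorem sum_hypL_field (x w : V) {m : ℕ} {f : TwistedSym k b d} (hf : f ∈ grade k b d m) :
    ∑ i, hypL h K x (b i) (field h (d i) w f) =
      -(m / 4 : k) • (X k b d x * (X k b d w * f)) +
        (kap K m * (m + 2) / 4) • pd h x (pd h w f) := by
  have h1 := h.sum_right (LinearMap.mulLeft k (X k b d x) ∘ₗ
    (LinearMap.mul k (TwistedSym k b d)).flip f ∘ₗ X k b d) w
  have h2 := h.sum_right (pd h x ∘ₗ (pd h).flip f) w
  simp only [LinearMap.comp_apply, LinearMap.flip_apply, LinearMap.mul_apply',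
    LinearMap.mulLeft_apply] at h1 h2
  have expand : ∀ i, hypL h K x (b i) (field h (d i) w f) =
      X k b d x * (X k b d (b i) * (X k b d (d i) * pd h w f)) +
      (2⁻¹ * m : k) • u (d i) w • (X k b d x * (X k b d (b i) * f)) +
      kap K m • pd h x (pd h (b i) (X k b d (d i) * pd h w f)) +
      (kap K m * (2⁻¹ * m)) • u (d i) w • pd h x (pd h (b i) f) := by
    intro i
    rw [hypL_of_mem h K x (b i) (field_mem_grade h (d i) w hf), field_of_mem h _ _ hf]
    simp only [map_add, map_smul, mul_add, mul_smul_comm]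
    module
  simp only [expand, Finset.sum_add_distrib, ← Finset.smul_sum, h1, h2, ← Finset.mul_sum,
    ← map_sum, sum_X_mul_X_mul, sum_pd_X]
  simp only [map_add, map_smul, num_pd h hf, mul_zero]
  module

/-- The vector fields are tangent to the hyperboloid: contracting both indices of a generator
with a vector field gives zero. -/
theorem sum_sum_hypL_field (K : k) {m : ℕ} {f : TwistedSym k b d} (hf : f ∈ grade k b d m) :
    ∑ i, ∑ l, hypL h K (b i) (b l) (field h (d l) (d i) f) = 0 := by
  simp only [sum_hypL_field h _ _ hf, Finset.sum_add_distrib, ← Finset.smul_sum,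
    sum_X_mul_X_mul, sum_pd_pd, smul_zero, add_zero]

/-- The twisted Leibniz rule for the product of a generator of the hyperboloid and a function,
in the model. -/
theorem field_hypL (K : k) (x y z w : V) (f : TwistedSym k b d) :
    field h x y (hypL h K z w f) =
      (2 * u y z) • hypL h K x w f + u x y • hypL h K z w f + u z w • hypL h K x y f +
      (hypL h K x y (field h z w f) -
      (4 * u y z) • ∑ i, hypL h K x (b i) (field h (d i) w f) -
      (2 * u x y) • ∑ i, hypL h K z (b i) (field h (d i) w f) -
      (2 * u z w) • ∑ i, hypL h K x (b i) (field h (d i) y f) +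
      (4 * (u z w * u x y + u y z * u x w)) •
        ∑ i, ∑ l, hypL h K (b i) (b l) (field h (d l) (d i) f)) := by
  have key : field h x y ∘ₗ hypL h K z w =
      (2 * u y z) • hypL h K x w + u x y • hypL h K z w + u z w • hypL h K x y +
      (hypL h K x y ∘ₗ field h z w -
      (4 * u y z) • ∑ i, hypL h K x (b i) ∘ₗ field h (d i) w -
      (2 * u x y) • ∑ i, hypL h K z (b i) ∘ₗ field h (d i) w -
      (2 * u z w) • ∑ i, hypL h K x (b i) ∘ₗ field h (d i) y +
      (4 * (u z w * u x y + u y z * u x w)) •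
        ∑ i, ∑ l, hypL h K (b i) (b l) ∘ₗ field h (d l) (d i)) := by
    refine linearMap_ext_grade fun m f hf => ?_
    have ha : num h (pd h z (pd h w f)) = (m - 2 : k) • pd h z (pd h w f) := by
      have := pd_num h z (pd h w f)
      rw [num_pd h hf, map_smul] at this
      have h2 : num h (pd h z (pd h w f)) =
        (m - 1 : k) • pd h z (pd h w f) - pd h z (pd h w f) := by rw [this]; abel
      rw [h2]; module
    simp only [LinearMap.add_apply, LinearMap.sub_apply, LinearMap.smul_apply,
      LinearMap.comp_apply, LinearMap.sum_apply]
    rw [sum_sum_hypL_field h K hf, sum_hypL_field h x w hf, sum_hypL_field h z w hf,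
      sum_hypL_field h x y hf, hypL_of_mem h K x y (field_mem_grade h z w hf)]
    simp only [hypL_of_mem h K _ _ hf, field_of_mem h _ _ hf]
    simp only [field, LinearMap.mk₂_apply, LinearMap.add_apply, LinearMap.comp_apply,
      LinearMap.smul_apply, LinearMap.mulLeft_apply, map_add, map_smul, ha, num_X_mul,
      num_of_mem h hf, pd_X_mul, num_pd h hf, mul_add, mul_smul_comm]
    module
  have := LinearMap.congr_fun key f
  simpa [LinearMap.sum_apply] using this

/-- The Casimir operator acts by `N² / 2 + N`. -/
theorem sum_field_field {m : ℕ} {f : TwistedSym k b d} (hf : f ∈ grade k b d m) :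
    (-4 : k) • ∑ i, ∑ l, field h (b i) (b l) (field h (d l) (d i) f) =
      ((m : k) ^ 2 / 2 + m) • f := by
  have inner : ∀ i, ∑ l, field h (b i) (b l) (field h (d l) (d i) f) =
      (4⁻¹ * m + 2⁻¹ : k) • (X k b d (b i) * pd h (d i) f) -
        (4⁻¹ * m : k) • (X k b d (b i) * pd h (d i) f) -
        (8⁻¹ * m ^ 2 * u (b i) (d i)) • f := by
    intro i
    have h1 := h.sum_right (LinearMap.mulLeft k (X k b d (b i)) ∘ₗ (pd h).flip f) (d i)
    have h2 := h.sum_left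
      ((LinearMap.mul k (TwistedSym k b d)).flip (pd h (d i) f) ∘ₗ X k b d) (b i)
    have h3 := h.sum_left ((LinearMap.toSpanSingleton k _ f) ∘ₗ u.flip (d i)) (b i)
    simp only [LinearMap.comp_apply, LinearMap.flip_apply, LinearMap.mul_apply',
      LinearMap.mulLeft_apply, LinearMap.toSpanSingleton_apply] at h1 h2 h3
    have expand : ∀ l, field h (b i) (b l) (field h (d l) (d i) f) =
        X k b d (b i) * pd h (b l) (X k b d (d l) * pd h (d i) f) +
        (2⁻¹ * m : k) • u (d l) (d i) • (X k b d (b i) * pd h (b l) f) +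
        (2⁻¹ * m : k) • u (b i) (b l) • (X k b d (d l) * pd h (d i) f) +
        (4⁻¹ * m ^ 2 : k) • u (b i) (b l) • u (d l) (d i) • f := by
      intro l
      rw [field_of_mem h _ _ (field_mem_grade h _ _ hf), field_of_mem h _ _ hf]
      simp only [map_add, map_smul, mul_add, mul_smul_comm]
      module
    simp only [expand, Finset.sum_add_distrib, ← Finset.smul_sum, ← Finset.mul_sum, sum_pd_X,
      h1, h2, h3, num_pd h hf, mul_add, mul_smul_comm]
    module
  simp only [inner, Finset.sum_sub_distrib, ← Finset.smul_sum, sum_X_pd, num_of_mem h hf,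
    ← Finset.sum_smul, ← Finset.mul_sum, h.loop]
  module

end TwistedSym
end Cup

/-! ### Symmetries with central determinant in coordinates -/

section Det

variable {k V ι : Type*} [Field k] [AddCommGroup V] [Module k V] [Fintype ι]

variable (k) in
/-- The tensor `∑ b i ⊗ d i`. -/
def cupT (b d : ι → V) : V ⊗[k] V := ∑ i, b i ⊗ₜ[k] d i

/-- `S = Id - 2 u ⊗ v` where the determinant is `v = ∑ b i ⊗ d i`, the codeterminant is the
bilinear form `u`, and the determinant is central. -/
structure IsCentralDet (S : V ⊗[k] V →ₗ[k] V ⊗[k] V) (u : V →ₗ[k] V →ₗ[k] k) (b d : ι → V) :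
    Prop where
  isCup : IsCup u b d
  apply : ∀ t, S t = t - (2 * TensorProduct.lift u t) • cupT k b d

/-- The determinant is expanded along the basis `b`; centrality gives the zigzag identities. -/
theorem HasCentralDeterminant.exists_isCentralDet [CharZero k] {n : ℕ}
    {S : V ⊗[k] V →ₗ[k] V ⊗[k] V} (hdet : HasCentralDeterminant S)
    (b : Module.Basis (Fin n) k V) :
    ∃ (u : V →ₗ[k] V →ₗ[k] k) (d : Fin n → V), IsCentralDet S u b d := by
  obtain ⟨u, v, hS, huv, hM, hN⟩ := hdet
  let D : V ⊗[k] V →ₗ[k] (Fin n → V) :=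
    LinearMap.pi fun i => (TensorProduct.lid k V).toLinearMap ∘ₗ (b.coord i).rTensor V
  have hD : ∀ t, t = ∑ i, b i ⊗ₜ[k] D t i := by
    intro t
    induction t with
    | zero => simp
    | tmul x y =>
      have hx : x ⊗ₜ[k] y = (∑ i, b.repr x i • b i) ⊗ₜ y := by rw [b.sum_repr]
      have hi : ∀ i, D (x ⊗ₜ[k] y) i = b.repr x i • y := fun i => rfl
      simp only [hi]
      rw [hx, TensorProduct.sum_tmul]
      exact Finset.sum_congr rfl fun i _ => TensorProduct.smul_tmul _ _ _
    | add s t hs ht =>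
      conv_lhs => rw [hs, ht]
      simp [TensorProduct.tmul_add, Finset.sum_add_distrib]
  have hlift : TensorProduct.lift (TensorProduct.curry u) = u :=
    TensorProduct.ext' fun _ _ => rfl
  have h2 : (-2 : k) ≠ 0 := by norm_num
  have h2' : -(2⁻¹ : k) = (-2 : k)⁻¹ := by rw [inv_neg]
  refine ⟨TensorProduct.curry u, D v, ⟨fun x => ?_, fun x => ?_, ?_⟩, fun t => ?_⟩
  · have h1 := LinearMap.congr_fun hN x
    rw [LinearMap.smul_apply, LinearMap.id_apply] at h1
    rw [h2', eq_inv_smul_iff₀ h2]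
    refine Eq.trans ?_ h1
    congr 1
    conv_rhs => rw [hD v]
    simp [opN]
  · have h1 := LinearMap.congr_fun hM x
    rw [LinearMap.smul_apply, LinearMap.id_apply] at h1
    rw [h2', eq_inv_smul_iff₀ h2]
    refine Eq.trans ?_ h1
    congr 1
    conv_rhs => rw [hD v]
    simp [opM]
  · rw [← huv]
    conv_rhs => rw [hD v]
    simp
  · have h3 := hS t
    rw [hlift, cupT, ← hD v, mul_smul, ← h3, smul_smul]
    simp

end Det

/-! ### Fourfold tensor products -/

section Middle

variable {k : Type*} [Field k]
variable {A B C B' C' D A₂ B₂ C₂ B₂' C₂' D₂ : Type*}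
  [AddCommGroup A] [Module k A] [AddCommGroup B] [Module k B]
  [AddCommGroup C] [Module k C] [AddCommGroup B'] [Module k B'] [AddCommGroup C'] [Module k C']
  [AddCommGroup D] [Module k D] [AddCommGroup A₂] [Module k A₂] [AddCommGroup B₂] [Module k B₂]
  [AddCommGroup C₂] [Module k C₂] [AddCommGroup B₂'] [Module k B₂'] [AddCommGroup C₂']
  [Module k C₂'] [AddCommGroup D₂] [Module k D₂]

/-- Insert a tensor between `a` and `w`. -/
def glue (a : A) (w : D) : B ⊗[k] C →ₗ[k] (A ⊗[k] B) ⊗[k] (C ⊗[k] D) :=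
  TensorProduct.map (TensorProduct.mk k A B a) ((TensorProduct.mk k C D).flip w)

theorem middle_tmul (f : B ⊗[k] C →ₗ[k] B' ⊗[k] C') (a : A) (x : B) (y : C) (w : D) :
    middle f ((a ⊗ₜ x) ⊗ₜ (y ⊗ₜ w)) = glue a w (f (x ⊗ₜ y)) := by
  have : ∀ t : B' ⊗[k] C', (TensorProduct.tensorTensorTensorAssoc k A B' C' D).symm
      ((a ⊗ₜ t) ⊗ₜ w) = glue a w t := by
    intro t
    induction t with
    | zero => simp
    | tmul p q => simp [glue]
    | add s t hs ht => rw [TensorProduct.tmul_add, TensorProduct.add_tmul, map_add, hs, ht, map_add]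
  rw [← this]
  simp [middle]

/-- `middle` is natural. -/
theorem middle_map (f : B ⊗[k] C →ₗ[k] B' ⊗[k] C') (f₂ : B₂ ⊗[k] C₂ →ₗ[k] B₂' ⊗[k] C₂')
    (α : A →ₗ[k] A₂) (β : B →ₗ[k] B₂) (γ : C →ₗ[k] C₂) (δ : D →ₗ[k] D₂)
    (β' : B' →ₗ[k] B₂') (γ' : C' →ₗ[k] C₂')
    (hf : ∀ t, f₂ (TensorProduct.map β γ t) = TensorProduct.map β' γ' (f t))
    (t : (A ⊗[k] B) ⊗[k] (C ⊗[k] D)) :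
    middle f₂ (TensorProduct.map (TensorProduct.map α β) (TensorProduct.map γ δ) t) =
      TensorProduct.map (TensorProduct.map α β') (TensorProduct.map γ' δ) (middle f t) := by
  have h1 : ∀ (a : A) (w : D) (s : B' ⊗[k] C'),
      glue (α a) (δ w) (TensorProduct.map β' γ' s) =
        TensorProduct.map (TensorProduct.map α β') (TensorProduct.map γ' δ) (glue a w s) := by
    intro a w s
    induction s with
    | zero => simp
    | tmul p q => simp [glue]
    | add s t hs ht => simp only [map_add, hs, ht]
  have h2 : middle f₂ ∘ₗ TensorProduct.map (TensorProduct.map α β) (TensorProduct.map γ δ) =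
      TensorProduct.map (TensorProduct.map α β') (TensorProduct.map γ' δ) ∘ₗ middle f := by
    refine TensorProduct.ext_fourfold' fun a x y w => ?_
    simp only [LinearMap.comp_apply, TensorProduct.map_tmul, middle_tmul, ← h1, ← hf]
  exact LinearMap.congr_fun h2 t

end Middle

/-- When `b` is a basis, `d` is `-1 / 2` times the dual basis with respect to `u`. -/
theorem IsCup.pairing {k V : Type*} [Field k] [AddCommGroup V] [Module k V] {n : ℕ}
    {u : V →ₗ[k] V →ₗ[k] k} {b : Module.Basis (Fin n) k V} {d : Fin n → V}
    (h : IsCup u b d) (i j : Fin n) :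
    u (d j) (b i) = if i = j then -(2⁻¹ : k) else 0 := by
  have h1 := congrArg (b.coord j) (h.right (b i))
  simpa [Finsupp.single_apply, neg_ite] using h1

theorem endEquiv_tmul {k V : Type*} [Field k] [AddCommGroup V] [Module k V]
    [FiniteDimensional k V] (x : V) (φ : Module.Dual k V) (y : V) :
    endEquiv k V (x ⊗ₜ φ) y = φ y • x := by
  simp [endEquiv]

section Translate

variable {k V : Type*} [Field k] [CharZero k] [AddCommGroup V] [Module k V]
  [FiniteDimensional k V] {n : ℕ}
variable {S : V ⊗[k] V →ₗ[k] V ⊗[k] V} {u : V →ₗ[k] V →ₗ[k] k} {b : Module.Basis (Fin n) k V}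
  {d : Fin n → V}

/-- The isomorphism `V → V*`, `z ↦ u(z, ·)`. -/
def dualIso (h : IsCup u b d) : V ≃ₗ[k] Module.Dual k V :=
  LinearEquiv.ofLinearMap u ((-2 : k) • ∑ i, (LinearMap.applyₗ (b i)).smulRight (d i))
    (by
      refine LinearMap.ext fun φ => LinearMap.ext fun x => ?_
      have := h.sum_right φ x
      simp only [smul_eq_mul] at this
      simp [LinearMap.sum_apply, mul_comm, this])
    (by
      refine LinearMap.ext fun x => ?_
      have := h.left x
      simp [this])

theorem dualIso_apply (h : IsCup u b d) (z x : V) : dualIso h z x = u z x := rfl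

/-- The identification `V ⊗ V = V ⊗ V* = End V` by means of `u`. -/
def toEnd (h : IsCup u b d) : V ⊗[k] V ≃ₗ[k] Module.End k V :=
  (TensorProduct.congr (LinearEquiv.refl k V) (dualIso h)).trans (endEquiv k V)

theorem toEnd_eq (h : IsCup u b d) (t : V ⊗[k] V) :
    toEnd h t = endEquiv k V ((dualIso h).toLinearMap.lTensor V t) := by
  rw [toEnd, LinearEquiv.trans_apply]
  congr 1

theorem endEquiv_symm_toEnd (h : IsCup u b d) (t : V ⊗[k] V) :
    (endEquiv k V).symm (toEnd h t) = (dualIso h).toLinearMap.lTensor V t := by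
  rw [toEnd_eq, LinearEquiv.symm_apply_apply]

theorem toEnd_tmul (h : IsCup u b d) (x z y : V) : toEnd h (x ⊗ₜ z) y = u z y • x := by
  rw [toEnd_eq, LinearMap.lTensor_tmul, endEquiv_tmul]; rfl

theorem toEnd_mul (h : IsCup u b d) (x y z w : V) :
    toEnd h (x ⊗ₜ y) * toEnd h (z ⊗ₜ w) = u y z • toEnd h (x ⊗ₜ w) := by
  ext t
  simp [toEnd_tmul, smul_smul, mul_comm]

theorem toEnd_cupT (h : IsCup u b d) : toEnd h (cupT k b d) = -(2⁻¹ : k) • 1 := by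
  ext y
  simp [cupT, map_sum, LinearMap.sum_apply, toEnd_tmul, h.right]

/-! ### The extended symmetry is the symmetry on `V ⊗ V` -/

theorem braidDualLeft_dualIso (h : IsCentralDet S u b d) (t : V ⊗[k] V) :
    braidDualLeft S ((dualIso h.isCup).toLinearMap.rTensor V t) =
      (dualIso h.isCup).toLinearMap.lTensor V (S t) := by
  induction t with
  | zero => simp
  | add s t hs ht => simp only [map_add, hs, ht]
  | tmul z x =>
    apply (endEquiv k V).injective
    rw [← toEnd_eq, h.apply, map_sub, map_smul, toEnd_cupT]
    ext y
    have h1 := h.isCup.left z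
    simp only [braidDualLeft, slice, LinearMap.comp_apply, LinearEquiv.coe_coe,
      LinearEquiv.apply_symm_apply, LinearMap.rTensor_tmul, TensorProduct.lift.tmul,
      LinearMap.mk₂_apply, TensorProduct.mk_apply, h.apply, LinearMap.sub_apply, toEnd_tmul]
    simp only [map_sub, map_smul, cupT, map_sum, LinearMap.rTensor_tmul, TensorProduct.lid_tmul,
      dualIso_apply, h1, LinearMap.smul_apply, Module.End.one_apply]
    module

theorem braidDualLeft_bijective (h : IsCentralDet S u b d) (hS : S ∘ₗ S = LinearMap.id) :
    Function.Bijective (braidDualLeft S) := by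
  let e := TensorProduct.congr (dualIso h.isCup) (LinearEquiv.refl k V)
  let e' := TensorProduct.congr (LinearEquiv.refl k V) (dualIso h.isCup)
  let s : V ⊗[k] V ≃ₗ[k] V ⊗[k] V := LinearEquiv.ofLinearMap S S hS hS
  have : braidDualLeft S = (e.symm.trans (s.trans e')).toLinearMap := by
    refine LinearMap.ext fun t => ?_
    obtain ⟨t, rfl⟩ := e.surjective t
    have h1 := braidDualLeft_dualIso h t
    rw [LinearEquiv.coe_coe, LinearEquiv.trans_apply, LinearEquiv.symm_apply_apply]
    exact h1
  rw [this]
  exact LinearEquiv.bijective _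

theorem braidDualRight_dualIso (h : IsCentralDet S u b d) (hS : S ∘ₗ S = LinearMap.id)
    (t : V ⊗[k] V) :
    braidDualRight S ((dualIso h.isCup).toLinearMap.lTensor V t) =
      (dualIso h.isCup).toLinearMap.rTensor V (S t) := by
  rw [braidDualRight, dif_pos (braidDualLeft_bijective h hS), LinearEquiv.coe_coe,
    LinearEquiv.symm_apply_eq, LinearEquiv.ofBijective_apply, braidDualLeft_dualIso h]
  congr 1
  exact (LinearMap.congr_fun hS t).symm

theorem braidDualDual_dualIso (h : IsCentralDet S u b d) (t : V ⊗[k] V) :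
    braidDualDual S (TensorProduct.map (dualIso h.isCup).toLinearMap
        (dualIso h.isCup).toLinearMap t) =
      TensorProduct.map (dualIso h.isCup).toLinearMap (dualIso h.isCup).toLinearMap (S t) := by
  rw [braidDualDual]
  simp only [LinearMap.comp_apply, LinearEquiv.coe_coe]
  rw [LinearEquiv.symm_apply_eq]
  induction t with
  | zero => simp
  | add s t hs ht => simp only [map_add, hs, ht]
  | tmul z w =>
    refine TensorProduct.ext' fun x y => ?_
    have hD : ∀ t, TensorProduct.dualDistribEquiv k V V t = TensorProduct.dualDistrib k V V t :=
      fun _ => rfl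
    have h1 : ∑ i, u w (b i) * u z (d i) = -(2⁻¹ : k) * u z w := by
      simpa using h.isCup.sum_left (u z) w
    have h2 : ∑ i, u (d i) x * u (b i) y = -(2⁻¹ : k) * u x y := by
      simpa [mul_comm] using h.isCup.sum_right (u.flip y) x
    simp only [LinearMap.dualMap_apply, h.apply, map_sub, map_smul, cupT, map_sum,
      LinearMap.sub_apply, LinearMap.smul_apply, LinearMap.sum_apply,
      TensorProduct.map_tmul, LinearEquiv.coe_coe, LinearEquiv.trans_apply,
      TensorProduct.comm_tmul, hD,
      TensorProduct.dualDistrib_apply, dualIso_apply, TensorProduct.lift.tmul, smul_eq_mul]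
    linear_combination 2 * u z w * h2 - 2 * u x y * h1

/-- The twist of `End V = V ⊗ V` in terms of `S`. -/
def braidSq (S : V ⊗[k] V →ₗ[k] V ⊗[k] V) :
    (V ⊗[k] V) ⊗[k] (V ⊗[k] V) →ₗ[k] (V ⊗[k] V) ⊗[k] (V ⊗[k] V) :=
  middle S ∘ₗ TensorProduct.map S S ∘ₗ middle S

/-- Under `End V = V ⊗ V`, all extensions of `S` in the twist of `End V` become `S` itself. -/
theorem braidEnd_toEnd (h : IsCentralDet S u b d) (hS : S ∘ₗ S = LinearMap.id)
    (t : (V ⊗[k] V) ⊗[k] (V ⊗[k] V)) :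
    braidEnd S (TensorProduct.map (toEnd h.isCup).toLinearMap (toEnd h.isCup).toLinearMap t) =
      TensorProduct.map (toEnd h.isCup).toLinearMap (toEnd h.isCup).toLinearMap
        (braidSq S t) := by
  set θ := (dualIso h.isCup).toLinearMap with hθ
  have e1 : TensorProduct.map (endEquiv k V).symm.toLinearMap (endEquiv k V).symm.toLinearMap
      (TensorProduct.map (toEnd h.isCup).toLinearMap (toEnd h.isCup).toLinearMap t) =
      TensorProduct.map (TensorProduct.map LinearMap.id θ)
        (TensorProduct.map LinearMap.id θ) t := by
    induction t with
    | zero => simp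
    | tmul p q =>
      simp only [TensorProduct.map_tmul, LinearEquiv.coe_coe, endEquiv_symm_toEnd]; rfl
    | add s t hs ht => simp only [map_add, hs, ht]
  have e2 : ∀ t : (V ⊗[k] V) ⊗[k] (V ⊗[k] V),
      TensorProduct.map (endEquiv k V).toLinearMap (endEquiv k V).toLinearMap
        (TensorProduct.map (TensorProduct.map LinearMap.id θ)
          (TensorProduct.map LinearMap.id θ) t) =
      TensorProduct.map (toEnd h.isCup).toLinearMap (toEnd h.isCup).toLinearMap t := by
    intro t
    induction t with
    | zero => simp
    | tmul p q => simp only [TensorProduct.map_tmul, LinearEquiv.coe_coe, toEnd_eq]; rfl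
    | add s t hs ht => simp only [map_add, hs, ht]
  have e3 : ∀ t : (V ⊗[k] V) ⊗[k] (V ⊗[k] V), TensorProduct.map S (braidDualDual S)
      (TensorProduct.map (TensorProduct.map LinearMap.id LinearMap.id) (TensorProduct.map θ θ) t) =
      TensorProduct.map (TensorProduct.map LinearMap.id LinearMap.id) (TensorProduct.map θ θ)
        (TensorProduct.map S S t) := by
    intro t
    induction t with
    | zero => simp
    | tmul p q =>
      simp only [TensorProduct.map_tmul, TensorProduct.map_id, LinearMap.id_apply, hθ,
        braidDualDual_dualIso h]
    | add s t hs ht => simp only [map_add, hs, ht]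
  rw [braidEnd, braidSq]
  simp only [LinearMap.comp_apply]
  rw [e1, middle_map S (braidDualLeft S) LinearMap.id θ LinearMap.id θ LinearMap.id θ
      (braidDualLeft_dualIso h), e3,
    middle_map S (braidDualRight S) LinearMap.id LinearMap.id θ θ θ LinearMap.id
      (braidDualRight_dualIso h hS), e2]

end Translate

/-! ### The twist of `End V` on pure tensors -/

section Middle

variable {k : Type*} [Field k]
variable {A B C B' C' D : Type*}
  [AddCommGroup A] [Module k A] [AddCommGroup B] [Module k B]
  [AddCommGroup C] [Module k C] [AddCommGroup B'] [Module k B'] [AddCommGroup C'] [Module k C']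
  [AddCommGroup D] [Module k D]

theorem middle_glue (f : B ⊗[k] C →ₗ[k] B' ⊗[k] C') (a : A) (w : D) (t : B ⊗[k] C) :
    middle f (glue a w t) = glue a w (f t) := by
  induction t with
  | zero => simp
  | tmul x y => exact middle_tmul f a x y w
  | add s t hs ht => simp only [map_add, hs, ht]

end Middle

section Twist

variable {k V : Type*} [Field k] [AddCommGroup V] [Module k V] {ι : Type*} [Fintype ι]
variable {S : V ⊗[k] V →ₗ[k] V ⊗[k] V} {u : V →ₗ[k] V →ₗ[k] k} {b d : ι → V}

theorem IsCentralDet.tmul (h : IsCentralDet S u b d) (x y : V) :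
    S (x ⊗ₜ y) = x ⊗ₜ y - (2 * u x y) • cupT k b d := by
  rw [h.apply, TensorProduct.lift.tmul]

theorem lift_cupT (h : IsCup u b d) : TensorProduct.lift u (cupT k b d) = 1 := by
  simp [cupT, h.loop]

theorem glue_cupT (x w : V) : glue x w (cupT k b d) = ∑ i, (x ⊗ₜ[k] b i) ⊗ₜ[k] (d i ⊗ₜ[k] w) := by
  simp [glue, cupT]

/-- `glue a w t` as a function of `a`. -/
def glueL {A B C D : Type*} [AddCommGroup A] [Module k A] [AddCommGroup B] [Module k B]
    [AddCommGroup C] [Module k C] [AddCommGroup D] [Module k D] (w : D) (t : B ⊗[k] C) :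
    A →ₗ[k] (A ⊗[k] B) ⊗[k] (C ⊗[k] D) where
  toFun a := glue a w t
  map_add' a a' := by
    rw [glue, map_add, TensorProduct.map_add_left]; rfl
  map_smul' r a := by
    rw [glue, map_smul, TensorProduct.map_smul_left]; rfl

theorem glueL_apply (a w : V) (t : V ⊗[k] V) : glueL w t a = glue a w t := rfl

/-- `glue a w t` as a function of `w`. -/
def glueR {A B C D : Type*} [AddCommGroup A] [Module k A] [AddCommGroup B] [Module k B]
    [AddCommGroup C] [Module k C] [AddCommGroup D] [Module k D] (a : A) (t : B ⊗[k] C) :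
    D →ₗ[k] (A ⊗[k] B) ⊗[k] (C ⊗[k] D) where
  toFun w := glue a w t
  map_add' w w' := by
    rw [glue, map_add, TensorProduct.map_add_right]; rfl
  map_smul' r w := by
    rw [glue, map_smul, TensorProduct.map_smul_right]; rfl

theorem glueR_apply (a w : V) (t : V ⊗[k] V) : glueR a t w = glue a w t := rfl

theorem IsCentralDet.cupT (h : IsCentralDet S u b d) : S (cupT k b d) = -cupT k b d := by
  rw [h.apply, lift_cupT h.isCup]; module

variable [CharZero k]

theorem map_glue_cupT (h : IsCentralDet S u b d) (x w : V) :
    TensorProduct.map S S (glue x w (cupT k b d)) =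
      glue x w (cupT k b d) + cupT k b d ⊗ₜ (x ⊗ₜ w) + (x ⊗ₜ w) ⊗ₜ cupT k b d -
        (2 * u x w) • (cupT k b d ⊗ₜ cupT k b d) := by
  have h1 := h.isCup.sum_left (TensorProduct.mk k _ (V ⊗[k] V) (cupT k b d) ∘ₗ
    (TensorProduct.mk k V V).flip w) x
  have h2 := h.isCup.sum_right ((TensorProduct.mk k (V ⊗[k] V) _).flip (cupT k b d) ∘ₗ
    TensorProduct.mk k V V x) w
  have h3 := h.isCup.sum_right (u x) w
  simp only [LinearMap.comp_apply, LinearMap.flip_apply, TensorProduct.mk_apply] at h1 h2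
  have expand : ∀ i, S (x ⊗ₜ b i) ⊗ₜ[k] S (d i ⊗ₜ w) =
      (x ⊗ₜ[k] b i) ⊗ₜ[k] (d i ⊗ₜ[k] w) -
      (2 : k) • u x (b i) • (cupT k b d ⊗ₜ[k] (d i ⊗ₜ[k] w)) -
      (2 : k) • u (d i) w • ((x ⊗ₜ[k] b i) ⊗ₜ[k] cupT k b d) +
      (4 * (u (d i) w • u x (b i))) • (cupT k b d ⊗ₜ[k] cupT k b d) := by
    intro i
    simp only [h.tmul, TensorProduct.sub_tmul, TensorProduct.tmul_sub, TensorProduct.tmul_smul,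
      ← TensorProduct.smul_tmul', smul_eq_mul]
    module
  rw [glue_cupT, map_sum]
  simp only [TensorProduct.map_tmul, expand, Finset.sum_add_distrib, Finset.sum_sub_distrib,
    ← Finset.smul_sum, h1, h2, ← Finset.sum_smul, ← Finset.mul_sum, h3]
  module

theorem middle_cupT_tmul (h : IsCentralDet S u b d) (z w : V) :
    middle S (cupT k b d ⊗ₜ (z ⊗ₜ w)) = cupT k b d ⊗ₜ (z ⊗ₜ w) + glue z w (cupT k b d) := by
  have h1 := h.isCup.sum_right (glueL w (cupT k b d)) z
  simp only [glueL_apply] at h1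
  conv_lhs => enter [2, 2]; rw [cupT]
  simp only [TensorProduct.sum_tmul, map_sum, middle_tmul, h.tmul, map_sub, map_smul,
    Finset.sum_sub_distrib, mul_smul, ← Finset.smul_sum, h1]
  rw [cupT, TensorProduct.sum_tmul, ← cupT]
  simp only [glue, TensorProduct.map_tmul, TensorProduct.mk_apply, LinearMap.flip_apply]
  module

theorem middle_tmul_cupT (h : IsCentralDet S u b d) (x y : V) :
    middle S ((x ⊗ₜ y) ⊗ₜ cupT k b d) = (x ⊗ₜ y) ⊗ₜ cupT k b d + glue x y (cupT k b d) := by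
  have h1 := h.isCup.sum_left (glueR x (cupT k b d)) y
  simp only [glueR_apply] at h1
  conv_lhs => enter [2, 3]; rw [cupT]
  simp only [TensorProduct.tmul_sum, map_sum, middle_tmul, h.tmul, map_sub, map_smul,
    Finset.sum_sub_distrib, mul_smul, ← Finset.smul_sum, h1]
  rw [cupT, TensorProduct.tmul_sum, ← cupT]
  simp only [glue, TensorProduct.map_tmul, TensorProduct.mk_apply, LinearMap.flip_apply]
  module

variable (k b d) in
/-- The tensor `v₁ ⊗ v₁' ⊗ v₂' ⊗ v₂` obtained by nesting two copies of the determinant. -/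
def nest : (V ⊗[k] V) ⊗[k] (V ⊗[k] V) := ∑ i, glue (b i) (d i) (cupT k b d)

theorem middle_cupT_cupT (h : IsCentralDet S u b d) :
    middle S (cupT k b d ⊗ₜ cupT k b d) = cupT k b d ⊗ₜ cupT k b d + nest k b d := by
  conv_lhs => enter [2, 3]; rw [cupT]
  simp only [TensorProduct.tmul_sum, map_sum, middle_cupT_tmul h, Finset.sum_add_distrib]
  rw [← TensorProduct.tmul_sum]; rfl

/-- The twist of `End V = V ⊗ V` on pure tensors. -/
theorem braidSq_tmul (h : IsCentralDet S u b d) (x y z w : V) :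
    braidSq S ((x ⊗ₜ y) ⊗ₜ (z ⊗ₜ w)) =
      (x ⊗ₜ y) ⊗ₜ (z ⊗ₜ w) - (2 * u y z) • glue x w (cupT k b d) -
      (2 * u x y) • (cupT k b d ⊗ₜ (z ⊗ₜ w) + glue z w (cupT k b d)) -
      (2 * u z w) • ((x ⊗ₜ y) ⊗ₜ cupT k b d + glue x y (cupT k b d) -
        (2 * u x y) • (cupT k b d ⊗ₜ cupT k b d + nest k b d)) -
      (2 * u y z) • (cupT k b d ⊗ₜ (x ⊗ₜ w) + (x ⊗ₜ w) ⊗ₜ cupT k b d + glue x w (cupT k b d) -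
        (2 * u x w) • (cupT k b d ⊗ₜ cupT k b d + nest k b d)) := by
  have e1 : ∀ x y z w : V, middle S ((x ⊗ₜ y) ⊗ₜ (z ⊗ₜ w)) =
      (x ⊗ₜ y) ⊗ₜ (z ⊗ₜ w) - (2 * u y z) • glue x w (cupT k b d) := by
    intro x y z w
    rw [middle_tmul, h.tmul, map_sub, map_smul]; rfl
  have e2 : TensorProduct.map S S ((x ⊗ₜ y) ⊗ₜ (z ⊗ₜ w)) = (x ⊗ₜ y) ⊗ₜ (z ⊗ₜ w) -
      (2 * u x y) • (cupT k b d ⊗ₜ (z ⊗ₜ w)) - (2 * u z w) • ((x ⊗ₜ y) ⊗ₜ cupT k b d) +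
      (4 * u x y * u z w) • (cupT k b d ⊗ₜ cupT k b d) := by
    simp only [TensorProduct.map_tmul, h.tmul, TensorProduct.sub_tmul, TensorProduct.tmul_sub,
      TensorProduct.tmul_smul, ← TensorProduct.smul_tmul']
    module
  rw [braidSq, LinearMap.comp_apply, LinearMap.comp_apply, e1, map_sub, map_smul, e2,
    map_glue_cupT h]
  simp only [map_add, map_sub, map_smul, e1, middle_glue, h.cupT, map_neg, middle_cupT_tmul h,
    middle_tmul_cupT h, middle_cupT_cupT h]
  module

end Twist

section Twist

variable {k V : Type*} [Field k] [AddCommGroup V] [Module k V]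
  {ι : Type*} [Fintype ι]
variable {S : V ⊗[k] V →ₗ[k] V ⊗[k] V} {u : V →ₗ[k] V →ₗ[k] k} {b d : ι → V}

/-! ### Traces and products in terms of tensors -/

/-- The product of `End V = V ⊗ V`. -/
def mulSq (u : V →ₗ[k] V →ₗ[k] k) : (V ⊗[k] V) ⊗[k] (V ⊗[k] V) →ₗ[k] V ⊗[k] V :=
  (TensorProduct.lid k V).toLinearMap.lTensor V ∘ₗ
    ((TensorProduct.lift u).rTensor V).lTensor V ∘ₗ
    (TensorProduct.assoc k V V V).symm.toLinearMap.lTensor V ∘ₗ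
    (TensorProduct.assoc k V V (V ⊗[k] V)).toLinearMap

theorem mulSq_tmul (x y z w : V) : mulSq u ((x ⊗ₜ y) ⊗ₜ (z ⊗ₜ w)) = u y z • (x ⊗ₜ[k] w) := by
  simp [mulSq]

/-- Contraction of the left factor `V ⊗ V` with `u`. -/
def capL (u : V →ₗ[k] V →ₗ[k] k) : (V ⊗[k] V) ⊗[k] (V ⊗[k] V) →ₗ[k] V ⊗[k] V :=
  (TensorProduct.lid k _).toLinearMap ∘ₗ (TensorProduct.lift u).rTensor _

/-- Contraction of the right factor `V ⊗ V` with `u`. -/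
def capR (u : V →ₗ[k] V →ₗ[k] k) : (V ⊗[k] V) ⊗[k] (V ⊗[k] V) →ₗ[k] V ⊗[k] V :=
  (TensorProduct.rid k _).toLinearMap ∘ₗ (TensorProduct.lift u).lTensor _

theorem capL_tmul (s t : V ⊗[k] V) : capL u (s ⊗ₜ t) = TensorProduct.lift u s • t := by
  simp [capL]

theorem capR_tmul (s t : V ⊗[k] V) : capR u (s ⊗ₜ t) = TensorProduct.lift u t • s := by
  simp [capR]

variable (b d) in
/-- The projection of `V ⊗ V` onto the kernel of `u` along the determinant. -/
def projSq (u : V →ₗ[k] V →ₗ[k] k) : V ⊗[k] V →ₗ[k] V ⊗[k] V :=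
  LinearMap.id - (TensorProduct.lift u).smulRight (cupT k b d)

theorem projSq_apply (t : V ⊗[k] V) :
    projSq b d u t = t - TensorProduct.lift u t • cupT k b d := rfl

theorem projSq_of_lift_eq_zero {t : V ⊗[k] V} (ht : TensorProduct.lift u t = 0) :
    projSq b d u t = t := by
  simp [projSq_apply, ht]

theorem mulSq_glue_cupT (h : IsCup u b d) (x w : V) :
    mulSq u (glue x w (cupT k b d)) = x ⊗ₜ w := by
  simp only [glue_cupT, map_sum, mulSq_tmul, ← Finset.sum_smul, h.loop, one_smul]

theorem mulSq_cupT_tmul (h : IsCup u b d) (t : V ⊗[k] V) :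
    mulSq u (cupT k b d ⊗ₜ t) = -(2⁻¹ : k) • t := by
  induction t with
  | zero => simp
  | add s t hs ht => rw [TensorProduct.tmul_add, map_add, hs, ht, smul_add]
  | tmul x y =>
    have := h.sum_right ((TensorProduct.mk k V V).flip y) x
    simpa [cupT, TensorProduct.sum_tmul, mulSq_tmul] using this

theorem mulSq_tmul_cupT (h : IsCup u b d) (t : V ⊗[k] V) :
    mulSq u (t ⊗ₜ cupT k b d) = -(2⁻¹ : k) • t := by
  induction t with
  | zero => simp
  | add s t hs ht => rw [TensorProduct.add_tmul, map_add, hs, ht, smul_add]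
  | tmul x y =>
    have := h.sum_left (TensorProduct.mk k V V x) y
    simpa [cupT, TensorProduct.tmul_sum, mulSq_tmul] using this

theorem mulSq_nest (h : IsCup u b d) : mulSq u (nest k b d) = cupT k b d := by
  simp only [nest, map_sum, mulSq_glue_cupT h]; rfl

theorem capL_glue_cupT (h : IsCup u b d) (x w : V) :
    capL u (glue x w (cupT k b d)) = -(2⁻¹ : k) • (x ⊗ₜ w) := by
  have := h.sum_left ((TensorProduct.mk k V V).flip w) x
  simpa [glue_cupT, map_sum, capL_tmul] using this

theorem capR_glue_cupT (h : IsCup u b d) (x w : V) :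
    capR u (glue x w (cupT k b d)) = -(2⁻¹ : k) • (x ⊗ₜ w) := by
  have := h.sum_right (TensorProduct.mk k V V x) w
  simpa [glue_cupT, map_sum, capR_tmul] using this

variable [CharZero k]

theorem mulSq_sub_braidSq_tmul (h : IsCentralDet S u b d) (x y z w : V) :
    mulSq u ((x ⊗ₜ y) ⊗ₜ (z ⊗ₜ w) - braidSq S ((x ⊗ₜ y) ⊗ₜ (z ⊗ₜ w))) =
      (2 * u y z) • (x ⊗ₜ[k] w) + u x y • (z ⊗ₜ w) + u z w • (x ⊗ₜ y) -
        (2 * (u z w * u x y + u y z * u x w)) • cupT k b d := by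
  rw [braidSq_tmul h]
  simp only [map_add, map_sub, map_smul, mulSq_tmul, mulSq_glue_cupT h.isCup,
    mulSq_cupT_tmul h.isCup, mulSq_tmul_cupT h.isCup, mulSq_nest h.isCup]
  module

theorem lift_mulSq_sub_braidSq (h : IsCentralDet S u b d) (t : (V ⊗[k] V) ⊗[k] (V ⊗[k] V)) :
    TensorProduct.lift u (mulSq u (t - braidSq S t)) = 0 := by
  have : TensorProduct.lift u ∘ₗ mulSq u ∘ₗ (LinearMap.id - braidSq S) = 0 := by
    refine TensorProduct.ext_fourfold' fun x y z w => ?_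
    simp only [LinearMap.comp_apply, LinearMap.sub_apply, LinearMap.id_apply]
    rw [mulSq_sub_braidSq_tmul h]
    simp only [map_add, map_sub, map_smul, TensorProduct.lift.tmul, lift_cupT h.isCup, smul_eq_mul,
      LinearMap.zero_apply]
    ring
  exact LinearMap.congr_fun this t

theorem capL_braidSq (h : IsCentralDet S u b d) (s t : V ⊗[k] V) :
    capL u (braidSq S (s ⊗ₜ t)) = TensorProduct.lift u t • s := by
  have : capL u ∘ₗ braidSq S = capR u := by
    refine TensorProduct.ext_fourfold' fun x y z w => ?_
    rw [LinearMap.comp_apply, braidSq_tmul h]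
    simp only [nest, map_sum, map_add, map_sub, map_smul, capL_glue_cupT h.isCup, capL_tmul,
      capR_tmul, lift_cupT h.isCup, TensorProduct.lift.tmul, ← Finset.smul_sum]
    rw [← cupT]
    module
  rw [← LinearMap.comp_apply, this, capR_tmul]

theorem capR_braidSq (h : IsCentralDet S u b d) (s t : V ⊗[k] V) :
    capR u (braidSq S (s ⊗ₜ t)) = TensorProduct.lift u s • t := by
  have : capR u ∘ₗ braidSq S = capL u := by
    refine TensorProduct.ext_fourfold' fun x y z w => ?_
    rw [LinearMap.comp_apply, braidSq_tmul h]
    simp only [nest, map_sum, map_add, map_sub, map_smul, capR_glue_cupT h.isCup, capL_tmul,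
      capR_tmul, lift_cupT h.isCup, TensorProduct.lift.tmul, ← Finset.smul_sum]
    rw [← cupT]
    module
  rw [← LinearMap.comp_apply, this, capL_tmul]

theorem braidSq_cupT_tmul (h : IsCentralDet S u b d) (t : V ⊗[k] V) :
    braidSq S (cupT k b d ⊗ₜ t) = t ⊗ₜ cupT k b d := by
  induction t with
  | zero => simp
  | add s t hs ht => rw [TensorProduct.tmul_add, map_add, hs, ht, TensorProduct.add_tmul]
  | tmul z w =>
    rw [braidSq, LinearMap.comp_apply, LinearMap.comp_apply, middle_cupT_tmul h, map_add,
      TensorProduct.map_tmul, h.cupT, h.tmul, map_glue_cupT h, TensorProduct.tmul_sub,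
      TensorProduct.tmul_smul, TensorProduct.neg_tmul, TensorProduct.neg_tmul]
    simp only [map_add, map_sub, map_neg, map_smul, middle_cupT_tmul h, middle_tmul_cupT h,
      middle_glue, h.cupT]
    module

theorem braidSq_tmul_cupT (h : IsCentralDet S u b d) (t : V ⊗[k] V) :
    braidSq S (t ⊗ₜ cupT k b d) = cupT k b d ⊗ₜ t := by
  induction t with
  | zero => simp
  | add s t hs ht => rw [TensorProduct.add_tmul, map_add, hs, ht, TensorProduct.tmul_add]
  | tmul x y =>
    rw [braidSq, LinearMap.comp_apply, LinearMap.comp_apply, middle_tmul_cupT h, map_add,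
      TensorProduct.map_tmul, h.cupT, h.tmul, map_glue_cupT h, TensorProduct.sub_tmul,
      ← TensorProduct.smul_tmul', TensorProduct.tmul_neg, TensorProduct.tmul_neg]
    simp only [map_add, map_sub, map_neg, map_smul, middle_cupT_tmul h, middle_tmul_cupT h,
      middle_glue, h.cupT]
    module

/-- A tensor whose contractions with `u` on the left and on the right vanish is fixed by the
projections onto the kernel of `u`. -/
theorem map_projSq_of_cap {t : (V ⊗[k] V) ⊗[k] (V ⊗[k] V)} (hl : capL u t = 0)
    (hr : capR u t = 0) : TensorProduct.map (projSq b d u) (projSq b d u) t = t := by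
  have h1 : ∀ t : (V ⊗[k] V) ⊗[k] (V ⊗[k] V),
      (projSq b d u).rTensor (V ⊗[k] V) t = t - cupT k b d ⊗ₜ capL u t := by
    intro t
    induction t with
    | zero => simp
    | add s t hs ht => rw [map_add, hs, ht, map_add, TensorProduct.tmul_add]; abel
    | tmul s t =>
      simp [projSq_apply, capL_tmul, TensorProduct.sub_tmul, TensorProduct.smul_tmul]
  have h2 : ∀ t : (V ⊗[k] V) ⊗[k] (V ⊗[k] V),
      (projSq b d u).lTensor (V ⊗[k] V) t = t - capR u t ⊗ₜ cupT k b d := by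
    intro t
    induction t with
    | zero => simp
    | add s t hs ht => rw [map_add, hs, ht, map_add, TensorProduct.add_tmul]; abel
    | tmul s t =>
      simp [projSq_apply, capR_tmul, TensorProduct.tmul_sub, TensorProduct.smul_tmul]
  have h3 := LinearMap.congr_fun
    (LinearMap.rTensor_comp_lTensor (f := projSq b d u) (g := projSq b d u)) t
  rw [← h3, LinearMap.comp_apply, h2, hr, TensorProduct.zero_tmul, sub_zero, h1, hl,
    TensorProduct.tmul_zero, sub_zero]

end Twist

section SL

variable {k V : Type*} [Field k] [CharZero k] [AddCommGroup V] [Module k V]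
  [FiniteDimensional k V] {n : ℕ}
variable {S : V ⊗[k] V →ₗ[k] V ⊗[k] V} {u : V →ₗ[k] V →ₗ[k] k} {b : Module.Basis (Fin n) k V}
  {d : Fin n → V}

/-! ### The twisted Lie algebra `sl(V_S)` -/

theorem traceS_toEnd (h : IsCentralDet S u b d) (hS : S ∘ₗ S = LinearMap.id) (t : V ⊗[k] V) :
    traceS S (toEnd h.isCup t) = -TensorProduct.lift u t := by
  have h1 : ∀ t : V ⊗[k] V, contractLeft k V ((dualIso h.isCup).toLinearMap.rTensor V t) =
      TensorProduct.lift u t := by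
    intro t
    induction t with
    | zero => simp
    | add s t hs ht => simp only [map_add, hs, ht]
    | tmul x y => simp [dualIso_apply]
  rw [traceS, LinearMap.comp_apply, LinearMap.comp_apply, LinearEquiv.coe_coe, endEquiv_symm_toEnd,
    braidDualRight_dualIso h hS, h1, h.apply, map_sub, map_smul, lift_cupT h.isCup, smul_eq_mul]
  ring

theorem toEnd_neg_two_cupT (h : IsCup u b d) : toEnd h ((-2 : k) • cupT k b d) = 1 := by
  rw [map_smul, toEnd_cupT]; module

theorem traceS_one (h : IsCentralDet S u b d) (hS : S ∘ₗ S = LinearMap.id) : traceS S 1 = 2 := by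
  rw [← toEnd_neg_two_cupT h.isCup, traceS_toEnd h hS, map_smul, lift_cupT h.isCup]
  simp

theorem mem_sl_iff (h : IsCentralDet S u b d) (hS : S ∘ₗ S = LinearMap.id) (t : V ⊗[k] V) :
    toEnd h.isCup t ∈ sl S ↔ TensorProduct.lift u t = 0 := by
  rw [sl, LinearMap.mem_ker, traceS_toEnd h hS, neg_eq_zero]

theorem coe_slProj (h : IsCentralDet S u b d) (hS : S ∘ₗ S = LinearMap.id) (t : V ⊗[k] V) :
    (slProj S (toEnd h.isCup t) : Module.End k V) = toEnd h.isCup (projSq b d u t) := by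
  have h1 : ∀ X, X - ((2 : k)⁻¹ * traceS S X) • (1 : Module.End k V) ∈ sl S := by
    intro X
    rw [sl, LinearMap.mem_ker, map_sub, map_smul, traceS_one h hS, smul_eq_mul]
    ring
  rw [slProj, dif_pos h1, LinearMap.codRestrict_apply]
  simp only [LinearMap.sub_apply, LinearMap.id_apply, LinearMap.smulRight_apply,
    LinearMap.smul_apply, traceS_toEnd h hS, projSq_apply, map_sub, map_smul, toEnd_cupT]
  module

/-- The surjection `V ⊗ V = End V → sl(V_S)`. -/
def toSl (h : IsCentralDet S u b d) : V ⊗[k] V →ₗ[k] sl S :=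
  slProj S ∘ₗ (toEnd h.isCup).toLinearMap

/-- The inclusion `sl(V_S) → End V = V ⊗ V`. -/
def ofSl (h : IsCentralDet S u b d) : sl S →ₗ[k] V ⊗[k] V :=
  (toEnd h.isCup).symm.toLinearMap ∘ₗ (sl S).subtype

theorem toEnd_ofSl (h : IsCentralDet S u b d) (X : sl S) : toEnd h.isCup (ofSl h X) = X := by
  simp [ofSl]

theorem lift_ofSl (h : IsCentralDet S u b d) (hS : S ∘ₗ S = LinearMap.id) (X : sl S) :
    TensorProduct.lift u (ofSl h X) = 0 := by
  rw [← mem_sl_iff h hS, toEnd_ofSl]; exact X.2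

theorem ofSl_toSl (h : IsCentralDet S u b d) (hS : S ∘ₗ S = LinearMap.id) (t : V ⊗[k] V) :
    ofSl h (toSl h t) = projSq b d u t := by
  simp [ofSl, toSl, coe_slProj h hS]

theorem toSl_ofSl (h : IsCentralDet S u b d) (hS : S ∘ₗ S = LinearMap.id) (X : sl S) :
    toSl h (ofSl h X) = X := by
  apply Subtype.ext
  rw [toSl, LinearMap.comp_apply, LinearEquiv.coe_coe, coe_slProj h hS,
    projSq_of_lift_eq_zero (lift_ofSl h hS X), toEnd_ofSl]

theorem toSl_cupT (h : IsCentralDet S u b d) (hS : S ∘ₗ S = LinearMap.id) :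
    toSl h (cupT k b d) = 0 := by
  apply Subtype.ext
  simp [toSl, coe_slProj h hS, projSq_apply, lift_cupT h.isCup]

theorem toSl_surjective (h : IsCentralDet S u b d) (hS : S ∘ₗ S = LinearMap.id) :
    Function.Surjective (toSl h) := fun X => ⟨ofSl h X, toSl_ofSl h hS X⟩

theorem braidEnd_sl (h : IsCentralDet S u b d) (hS : S ∘ₗ S = LinearMap.id) (X Y : sl S) :
    braidEnd S (TensorProduct.map (sl S).subtype (sl S).subtype (X ⊗ₜ Y)) =
      TensorProduct.map (toEnd h.isCup).toLinearMap (toEnd h.isCup).toLinearMap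
        (braidSq S (ofSl h X ⊗ₜ ofSl h Y)) := by
  rw [← braidEnd_toEnd h hS]
  simp [toEnd_ofSl]

theorem braidSl_tmul (h : IsCentralDet S u b d) (hS : S ∘ₗ S = LinearMap.id) (X Y : sl S) :
    braidSl S (X ⊗ₜ Y) =
      TensorProduct.map (toSl h) (toSl h) (braidSq S (ofSl h X ⊗ₜ ofSl h Y)) := by
  rw [braidSl, LinearMap.comp_apply, LinearMap.comp_apply, braidEnd_sl h hS, toSl,
    TensorProduct.map_comp]
  rfl

/-- `sl(V_S)` is stable under the twist. -/
theorem braid_mem (h : IsCentralDet S u b d) (hS : S ∘ₗ S = LinearMap.id) (t : sl S ⊗[k] sl S) :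
    braidEnd S (TensorProduct.map (sl S).subtype (sl S).subtype t) =
      TensorProduct.map (sl S).subtype (sl S).subtype (braidSl S t) := by
  induction t with
  | zero => simp
  | add s t hs ht => simp only [map_add, hs, ht]
  | tmul X Y =>
    have h1 : (sl S).subtype ∘ₗ toSl h = (toEnd h.isCup).toLinearMap ∘ₗ projSq b d u :=
      LinearMap.ext fun t => coe_slProj h hS t
    rw [braidEnd_sl h hS, braidSl_tmul h hS, ← LinearMap.comp_apply (TensorProduct.map _ _)
      (TensorProduct.map _ _), ← TensorProduct.map_comp, h1, TensorProduct.map_comp,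
      LinearMap.comp_apply, map_projSq_of_cap]
    · rw [capL_braidSq h, lift_ofSl h hS, zero_smul]
    · rw [capR_braidSq h, lift_ofSl h hS, zero_smul]

theorem bracketEnd_toEnd (h : IsCentralDet S u b d) (hS : S ∘ₗ S = LinearMap.id)
    (t : (V ⊗[k] V) ⊗[k] (V ⊗[k] V)) :
    bracketEnd S (TensorProduct.map (toEnd h.isCup).toLinearMap (toEnd h.isCup).toLinearMap t) =
      toEnd h.isCup (mulSq u (t - braidSq S t)) := by
  have h1 : LinearMap.mul' k (Module.End k V) ∘ₗ
      TensorProduct.map (toEnd h.isCup).toLinearMap (toEnd h.isCup).toLinearMap =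
      (toEnd h.isCup).toLinearMap ∘ₗ mulSq u := by
    refine TensorProduct.ext_fourfold' fun x y z w => ?_
    simp [toEnd_mul, mulSq_tmul]
  rw [bracketEnd, LinearMap.comp_apply, LinearMap.sub_apply, LinearMap.id_apply,
    braidEnd_toEnd h hS, ← map_sub]
  exact LinearMap.congr_fun h1 _

theorem bracketEnd_sl (h : IsCentralDet S u b d) (hS : S ∘ₗ S = LinearMap.id) (X Y : sl S) :
    bracketEnd S (TensorProduct.map (sl S).subtype (sl S).subtype (X ⊗ₜ Y)) =
      toEnd h.isCup (mulSq u (ofSl h X ⊗ₜ ofSl h Y - braidSq S (ofSl h X ⊗ₜ ofSl h Y))) := by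
  rw [← bracketEnd_toEnd h hS]
  simp [toEnd_ofSl]

theorem bracketSl_tmul (h : IsCentralDet S u b d) (hS : S ∘ₗ S = LinearMap.id) (X Y : sl S) :
    bracketSl S (X ⊗ₜ Y) =
      toSl h (mulSq u (ofSl h X ⊗ₜ ofSl h Y - braidSq S (ofSl h X ⊗ₜ ofSl h Y))) := by
  rw [bracketSl, LinearMap.comp_apply, LinearMap.comp_apply, bracketEnd_sl h hS]; rfl

/-- `sl(V_S)` is stable under the bracket. -/
theorem bracket_mem (h : IsCentralDet S u b d) (hS : S ∘ₗ S = LinearMap.id)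
    (t : sl S ⊗[k] sl S) :
    bracketEnd S (TensorProduct.map (sl S).subtype (sl S).subtype t) = (bracketSl S t : sl S) := by
  induction t with
  | zero => simp
  | add s t hs ht => simp only [map_add, hs, ht, Submodule.coe_add]
  | tmul X Y =>
    rw [bracketEnd_sl h hS, bracketSl_tmul h hS, toSl, LinearMap.comp_apply, LinearEquiv.coe_coe,
      coe_slProj h hS, projSq_of_lift_eq_zero (lift_mulSq_sub_braidSq h _)]

theorem braidSl_toSl (h : IsCentralDet S u b d) (hS : S ∘ₗ S = LinearMap.id) (s t : V ⊗[k] V) :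
    braidSl S (toSl h s ⊗ₜ toSl h t) =
      TensorProduct.map (toSl h) (toSl h) (braidSq S (s ⊗ₜ t)) := by
  simp only [braidSl_tmul h hS, ofSl_toSl h hS, projSq_apply, TensorProduct.sub_tmul,
    TensorProduct.tmul_sub, ← TensorProduct.smul_tmul', TensorProduct.tmul_smul, map_sub, map_smul,
    braidSq_cupT_tmul h, braidSq_tmul_cupT h, TensorProduct.map_tmul, toSl_cupT h hS,
    TensorProduct.zero_tmul, TensorProduct.tmul_zero]
  module

/-- The twist of `sl(V_S)` on generators. -/
theorem braidSl_toSl_tmul (h : IsCentralDet S u b d) (hS : S ∘ₗ S = LinearMap.id) (x y z w : V) :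
    braidSl S (toSl h (x ⊗ₜ y) ⊗ₜ toSl h (z ⊗ₜ w)) =
      toSl h (x ⊗ₜ y) ⊗ₜ toSl h (z ⊗ₜ w) -
      (4 * u y z) • ∑ i, toSl h (x ⊗ₜ b i) ⊗ₜ toSl h (d i ⊗ₜ w) -
      (2 * u x y) • ∑ i, toSl h (z ⊗ₜ b i) ⊗ₜ toSl h (d i ⊗ₜ w) -
      (2 * u z w) • ∑ i, toSl h (x ⊗ₜ b i) ⊗ₜ toSl h (d i ⊗ₜ y) +
      (4 * (u z w * u x y + u y z * u x w)) •
        ∑ i, ∑ l, toSl h (b i ⊗ₜ b l) ⊗ₜ toSl h (d l ⊗ₜ d i) := by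
  rw [braidSl_toSl h hS, braidSq_tmul h]
  simp only [map_sub, map_add, map_smul, nest, map_sum, glue_cupT, TensorProduct.map_tmul,
    toSl_cupT h hS, TensorProduct.zero_tmul, TensorProduct.tmul_zero]
  module

/-- The bracket of `sl(V_S)` on generators. -/
theorem bracketSl_toSl_tmul (h : IsCentralDet S u b d) (hS : S ∘ₗ S = LinearMap.id)
    (x y z w : V) :
    bracketSl S (toSl h (x ⊗ₜ y) ⊗ₜ toSl h (z ⊗ₜ w)) =
      (2 * u y z) • toSl h (x ⊗ₜ w) + u x y • toSl h (z ⊗ₜ w) + u z w • toSl h (x ⊗ₜ y) := by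
  have h1 : ∀ s t : V ⊗[k] V, bracketSl S (toSl h s ⊗ₜ toSl h t) =
      toSl h (mulSq u (s ⊗ₜ t - braidSq S (s ⊗ₜ t))) := by
    intro s t
    simp only [bracketSl_tmul h hS, ofSl_toSl h hS, projSq_apply, TensorProduct.sub_tmul,
      TensorProduct.tmul_sub, ← TensorProduct.smul_tmul', TensorProduct.tmul_smul, map_sub,
      map_smul, braidSq_cupT_tmul h, braidSq_tmul_cupT h, mulSq_cupT_tmul h.isCup,
      mulSq_tmul_cupT h.isCup]
    module
  rw [h1, mulSq_sub_braidSq_tmul h]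
  simp only [map_sub, map_add, map_smul, toSl_cupT h hS]
  module

end SL

theorem quadratic_tmul {k W : Type*} [Field k] [AddCommGroup W] [Module k W] (x y : W) :
    quadratic k W (x ⊗ₜ y) = TensorAlgebra.ι k x * TensorAlgebra.ι k y := by
  simp [quadratic]

section Quotient

variable {k V : Type*} [Field k] [AddCommGroup V] [Module k V] [FiniteDimensional k V] {n : ℕ}
  {S : V ⊗[k] V →ₗ[k] V ⊗[k] V} {b : Module.Basis (Fin n) k V} {c : k}

theorem adjoin_hypGen : Algebra.adjoin k (Set.range (hypGen S b c)) = ⊤ :=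
  adjoin_range_mkAlgHom_ι _

theorem mul_hypGen (t : sl S ⊗[k] sl S) :
    RingQuot.mkAlgHom k (HypRel S b c) (quadratic k (sl S) t) =
      LinearMap.mul' k _ (TensorProduct.map (hypGen S b c) (hypGen S b c) t) := by
  induction t with
  | zero => simp
  | add s t hs ht => simp only [map_add, hs, ht]
  | tmul X Y =>
    rw [quadratic_tmul, map_mul]; rfl

theorem hypGen_comm (t : sl S ⊗[k] sl S) :
    LinearMap.mul' k _ (TensorProduct.map (hypGen S b c) (hypGen S b c) (braidSl S t)) =
      LinearMap.mul' k _ (TensorProduct.map (hypGen S b c) (hypGen S b c) t) := by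
  rw [← mul_hypGen, ← mul_hypGen]
  exact (RingQuot.mkAlgHom_rel k (HypRel.comm t)).symm

theorem hypGen_casimirTensor :
    LinearMap.mul' k _ (TensorProduct.map (hypGen S b c) (hypGen S b c) (casimirTensor S b)) =
      c • 1 := by
  rw [← mul_hypGen, RingQuot.mkAlgHom_rel k HypRel.quadric, AlgHom.commutes,
    Algebra.algebraMap_eq_smul_one]

end Quotient

section Casimir

variable {k V : Type*} [Field k] [CharZero k] [AddCommGroup V] [Module k V]
  [FiniteDimensional k V] {n : ℕ}
variable {S : V ⊗[k] V →ₗ[k] V ⊗[k] V} {u : V →ₗ[k] V →ₗ[k] k} {b : Module.Basis (Fin n) k V}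
  {d : Fin n → V}

/-! ### The Casimir element -/

theorem matUnit_eq (h : IsCup u b d) (i j : Fin n) :
    matUnit b i j = toEnd h (b i ⊗ₜ ((-2 : k) • d j)) := by
  have h1 : b.coord j = dualIso h ((-2 : k) • d j) := by
    refine b.ext fun i => ?_
    rw [dualIso_apply, map_smul, LinearMap.smul_apply, h.pairing, Module.Basis.coord_apply,
      Module.Basis.repr_self, Finsupp.single_apply]
    split_ifs <;> simp
  rw [matUnit, h1, toEnd_eq, LinearMap.lTensor_tmul]; rfl

theorem matC_apply (h : IsCentralDet S u b d) (hS : S ∘ₗ S = LinearMap.id) (i j : Fin n) :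
    matC S b i j = 2 * u (b i) (d j) := by
  rw [matC, Matrix.of_apply, matUnit_eq h.isCup, traceS_toEnd h hS]
  simp

/-- The inverse of the matrix `C` in terms of `u` and the coordinates of `v`. -/
def matBExpl (u : V →ₗ[k] V →ₗ[k] k) (b : Module.Basis (Fin n) k V) (d : Fin n → V) :
    Matrix (Fin n) (Fin n) k :=
  Matrix.of fun i j => 2 * ∑ a, u (b a) (b i) * b.repr (d a) j

theorem matC_mul (h : IsCentralDet S u b d) (hS : S ∘ₗ S = LinearMap.id) :
    matC S b * matBExpl u b d = 1 := by
  ext i m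
  have h1 : ∀ a, ∑ j, u (b a) (b j) * u (b i) (d j) = -(2⁻¹ : k) * u (b i) (b a) := fun a => by
    simpa using h.isCup.sum_left (u (b i)) (b a)
  have h2 : ∑ a, u (b i) (b a) * b.repr (d a) m = -(2⁻¹ : k) * b.repr (b i) m := by
    simpa using h.isCup.sum_left (b.coord m) (b i)
  have h3 : (matC S b * matBExpl u b d) i m =
      ∑ a, (4 * b.repr (d a) m) * ∑ j, u (b a) (b j) * u (b i) (d j) := by
    simp only [Matrix.mul_apply, matC_apply h hS, matBExpl, Matrix.of_apply, Finset.mul_sum]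
    rw [Finset.sum_comm]
    exact Finset.sum_congr rfl fun a _ => Finset.sum_congr rfl fun j _ => by ring
  have h4 : ∀ a, (4 * b.repr (d a) m) * (-(2⁻¹ : k) * u (b i) (b a)) =
      (-2) * (u (b i) (b a) * b.repr (d a) m) := fun a => by ring
  rw [h3]
  simp only [h1, h4, ← Finset.mul_sum, h2, Module.Basis.repr_self, Matrix.one_apply,
    Finsupp.single_apply]
  split_ifs <;> simp

theorem isUnit_det_matC (h : IsCentralDet S u b d) (hS : S ∘ₗ S = LinearMap.id) :
    IsUnit (matC S b).det :=
  Matrix.isUnit_det_of_right_inverse (matC_mul h hS)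

theorem matB_apply (h : IsCentralDet S u b d) (hS : S ∘ₗ S = LinearMap.id) (i j : Fin n) :
    matB S b i j = 2 * ∑ a, u (b a) (b i) * b.repr (d a) j := by
  rw [matB, Matrix.inv_eq_right_inv (matC_mul h hS), matBExpl, Matrix.of_apply]

/-- `∑ B_i^j d_i ⊗ b_j = -v`. -/
theorem sum_matB (h : IsCentralDet S u b d) (hS : S ∘ₗ S = LinearMap.id) :
    ∑ i, ∑ j, matB S b i j • (d i ⊗ₜ[k] b j) = -cupT k b d := by
  have h1 : ∀ i, ∑ j, matB S b i j • (d i ⊗ₜ[k] b j) =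
      (2 : k) • ∑ a, u (b a) (b i) • (d i ⊗ₜ[k] d a) := by
    intro i
    simp only [matB_apply h hS, Finset.mul_sum, Finset.sum_smul, Finset.smul_sum]
    rw [Finset.sum_comm]
    refine Finset.sum_congr rfl fun a _ => ?_
    conv_rhs => rw [← b.sum_repr (d a)]
    simp only [TensorProduct.tmul_sum, TensorProduct.tmul_smul, Finset.smul_sum]
    exact Finset.sum_congr rfl fun j _ => by module
  simp only [h1, ← Finset.smul_sum]
  rw [Finset.sum_comm]
  have h2 : ∀ a, ∑ i, u (b a) (b i) • (d i ⊗ₜ[k] d a) = -(2⁻¹ : k) • (b a ⊗ₜ[k] d a) :=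
    fun a => h.isCup.sum_left ((TensorProduct.mk k V V).flip (d a)) (b a)
  simp only [h2, ← Finset.smul_sum]
  rw [cupT]
  module

theorem slGen_eq (h : IsCentralDet S u b d) (i j : Fin n) :
    slGen S b i j = (-2 : k) • toSl h (b i ⊗ₜ d j) := by
  rw [slGen, matUnit_eq h.isCup, TensorProduct.tmul_smul, map_smul, map_smul]; rfl

/-- The Casimir element in terms of the determinant. -/
theorem sum_matB_slGen (h : IsCentralDet S u b d) (hS : S ∘ₗ S = LinearMap.id) {W : Type*}
    [AddCommGroup W] [Module k W] (F : sl S →ₗ[k] sl S →ₗ[k] W) :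
    ∑ i, ∑ j, ∑ l, matB S b i j • F (slGen S b l i) (slGen S b j l) =
      (-4 : k) • ∑ i, ∑ l, F (toSl h (b i ⊗ₜ b l)) (toSl h (d l ⊗ₜ d i)) := by
  have h1 : ∀ l, ∑ i, ∑ j, matB S b i j • F (toSl h (b l ⊗ₜ d i)) (toSl h (b j ⊗ₜ d l)) =
      -∑ i, F (toSl h (b l ⊗ₜ b i)) (toSl h (d i ⊗ₜ d l)) := by
    intro l
    have := congrArg (TensorProduct.lift (F.compl₁₂ (toSl h ∘ₗ TensorProduct.mk k V V (b l))
      (toSl h ∘ₗ (TensorProduct.mk k V V).flip (d l)))) (sum_matB h hS)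
    simpa [cupT] using this
  have h2 : ∑ i, ∑ j, ∑ l, matB S b i j • F (slGen S b l i) (slGen S b j l) =
      (4 : k) • ∑ l, ∑ i, ∑ j,
        matB S b i j • F (toSl h (b l ⊗ₜ d i)) (toSl h (b j ⊗ₜ d l)) := by
    simp only [slGen_eq h, map_smul, LinearMap.smul_apply, Finset.smul_sum]
    refine Eq.trans ?_ Finset.sum_comm
    refine Finset.sum_congr rfl fun i _ => Eq.trans Finset.sum_comm ?_
    exact Finset.sum_congr rfl fun l _ => Finset.sum_congr rfl fun j _ => by module
  rw [h2]
  simp only [h1, Finset.sum_neg_distrib]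
  module

theorem casimirTensor_eq (h : IsCentralDet S u b d) (hS : S ∘ₗ S = LinearMap.id) :
    casimirTensor S b =
      (-4 : k) • ∑ i, ∑ l, toSl h (b i ⊗ₜ b l) ⊗ₜ[k] toSl h (d l ⊗ₜ d i) := by
  have := sum_matB_slGen h hS (W := sl S ⊗[k] sl S) (TensorProduct.mk k (sl S) (sl S))
  simp only [TensorProduct.mk_apply] at this
  rw [casimirTensor, this]

/-! ### Generators and relations of the hyperboloid -/

/-- The value of a map `γ` with domain `sl(V_S)` on the image of `x ⊗ y` in `sl(V_S)`, as a
bilinear map of `x` and `y`. -/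
def onSl {A : Type*} [AddCommGroup A] [Module k A] (h : IsCentralDet S u b d)
    (γ : sl S →ₗ[k] A) : V →ₗ[k] V →ₗ[k] A :=
  TensorProduct.curry (γ ∘ₗ toSl h)

theorem onSl_apply {A : Type*} [AddCommGroup A] [Module k A] (h : IsCentralDet S u b d)
    (γ : sl S →ₗ[k] A) (x y : V) : onSl h γ x y = γ (toSl h (x ⊗ₜ y)) := rfl

theorem adjoin_onSl {A : Type*} [Ring A] [Algebra k A] (h : IsCentralDet S u b d)
    (hS : S ∘ₗ S = LinearMap.id) {γ : sl S →ₗ[k] A}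
    (hγ : Algebra.adjoin k (Set.range γ) = ⊤) :
    Algebra.adjoin k (Set.range (TensorProduct.lift (onSl h γ))) = ⊤ := by
  have h1 : TensorProduct.lift (onSl h γ) = γ ∘ₗ toSl h := TensorProduct.ext' fun _ _ => rfl
  rw [h1, LinearMap.coe_comp, (toSl_surjective h hS).range_comp, hγ]

variable {c : k}

/-- The zigzag relation is the commutation relation contracted with the cup, with the value of
the quadric inserted. -/
theorem isHyp_hypGen (h : IsCentralDet S u b d) (hS : S ∘ₗ S = LinearMap.id) :
    IsHyp u b d (-c / 4) (onSl h (hypGen S b c)) := by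
  refine ⟨?_, fun x w => ?_⟩
  · have := congrArg (hypGen S b c) (toSl_cupT h hS)
    simpa [cupT, onSl_apply] using this
  · have hcas : ∑ i, ∑ l, onSl h (hypGen S b c) (b i) (b l) *
      onSl h (hypGen S b c) (d l) (d i) = (-c / 4) • 1 := by
      have := hypGen_casimirTensor (S := S) (b := b) (c := c)
      rw [casimirTensor_eq h hS] at this
      simp only [map_smul, map_sum, TensorProduct.map_tmul, LinearMap.mul'_apply] at this
      simp only [onSl_apply]
      have h4 : (-4 : k) ≠ 0 := by norm_num
      rw [← eq_inv_smul_iff₀ h4] at this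
      rw [this]
      match_scalars
      field_simp
    have hcomm : ∀ x y z w,
        (4 * u y z) • ∑ i, onSl h (hypGen S b c) x (b i) * onSl h (hypGen S b c) (d i) w +
        (2 * u x y) • ∑ i, onSl h (hypGen S b c) z (b i) * onSl h (hypGen S b c) (d i) w +
        (2 * u z w) • ∑ i, onSl h (hypGen S b c) x (b i) * onSl h (hypGen S b c) (d i) y =
        (4 * (u z w * u x y + u y z * u x w)) • (-c / 4) • 1 := by
      intro x y z w
      have := hypGen_comm (S := S) (b := b) (c := c) (toSl h (x ⊗ₜ y) ⊗ₜ toSl h (z ⊗ₜ w))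
      rw [braidSl_toSl_tmul h hS] at this
      simp only [map_add, map_sub, map_smul, map_sum, TensorProduct.map_tmul,
        LinearMap.mul'_apply, ← onSl_apply, hcas] at this
      rw [← sub_eq_zero] at this ⊢
      rw [← neg_eq_zero, ← this]
      abel
    have hsum := Finset.sum_congr rfl fun i (_ : i ∈ Finset.univ) => hcomm x (b i) (d i) w
    have e1 := h.isCup.sum_left (∑ i, (LinearMap.mul k _).flip (onSl h (hypGen S b c) (d i) w) ∘ₗ
      (onSl h (hypGen S b c)).flip (b i)) x
    have e2 := h.isCup.sum_right (∑ i, (LinearMap.mul k _ (onSl h (hypGen S b c) x (b i))) ∘ₗ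
      onSl h (hypGen S b c) (d i)) w
    have e3 := h.isCup.sum_right (LinearMap.toSpanSingleton k (Hyperboloid S b c)
      ((-c / 4) • 1) ∘ₗ u x) w
    simp only [LinearMap.sum_apply, LinearMap.comp_apply, LinearMap.flip_apply,
      LinearMap.mul_apply', LinearMap.toSpanSingleton_apply] at e1 e2 e3
    simp only [Finset.sum_add_distrib, mul_smul, ← Finset.smul_sum, e1, e2, ← Finset.sum_smul,
      h.isCup.loop, e3, one_smul, mul_add, add_smul] at hsum
    linear_combination (norm := module) (2⁻¹ : k) • hsum

/-- The universal property of the hyperboloid. -/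
theorem exists_algHom_hyperboloid (h : IsCentralDet S u b d) (hS : S ∘ₗ S = LinearMap.id)
    {B : Type*} [Ring B] [Algebra k B] {g : V →ₗ[k] V →ₗ[k] B}
    (hg : IsHyp u b d (-c / 4) g) :
    ∃ φ : Hyperboloid S b c →ₐ[k] B, ∀ x y, φ (onSl h (hypGen S b c) x y) = g x y := by
  let ψ : sl S →ₗ[k] B := TensorProduct.lift g ∘ₗ ofSl h
  have hψ : ∀ x y, ψ (toSl h (x ⊗ₜ y)) = g x y := by
    intro x y
    have h1 : TensorProduct.lift g (cupT k b d) = 0 := by simpa [cupT] using hg.cup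
    simp only [ψ, LinearMap.comp_apply, ofSl_toSl h hS, projSq_apply, map_sub, map_smul, h1]
    simp
  have hquad : ∀ t, TensorAlgebra.lift k ψ (quadratic k (sl S) t) =
      LinearMap.mul' k B (TensorProduct.map ψ ψ t) := by
    intro t
    induction t with
    | zero => simp
    | add s t hs ht => simp only [map_add, hs, ht]
    | tmul X Y => simp [quadratic_tmul]
  have hcas : ∑ i, ∑ l, g (b i) (b l) * g (d l) (d i) = (-c / 4) • 1 := by
    simp only [hg.zigzag, ← Finset.sum_smul, ← Finset.mul_sum, h.isCup.loop, mul_one]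
  have hcomm : ∀ t, LinearMap.mul' k B (TensorProduct.map ψ ψ (braidSl S t)) =
      LinearMap.mul' k B (TensorProduct.map ψ ψ t) := by
    have : (LinearMap.mul' k B ∘ₗ TensorProduct.map ψ ψ ∘ₗ braidSl S) ∘ₗ
        TensorProduct.map (toSl h) (toSl h) =
        (LinearMap.mul' k B ∘ₗ TensorProduct.map ψ ψ) ∘ₗ
        TensorProduct.map (toSl h) (toSl h) := by
      refine TensorProduct.ext_fourfold' fun x y z w => ?_
      simp only [LinearMap.comp_apply, TensorProduct.map_tmul]
      rw [braidSl_toSl_tmul h hS]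
      simp only [map_add, map_sub, map_smul, map_sum, TensorProduct.map_tmul,
        LinearMap.mul'_apply, hψ, hg.zigzag, ← Finset.sum_smul, ← Finset.mul_sum, h.isCup.loop]
      module
    intro t
    obtain ⟨t, rfl⟩ := TensorProduct.map_surjective (toSl_surjective h hS)
      (toSl_surjective h hS) t
    exact LinearMap.congr_fun this t
  let φ : Hyperboloid S b c →ₐ[k] B := RingQuot.liftAlgHom k ⟨TensorAlgebra.lift k ψ, by
    intro p q hpq
    cases hpq with
    | comm t => rw [hquad, hquad, hcomm]
    | quadric =>
      rw [hquad, casimirTensor_eq h hS, AlgHom.commutes, Algebra.algebraMap_eq_smul_one]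
      simp only [map_smul, map_sum, TensorProduct.map_tmul, LinearMap.mul'_apply, hψ, hcas]
      match_scalars
      field_simp⟩
  refine ⟨φ, fun x y => ?_⟩
  rw [← hψ]
  have : φ (hypGen S b c (toSl h (x ⊗ₜ y))) =
      TensorAlgebra.lift k ψ (TensorAlgebra.ι k (toSl h (x ⊗ₜ y))) :=
    RingQuot.liftAlgHom_mkAlgHom_apply k _ _ _
  rw [onSl_apply, this, TensorAlgebra.lift_ι_apply]

end Casimir

universe uk uV uA

section Free

variable {k A W W' : Type*} [Field k] [Ring A] [Algebra k A] [AddCommGroup W] [Module k W]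
  [AddCommGroup W'] [Module k W']

/-! ### Maps of free left modules -/

/-- Left multiplication by `a` on the free left module `A ⊗ W`. -/
def lact : A →ₗ[k] Module.End k (A ⊗[k] W) :=
  LinearMap.rTensorHom W ∘ₗ LinearMap.mul k A

theorem lact_tmul (a f : A) (x : W) : lact (k := k) a (f ⊗ₜ x) = (a * f) ⊗ₜ x := rfl

theorem lact_lact (a f : A) (m : A ⊗[k] W) : lact a (lact f m) = lact (a * f) m := by
  induction m with
  | zero => simp
  | add s t hs ht => simp only [map_add, hs, ht]
  | tmul e x => simp [lact_tmul, mul_assoc]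

theorem lact_one (m : A ⊗[k] W) : lact 1 m = m := by
  induction m with
  | zero => simp
  | add s t hs ht => simp only [map_add, hs, ht]
  | tmul e x => simp [lact_tmul]

theorem lTensor_lact (φ : W →ₗ[k] W') (a : A) (m : A ⊗[k] W) :
    φ.lTensor A (lact a m) = lact a (φ.lTensor A m) := by
  induction m with
  | zero => simp
  | add s t hs ht => simp only [map_add, hs, ht]
  | tmul e x => simp [lact_tmul]

/-- The map of free left modules `A ⊗ W → A ⊗ W'` which extends `r : W → A ⊗ W'`. -/
def extend : (W →ₗ[k] A ⊗[k] W') →ₗ[k] A ⊗[k] W →ₗ[k] A ⊗[k] W' where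
  toFun r := TensorProduct.lift (LinearMap.lcomp k (A ⊗[k] W') r ∘ₗ lact)
  map_add' _ _ := TensorProduct.ext' fun _ _ => by simp
  map_smul' _ _ := TensorProduct.ext' fun _ _ => by simp

theorem extend_tmul (r : W →ₗ[k] A ⊗[k] W') (a : A) (x : W) :
    extend r (a ⊗ₜ x) = lact a (r x) := by
  simp [extend]

theorem extend_lact (r : W →ₗ[k] A ⊗[k] W') (a : A) (m : A ⊗[k] W) :
    extend r (lact a m) = lact a (extend r m) := by
  induction m with
  | zero => simp
  | add s t hs ht => simp only [map_add, hs, ht]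
  | tmul e x => rw [lact_tmul, extend_tmul, extend_tmul, lact_lact]

end Free

section Pass

variable {k V A ι : Type*} [Field k] [AddCommGroup V] [Module k V] [Fintype ι]
  [Ring A] [Algebra k A]
variable {u : V →ₗ[k] V →ₗ[k] k} {b d : ι → V} {g : V →ₗ[k] V →ₗ[k] A} {K : k}

/-! ### The twist of `V` and the hyperboloid -/

variable (b d) in
/-- The map `w ↦ ∑ g(w, b i) ⊗ d i`. -/
def turn (g : V →ₗ[k] V →ₗ[k] A) : V →ₗ[k] A ⊗[k] V :=
  ∑ i, (TensorProduct.mk k A V).flip (d i) ∘ₗ g.flip (b i)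

theorem turn_apply (w : V) : turn b d g w = ∑ i, g w (b i) ⊗ₜ d i := by
  simp [turn, LinearMap.sum_apply]

variable (b d) in
/-- The twist `x ⊗ g(z, w) ↦ g(x, z) ⊗ w - 2 u(z, w) ∑ g(x, b i) ⊗ d i -
2 u(x, z) ∑ g(w, b i) ⊗ d i` of a vector and a generator of the hyperboloid. -/
def pass (u : V →ₗ[k] V →ₗ[k] k) (g : V →ₗ[k] V →ₗ[k] A) :
    V →ₗ[k] V →ₗ[k] V →ₗ[k] A ⊗[k] V :=
  LinearMap.mk₂ k (fun z w => (TensorProduct.mk k A V).flip w ∘ₗ g.flip z -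
      (2 * u z w) • turn b d g - (2 : k) • (u.flip z).smulRight (turn b d g w))
    (fun _ _ _ => LinearMap.ext fun _ => by simp; module)
    (fun _ _ _ => LinearMap.ext fun _ => by simp; module)
    (fun _ _ _ => LinearMap.ext fun _ => by simp; module)
    (fun _ _ _ => LinearMap.ext fun _ => by simp; module)

theorem pass_apply (z w x : V) : pass b d u g z w x =
    g x z ⊗ₜ w - (2 * u z w) • turn b d g x - (2 * u x z) • turn b d g w := by
  simp [pass, smul_smul]

variable [CharZero k]

/-- Sliding a cup through a generator. -/
theorem sum_pass (h : IsCup u b d) (hg : IsHyp u b d K g) (w : V) :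
    ∑ i, pass b d u g (d i) w (b i) = -turn b d g w := by
  have h1 := h.sum_right (turn b d g) w
  simp only [pass_apply, Finset.sum_sub_distrib, mul_smul, ← Finset.smul_sum, h1,
    ← TensorProduct.sum_tmul, hg.cup, TensorProduct.zero_tmul, ← Finset.sum_smul, h.loop]
  module

/-- The twist of `∑ g(x, b i) ⊗ d i` and a generator. -/
theorem extend_pass_turn (h : IsCup u b d) (hg : IsHyp u b d K g) (x z w : V) :
    extend (pass b d u g z w) (turn b d g x) =
      (K * u x z) • (1 ⊗ₜ w) + (K * u z w) • (1 ⊗ₜ x) + lact (g x z) (turn b d g w) := by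
  have h1 : ∑ j, lact (g x (b j)) (turn b d g (d j)) = -(2⁻¹ * K) • ((1 : A) ⊗ₜ[k] x) := by
    have h2 := h.sum_left (TensorProduct.mk k A V 1) x
    simp only [TensorProduct.mk_apply] at h2
    simp only [turn_apply, map_sum, lact_tmul]
    rw [Finset.sum_comm]
    simp only [← TensorProduct.sum_tmul, hg.zigzag, ← TensorProduct.smul_tmul', mul_smul,
      ← Finset.smul_sum, h2]
    module
  have h3 := h.sum_right ((lact (k := k)).flip (turn b d g w) ∘ₗ g x) z
  simp only [LinearMap.comp_apply, LinearMap.flip_apply] at h3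
  rw [turn_apply, map_sum]
  simp only [extend_tmul, pass_apply, map_sub, map_smul, Finset.sum_sub_distrib, lact_tmul,
    ← TensorProduct.sum_tmul, hg.zigzag, ← Finset.smul_sum, h1, mul_smul, h3]
  simp only [← TensorProduct.smul_tmul']
  module

/-- The twists of vectors and generators satisfy the quadratic relation of the hyperboloid. -/
theorem sum_extend_pass (h : IsCup u b d) (hg : IsHyp u b d K g) (z w x : V) :
    ∑ i, extend (pass b d u g (d i) w) (pass b d u g z (b i) x) = (K * u z w) • (1 ⊗ₜ x) := by
  have h1 := h.sum_left (LinearMap.applyₗ (turn b d g x) ∘ₗ extend ∘ₗ (pass b d u g).flip w) z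
  have h2 := h.sum_right (TensorProduct.mk k A V 1) w
  simp only [LinearMap.comp_apply, LinearMap.flip_apply, LinearMap.applyₗ_apply_apply,
    TensorProduct.mk_apply] at h1 h2
  have h3 : ∑ i, lact (g (b i) (d i)) (turn b d g w) = 0 := by
    rw [← LinearMap.sum_apply, ← map_sum, hg.cup]; simp
  have expand : ∀ i, extend (pass b d u g (d i) w) (pass b d u g z (b i) x) =
      lact (g x z) (pass b d u g (d i) w (b i)) -
      (2 : k) • u z (b i) • extend (pass b d u g (d i) w) (turn b d g x) -
      (2 * u x z) • ((K * u (b i) (d i)) • (1 ⊗ₜ w) + K • u (d i) w • (1 ⊗ₜ b i) +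
        lact (g (b i) (d i)) (turn b d g w)) := by
    intro i
    rw [pass_apply]
    simp only [map_sub, map_smul, extend_tmul, extend_pass_turn h hg]
    module
  have h4 : ∑ i, lact (g x z) (pass b d u g (d i) w (b i)) = -lact (g x z) (turn b d g w) := by
    rw [← map_sum, sum_pass h hg, map_neg]
  simp only [expand, Finset.sum_sub_distrib, Finset.sum_add_distrib, ← Finset.smul_sum, h1, h2, h3,
    h4, ← Finset.sum_smul, ← Finset.mul_sum, h.loop]
  rw [extend_pass_turn h hg]
  module

/-- If the hyperboloid has the universal property, then the twists of vectors and generators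
extend to a twist of vectors and functions on the hyperboloid. -/
theorem exists_passHom {k : Type uk} {V : Type uV} {A : Type uA} {ι : Type*} [Field k]
    [CharZero k] [AddCommGroup V] [Module k V] [Fintype ι] [Ring A] [Algebra k A]
    {u : V →ₗ[k] V →ₗ[k] k} {b d : ι → V} {g : V →ₗ[k] V →ₗ[k] A} {K : k}
    (h : IsCup u b d) (hg : IsHyp u b d K g)
    (hgen : Algebra.adjoin k (Set.range (TensorProduct.lift g)) = ⊤)
    (hlift : ∀ {B : Type (max uA uV)} [Ring B] [Algebra k B] {g' : V →ₗ[k] V →ₗ[k] B},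
      IsHyp u b d K g' → ∃ φ : A →ₐ[k] B, ∀ x y, φ (g x y) = g' x y) :
    ∃ τ : A →ₗ[k] V →ₗ[k] A ⊗[k] V, (∀ x, τ 1 x = 1 ⊗ₜ x) ∧
      (∀ z w, τ (g z w) = pass b d u g z w) ∧ ∀ f e, τ (f * e) = extend (τ e) ∘ₗ τ f := by
  let opE : (V →ₗ[k] A ⊗[k] V) →ₗ[k] (Module.End k (A ⊗[k] V))ᵐᵒᵖ :=
    (MulOpposite.opLinearEquiv k).toLinearMap ∘ₗ extend
  have hopE : ∀ r, (opE r).unop = extend r := fun _ => rfl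
  have hsum : ∀ F : ι → (Module.End k (A ⊗[k] V))ᵐᵒᵖ,
      (∑ i, F i).unop = ∑ i, (F i).unop := fun F => map_sum MulOpposite.opAddEquiv.symm F _
  obtain ⟨φ, hφ⟩ := hlift (B := (Module.End k (A ⊗[k] V))ᵐᵒᵖ)
    (g' := (pass b d u g).compr₂ opE) (by
    refine ⟨?_, fun z w => ?_⟩
    · have : ∑ i, pass b d u g (b i) (d i) = 0 := by
        refine LinearMap.ext fun x => ?_
        have h1 := h.sum_left (turn b d g) x
        simp only [LinearMap.sum_apply, pass_apply, Finset.sum_sub_distrib, mul_smul,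
          ← Finset.smul_sum, h1, ← Finset.sum_smul, h.loop, LinearMap.zero_apply]
        rw [turn_apply]
        module
      simp only [LinearMap.compr₂_apply, ← map_sum, this, map_zero]
    · apply MulOpposite.unop_injective
      refine TensorProduct.ext' fun a x => ?_
      simp only [LinearMap.compr₂_apply, hsum, MulOpposite.unop_mul, hopE,
        LinearMap.sum_apply, Module.End.mul_apply, extend_tmul, extend_lact, ← map_sum,
        sum_extend_pass h hg, MulOpposite.unop_smul, MulOpposite.unop_one, LinearMap.smul_apply,
        Module.End.one_apply, map_smul, lact_tmul, mul_one])
  have hlin : ∀ f a m, (φ f).unop (lact a m) = lact a ((φ f).unop m) := by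
    let M : Submodule k A :=
      { carrier := {f | ∀ a m, (φ f).unop (lact a m) = lact a ((φ f).unop m)}
        zero_mem' := fun a m => by simp
        add_mem' := fun {f e} hf he a m => by
          simp only [map_add, MulOpposite.unop_add, LinearMap.add_apply, hf a m, he a m]
        smul_mem' := fun r f hf a m => by
          simp only [map_smul, MulOpposite.unop_smul, LinearMap.smul_apply, hf a m] }
    have hM : M = ⊤ := eq_top_of_left_stable₂ g hgen M (fun a m => by simp)
      fun x y f hf a m => by
        rw [map_mul, MulOpposite.unop_mul, Module.End.mul_apply, Module.End.mul_apply, hφ,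
          LinearMap.compr₂_apply, hopE, extend_lact, hf]
    intro f
    have : f ∈ M := by rw [hM]; trivial
    exact this
  let τ : A →ₗ[k] V →ₗ[k] A ⊗[k] V :=
    (LinearMap.lcomp k (A ⊗[k] V) (TensorProduct.mk k A V 1)) ∘ₗ
      (MulOpposite.opLinearEquiv k).symm.toLinearMap ∘ₗ φ.toLinearMap
  have hτ : ∀ f x, τ f x = (φ f).unop (1 ⊗ₜ x) := fun _ _ => rfl
  have hext : ∀ f, extend (τ f) = (φ f).unop := by
    intro f
    refine TensorProduct.ext' fun a x => ?_
    rw [extend_tmul, hτ, ← hlin, lact_tmul, mul_one]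
  refine ⟨τ, fun x => by simp [hτ], fun z w => LinearMap.ext fun x => ?_,
    fun f e => LinearMap.ext fun x => ?_⟩
  · rw [hτ, hφ, LinearMap.compr₂_apply, hopE, extend_tmul, lact_one]
  · rw [hτ, map_mul, MulOpposite.unop_mul, Module.End.mul_apply, ← hτ, ← hext]
    rfl

end Pass

section PassTwo

variable {k V A ι : Type*} [Field k] [AddCommGroup V] [Module k V] [Fintype ι]
  [Ring A] [Algebra k A]
variable {u : V →ₗ[k] V →ₗ[k] k} {b d : ι → V} {g : V →ₗ[k] V →ₗ[k] A} {K : k}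

/-- A function on the hyperboloid passes two vectors, one after the other. -/
def passTwo (τ : A →ₗ[k] V →ₗ[k] A ⊗[k] V) : A →ₗ[k] V ⊗[k] V →ₗ[k] A ⊗[k] (V ⊗[k] V) where
  toFun f := TensorProduct.lift
    ((LinearMap.llcomp k V _ _ (TensorProduct.assoc k A V V).toLinearMap) ∘ₗ
      (LinearMap.lcomp k _ (τ f)) ∘ₗ LinearMap.rTensorHom V ∘ₗ τ.flip)
  map_add' f e := TensorProduct.ext' fun x y => by simp
  map_smul' r f := TensorProduct.ext' fun x y => by simp

theorem passTwo_tmul (τ : A →ₗ[k] V →ₗ[k] A ⊗[k] V) (f : A) (x y : V) :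
    passTwo τ f (x ⊗ₜ y) = TensorProduct.assoc k A V V ((τ.flip x).rTensor V (τ f y)) := by
  simp [passTwo]

variable {τ : A →ₗ[k] V →ₗ[k] A ⊗[k] V}

theorem passTwo_one (h1 : ∀ x, τ 1 x = 1 ⊗ₜ x) (t : V ⊗[k] V) : passTwo τ 1 t = 1 ⊗ₜ t := by
  induction t with
  | zero => simp
  | add s t hs ht => rw [map_add, hs, ht, TensorProduct.tmul_add]
  | tmul x y => simp [passTwo_tmul, h1]

theorem passTwo_mul (hmul : ∀ f e, τ (f * e) = extend (τ e) ∘ₗ τ f) (f e : A) :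
    passTwo τ (f * e) = extend (passTwo τ e) ∘ₗ passTwo τ f := by
  have h0 : ∀ (a : A) (y : V) (m : A ⊗[k] V), TensorProduct.assoc k A V V (lact a m ⊗ₜ y) =
      lact a (TensorProduct.assoc k A V V (m ⊗ₜ y)) := by
    intro a y m
    induction m with
    | zero => simp
    | add s t hs ht => simp only [map_add, TensorProduct.add_tmul, hs, ht]
    | tmul c x => simp [lact_tmul]
  have h2 : ∀ (x' : V) (a : A) (n : A ⊗[k] V),
      lact a (TensorProduct.assoc k A V V ((τ.flip x').rTensor V n)) =
      TensorProduct.assoc k A V V ((((lact (k := k) (W := V)) a) ∘ₗ τ.flip x').rTensor V n) := by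
    intro x' a n
    induction n with
    | zero => simp
    | add s t hs ht => simp only [map_add, hs, ht]
    | tmul c y => simp [h0]
  have h3 : ∀ (p : A ⊗[k] V) (y' : V),
      extend (passTwo τ e) (TensorProduct.assoc k A V V (p ⊗ₜ y')) =
      TensorProduct.assoc k A V V
        (((LinearMap.applyₗ p) ∘ₗ extend ∘ₗ τ).rTensor V (τ e y')) := by
    intro p y'
    induction p with
    | zero => simp
    | add s t hs ht =>
      rw [TensorProduct.add_tmul, map_add, map_add, hs, ht, map_add, LinearMap.add_comp,
        LinearMap.rTensor_add, LinearMap.add_apply, map_add]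
    | tmul a x' =>
      rw [TensorProduct.assoc_tmul, extend_tmul, passTwo_tmul, h2]
      congr 3
  have h4 : ∀ (x : V) (m : A ⊗[k] V),
      TensorProduct.assoc k A V V ((τ.flip x).rTensor V (extend (τ e) m)) =
      extend (passTwo τ e) (TensorProduct.assoc k A V V ((τ.flip x).rTensor V m)) := by
    intro x m
    induction m with
    | zero => simp
    | add s t hs ht => simp only [map_add, hs, ht]
    | tmul a y =>
      rw [extend_tmul, LinearMap.rTensor_tmul, h3]
      congr 1
      generalize τ e y = n
      induction n with
      | zero => simp
      | add s t hs ht => simp only [map_add, hs, ht]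
      | tmul c y' => simp [lact_tmul, hmul]
  refine TensorProduct.ext' fun x y => ?_
  rw [LinearMap.comp_apply, passTwo_tmul, passTwo_tmul, hmul, LinearMap.comp_apply, h4]

end PassTwo

section PassTwoCup

variable {k V A ι : Type*} [Field k] [CharZero k] [AddCommGroup V] [Module k V] [Fintype ι]
  [Ring A] [Algebra k A]
variable {u : V →ₗ[k] V →ₗ[k] k} {b d : ι → V} {g : V →ₗ[k] V →ₗ[k] A} {K : k}
  {τ : A →ₗ[k] V →ₗ[k] A ⊗[k] V}

/-- The twist of two vectors and a generator of the hyperboloid. -/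
theorem passTwo_generator (h : IsCup u b d) (hτ : ∀ z w, τ (g z w) = pass b d u g z w)
    (x y z w : V) :
    passTwo τ (g z w) (x ⊗ₜ y) =
      g x y ⊗ₜ (z ⊗ₜ w) - (4 * u y z) • ∑ i, g x (b i) ⊗ₜ (d i ⊗ₜ w) -
      (2 * u x y) • ∑ i, g z (b i) ⊗ₜ (d i ⊗ₜ w) -
      (2 * u z w) • ∑ i, g x (b i) ⊗ₜ (d i ⊗ₜ y) +
      (4 * (u z w * u x y + u y z * u x w)) • ∑ i, ∑ l, g (b i) (b l) ⊗ₜ (d l ⊗ₜ d i) -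
      (2 * u z w) • (g x y ⊗ₜ cupT k b d) - (2 * u y z) • (g x w ⊗ₜ cupT k b d) := by
  let G : (A ⊗[k] V) ⊗[k] V →ₗ[k] A ⊗[k] (V ⊗[k] V) := (TensorProduct.assoc k A V V).toLinearMap
  have g1 : ∀ (a : A) (x y : V), G ((a ⊗ₜ x) ⊗ₜ y) = a ⊗ₜ (x ⊗ₜ y) := fun a x y => by simp [G]
  have g2 : ∀ x w, G (turn b d g x ⊗ₜ w) = ∑ i, g x (b i) ⊗ₜ (d i ⊗ₜ w) := by
    intro x w
    simp only [turn_apply, TensorProduct.sum_tmul, map_sum, g1]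
  have g3 : ∀ x y, G ((τ.flip x).rTensor V (turn b d g y)) = g x y ⊗ₜ cupT k b d +
      G (turn b d g x ⊗ₜ y) - (2 * u x y) • ∑ j, G (turn b d g (b j) ⊗ₜ d j) := by
    intro x y
    have h1 := h.sum_left (G ∘ₗ TensorProduct.mk k _ V (turn b d g x)) y
    have h2 : ∑ j, g x y ⊗ₜ[k] (b j ⊗ₜ[k] d j) = g x y ⊗ₜ cupT k b d := by
      rw [← TensorProduct.tmul_sum, ← cupT]
    simp only [TensorProduct.mk_apply, LinearMap.comp_apply] at h1
    conv_lhs => rw [turn_apply]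
    simp only [map_sum, LinearMap.rTensor_tmul, LinearMap.flip_apply, hτ, pass_apply,
      TensorProduct.sub_tmul, ← TensorProduct.smul_tmul', map_sub, map_smul, g1,
      Finset.sum_sub_distrib, mul_smul, ← Finset.smul_sum, h1, h2]
    module
  have g4 : passTwo τ (g z w) (x ⊗ₜ y) = G ((τ.flip x).rTensor V (τ (g z w) y)) :=
    passTwo_tmul ..
  rw [g4, hτ, pass_apply]
  simp only [map_sub, map_smul, g3, LinearMap.rTensor_tmul, LinearMap.flip_apply, hτ,
    pass_apply, TensorProduct.sub_tmul, ← TensorProduct.smul_tmul', g1]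
  simp only [g2]
  module

/-- Generators of the hyperboloid pass through a cup. -/
theorem passTwo_generator_cupT (h : IsCup u b d) (hg : IsHyp u b d K g)
    (hτ : ∀ z w, τ (g z w) = pass b d u g z w) (z w : V) :
    passTwo τ (g z w) (cupT k b d) = g z w ⊗ₜ cupT k b d := by
  have e1 := h.sum_right (∑ j, (TensorProduct.mk k A (V ⊗[k] V)).flip (d j ⊗ₜ w) ∘ₗ
    g.flip (b j)) z
  have e2 := h.sum_right (u.flip w) z
  have e3 := h.sum_right ((TensorProduct.mk k A (V ⊗[k] V)).flip (cupT k b d) ∘ₗ g.flip w) z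
  have e4 : ∀ t : V ⊗[k] V, ∑ i, g (b i) (d i) ⊗ₜ[k] t = 0 := fun t => by
    rw [← TensorProduct.sum_tmul, hg.cup, TensorProduct.zero_tmul]
  simp only [LinearMap.sum_apply, LinearMap.comp_apply, LinearMap.flip_apply,
    TensorProduct.mk_apply, smul_eq_mul] at e1 e2 e3
  conv_lhs => rw [cupT]
  simp only [map_sum, passTwo_generator h hτ, Finset.sum_add_distrib, Finset.sum_sub_distrib,
    mul_smul, ← Finset.smul_sum, e1, e3, e4, ← Finset.sum_smul, h.loop]
  rw [← Finset.mul_sum, h.loop, e2]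
  module

/-- Functions pass through a cup, so that the twist descends to `sl(V_S)`. -/
theorem passTwo_cupT (h : IsCup u b d) (hg : IsHyp u b d K g)
    (hgen : Algebra.adjoin k (Set.range (TensorProduct.lift g)) = ⊤)
    (h1 : ∀ x, τ 1 x = 1 ⊗ₜ x) (hτ : ∀ z w, τ (g z w) = pass b d u g z w)
    (hmul : ∀ f e, τ (f * e) = extend (τ e) ∘ₗ τ f) (f : A) :
    passTwo τ f (cupT k b d) = f ⊗ₜ cupT k b d := by
  have hM : LinearMap.eqLocus ((passTwo τ).flip (cupT k b d))
      ((TensorProduct.mk k A _).flip (cupT k b d)) = ⊤ := by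
    refine eq_top_of_left_stable₂ g hgen _ ?_ fun x y f hf => ?_
    · exact passTwo_one h1 _
    · rw [LinearMap.mem_eqLocus] at hf ⊢
      simp only [LinearMap.flip_apply, TensorProduct.mk_apply] at hf ⊢
      rw [passTwo_mul hmul, LinearMap.comp_apply, passTwo_generator_cupT h hg hτ, extend_tmul, hf,
        lact_tmul]
  have : f ∈ LinearMap.eqLocus ((passTwo τ).flip (cupT k b d))
      ((TensorProduct.mk k A _).flip (cupT k b d)) := by rw [hM]; trivial
  exact this

/-- The twist of two vectors and a generator, modulo the determinant. -/
theorem lTensor_passTwo_generator (h : IsCup u b d) {W : Type*} [AddCommGroup W] [Module k W]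
    (φ : V ⊗[k] V →ₗ[k] W) (hφ : φ (cupT k b d) = 0)
    (hτ : ∀ z w, τ (g z w) = pass b d u g z w) (x y z w : V) :
    φ.lTensor A (passTwo τ (g z w) (x ⊗ₜ y)) =
      g x y ⊗ₜ φ (z ⊗ₜ w) - (4 * u y z) • ∑ i, g x (b i) ⊗ₜ φ (d i ⊗ₜ w) -
      (2 * u x y) • ∑ i, g z (b i) ⊗ₜ φ (d i ⊗ₜ w) -
      (2 * u z w) • ∑ i, g x (b i) ⊗ₜ φ (d i ⊗ₜ y) +
      (4 * (u z w * u x y + u y z * u x w)) •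
        ∑ i, ∑ l, g (b i) (b l) ⊗ₜ φ (d l ⊗ₜ d i) := by
  rw [passTwo_generator h hτ]
  simp only [map_sub, map_add, map_smul, map_sum, LinearMap.lTensor_tmul, hφ,
    TensorProduct.tmul_zero, smul_zero, sub_zero]

end PassTwoCup

section Eval

variable {k A W W' : Type*} [Field k] [Ring A] [Algebra k A] [AddCommGroup W] [Module k W]
  [AddCommGroup W'] [Module k W']

theorem rTensor_mul_assoc (σ : W ⊗[k] A →ₗ[k] A ⊗[k] W') (m : A ⊗[k] W) (f : A) :
    (LinearMap.mul' k A).rTensor W' ((TensorProduct.assoc k _ _ _).symm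
      (σ.lTensor A (TensorProduct.assoc k _ _ _ (m ⊗ₜ[k] f)))) =
      extend ((TensorProduct.curry σ).flip f) m := by
  have h1 : ∀ (a : A) (n : A ⊗[k] W'), (LinearMap.mul' k A).rTensor W'
      ((TensorProduct.assoc k A A W').symm (a ⊗ₜ n)) = lact a n := by
    intro a n
    induction n with
    | zero => simp
    | add s t hs ht => simp only [TensorProduct.tmul_add, map_add, hs, ht]
    | tmul e x => simp [lact_tmul]
  induction m with
  | zero => simp
  | add s t hs ht => simp only [TensorProduct.add_tmul, map_add, hs, ht]
  | tmul a x => simp [h1, extend_tmul]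

/-- Apply a map `W → A` and multiply. -/
def evalMul : (W →ₗ[k] A) →ₗ[k] A ⊗[k] W →ₗ[k] A :=
  LinearMap.llcomp k _ _ _ (LinearMap.mul' k A) ∘ₗ LinearMap.lTensorHom A

theorem evalMul_tmul (r : W →ₗ[k] A) (a : A) (x : W) : evalMul r (a ⊗ₜ x) = a * r x := by
  simp [evalMul]

theorem evalMul_lact (r : W →ₗ[k] A) (a : A) (m : A ⊗[k] W) :
    evalMul r (lact a m) = a * evalMul r m := by
  induction m with
  | zero => simp
  | add s t hs ht => simp only [map_add, mul_add, hs, ht]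
  | tmul e x => simp [lact_tmul, evalMul_tmul, mul_assoc]

theorem mul_lTensor_assoc (ρ : W ⊗[k] A →ₗ[k] A) (m : A ⊗[k] W) (f : A) :
    LinearMap.mul' k A (ρ.lTensor A (TensorProduct.assoc k _ _ _ (m ⊗ₜ[k] f))) =
      evalMul ((TensorProduct.curry ρ).flip f) m := by
  induction m with
  | zero => simp
  | add s t hs ht => simp only [TensorProduct.add_tmul, map_add, hs, ht]
  | tmul a x => simp [evalMul_tmul]

end Eval

section Action

variable {k V : Type*} [Field k] [AddCommGroup V] [Module k V]
  [FiniteDimensional k V] {n : ℕ}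
variable {S : V ⊗[k] V →ₗ[k] V ⊗[k] V} {u : V →ₗ[k] V →ₗ[k] k} {b : Module.Basis (Fin n) k V}
  {d : Fin n → V} {c : k}

/-! ### Uniqueness of the action -/

/-- Linear maps on `sl ⊗ A_c` agree if they agree at `1` and if agreement at `f` implies
agreement at products of generators with `f`. -/
theorem linearMap_ext_hyperboloid {W : Type*} [AddCommGroup W] [Module k W]
    {F G : sl S ⊗[k] Hyperboloid S b c →ₗ[k] W} (h1 : ∀ X, F (X ⊗ₜ 1) = G (X ⊗ₜ 1))
    (h2 : ∀ Y f, (TensorProduct.curry F).flip f = (TensorProduct.curry G).flip f →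
      ∀ X, F (X ⊗ₜ (hypGen S b c Y * f)) = G (X ⊗ₜ (hypGen S b c Y * f))) : F = G := by
  have hM : LinearMap.eqLocus (TensorProduct.curry F).flip (TensorProduct.curry G).flip = ⊤ :=
    eq_top_of_left_stable (hypGen S b c) adjoin_hypGen _ (LinearMap.ext h1)
      fun Y f hf => LinearMap.ext (h2 Y f hf)
  refine TensorProduct.ext' fun X f => ?_
  have : f ∈ LinearMap.eqLocus (TensorProduct.curry F).flip (TensorProduct.curry G).flip := by
    rw [hM]; trivial
  exact LinearMap.congr_fun this X

theorem IsAdjointAction.unique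
    {σ σ' : sl S ⊗[k] Hyperboloid S b c →ₗ[k] Hyperboloid S b c ⊗[k] sl S}
    {ρ ρ' : sl S ⊗[k] Hyperboloid S b c →ₗ[k] Hyperboloid S b c}
    (h : IsAdjointAction S b c σ ρ) (h' : IsAdjointAction S b c σ' ρ') : σ = σ' ∧ ρ = ρ' := by
  have hσ : σ = σ' := linearMap_ext_hyperboloid (W := Hyperboloid S b c ⊗[k] sl S)
      (fun X => by rw [h.braid_one, h'.braid_one]) fun Y f hf X => by
    rw [h.braid_mul, h'.braid_mul, rTensor_mul_assoc, rTensor_mul_assoc, h.braid_gen, h'.braid_gen,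
      hf]
  subst hσ
  refine ⟨rfl, linearMap_ext_hyperboloid
    (fun X => by rw [h.act_one, h'.act_one]) fun Y f hf X => ?_⟩
  rw [h.leibniz, h'.leibniz, mul_lTensor_assoc, mul_lTensor_assoc, h.act_gen, h'.act_gen, hf]

end Action

section Existence

open TwistedSym

variable {k V : Type*} [Field k] [CharZero k] [AddCommGroup V] [Module k V]
  [FiniteDimensional k V] {n : ℕ}
variable {S : V ⊗[k] V →ₗ[k] V ⊗[k] V} {u : V →ₗ[k] V →ₗ[k] k} {b : Module.Basis (Fin n) k V}
  {d : Fin n → V} {A : Type*} [Ring A] [Algebra k A] {γ : sl S →ₗ[k] A} {K : k}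

/-! ### Existence of the twist and of the action -/

/-- Linear maps on `sl ⊗ sl` that agree on the generators are equal. -/
theorem ext_sl (h : IsCentralDet S u b d) (hS : S ∘ₗ S = LinearMap.id) {W : Type*}
    [AddCommGroup W] [Module k W] {F G : sl S →ₗ[k] sl S →ₗ[k] W}
    (hFG : ∀ x y z w, F (toSl h (x ⊗ₜ y)) (toSl h (z ⊗ₜ w)) =
      G (toSl h (x ⊗ₜ y)) (toSl h (z ⊗ₜ w))) (X Y : sl S) : F X Y = G X Y := by
  obtain ⟨s, rfl⟩ := toSl_surjective h hS X
  obtain ⟨t, rfl⟩ := toSl_surjective h hS Y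
  have : F.compl₁₂ (toSl h) (toSl h) = G.compl₁₂ (toSl h) (toSl h) := by
    refine TensorProduct.ext' fun x y => TensorProduct.ext' fun z w => ?_
    exact hFG x y z w
  exact LinearMap.congr_fun (LinearMap.congr_fun this s) t

/-- The twist of `sl(V_S)` and functions: pass the two vectors of a representative in `V ⊗ V`
one after the other, and project back to `sl(V_S)`. -/
theorem exists_twist (h : IsCentralDet S u b d) (hS : S ∘ₗ S = LinearMap.id)
    (hγ : Algebra.adjoin k (Set.range γ) = ⊤) (hg : IsHyp u b d K (onSl h γ))
    {τ : A →ₗ[k] V →ₗ[k] A ⊗[k] V} (h1 : ∀ x, τ 1 x = 1 ⊗ₜ x)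
    (hτ : ∀ z w, τ (onSl h γ z w) = pass b d u (onSl h γ) z w)
    (hmul : ∀ f e, τ (f * e) = extend (τ e) ∘ₗ τ f) :
    ∃ σ : sl S ⊗[k] A →ₗ[k] A ⊗[k] sl S,
      (∀ X : sl S, σ (X ⊗ₜ[k] 1) = 1 ⊗ₜ[k] X) ∧
      (∀ X Y : sl S,
        σ (X ⊗ₜ[k] γ Y) = γ.rTensor (sl S) (braidSl S (X ⊗ₜ[k] Y))) ∧
      ∀ (X : sl S) (f e : A),
        σ (X ⊗ₜ[k] (f * e)) = extend ((TensorProduct.curry σ).flip e) (σ (X ⊗ₜ[k] f)) := by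
  have hgen := adjoin_onSl h hS hγ
  let σ : sl S ⊗[k] A →ₗ[k] A ⊗[k] sl S :=
    TensorProduct.lift (((passTwo τ).flip ∘ₗ ofSl h).compr₂ ((toSl h).lTensor _))
  have hσ : ∀ t f, σ (toSl h t ⊗ₜ f) = (toSl h).lTensor _ (passTwo τ f t) := by
    intro t f
    have h2 : σ (toSl h t ⊗ₜ f) = (toSl h).lTensor _ (passTwo τ f (ofSl h (toSl h t))) := rfl
    rw [h2, ofSl_toSl h hS, projSq_apply, map_sub, map_smul,
      passTwo_cupT h.isCup hg hgen h1 hτ hmul, map_sub, map_smul, LinearMap.lTensor_tmul,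
      toSl_cupT h hS, TensorProduct.tmul_zero, smul_zero, sub_zero]
  refine ⟨σ, fun X => ?_, ?_, fun X f e => ?_⟩
  · obtain ⟨t, rfl⟩ := toSl_surjective h hS X
    rw [hσ, passTwo_one h1, LinearMap.lTensor_tmul]
  · refine ext_sl h hS (W := A ⊗[k] sl S)
      (F := (TensorProduct.curry σ).compl₂ γ)
      (G := TensorProduct.curry (γ.rTensor (sl S) ∘ₗ braidSl S))
      fun x y z w => ?_
    change σ (toSl h (x ⊗ₜ y) ⊗ₜ onSl h γ z w) =
      γ.rTensor (sl S) (braidSl S (toSl h (x ⊗ₜ y) ⊗ₜ toSl h (z ⊗ₜ w)))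
    rw [hσ, lTensor_passTwo_generator h.isCup (toSl h) (toSl_cupT h hS) hτ,
      braidSl_toSl_tmul h hS]
    simp only [map_add, map_sub, map_smul, map_sum, LinearMap.rTensor_tmul, ← onSl_apply]
  · obtain ⟨t, rfl⟩ := toSl_surjective h hS X
    rw [hσ, hσ, passTwo_mul hmul, LinearMap.comp_apply]
    generalize passTwo τ f t = m
    induction m with
    | zero => simp
    | add s t hs ht => simp only [map_add, hs, ht]
    | tmul a s =>
      rw [extend_tmul, LinearMap.lTensor_tmul, extend_tmul, lTensor_lact, LinearMap.flip_apply,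
        TensorProduct.curry_apply, hσ]

/-- The action of `sl(V_S)` on the symmetric algebra. -/
def slField (h : IsCentralDet S u b d) : sl S →ₗ[k] Module.End k (TwistedSym k b d) :=
  TensorProduct.lift (field h.isCup) ∘ₗ ofSl h

theorem slField_toSl (h : IsCentralDet S u b d) (hS : S ∘ₗ S = LinearMap.id) (x y : V) :
    slField h (toSl h (x ⊗ₜ y)) = field h.isCup x y := by
  have h1 : TensorProduct.lift (field h.isCup) (cupT k b d) = 0 := by
    simpa [cupT] using sum_field h.isCup
  rw [slField, LinearMap.comp_apply, ofSl_toSl h hS, projSq_apply, map_sub, map_smul, h1]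
  simp

theorem slField_mem_even (h : IsCentralDet S u b d) (hS : S ∘ₗ S = LinearMap.id) (X : sl S)
    {f : TwistedSym k b d} (hf : f ∈ even k b d) : slField h X f ∈ even k b d := by
  obtain ⟨t, rfl⟩ := toSl_surjective h hS X
  induction t with
  | zero => simp
  | add s t hs ht => simp only [map_add, LinearMap.add_apply]; exact add_mem hs ht
  | tmul x y => rw [slField_toSl h hS]; exact field_mem_even _ _ _ hf

/-- The adjoint action of `sl(V_S)` on the hyperboloid, transported from the symmetric
algebra. -/
def adjAction (h : IsCentralDet S u b d) (γ : sl S →ₗ[k] A)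
    (Q : A →ₐ[k] Module.End k (even k b d)) :
    sl S ⊗[k] A →ₗ[k] A :=
  TensorProduct.lift ((slField h).compl₁₂ LinearMap.id (orbit Q) |>.compr₂
    (invOrbit h.isCup (onSl h γ)))

/-- The algebra `A` with its generators `γ` satisfies the relations of the hyperboloid with
parameter `K`, and acts by `Q` on the even part of the symmetric algebra in the prescribed
way. -/
structure IsModel (h : IsCentralDet S u b d) (K : k) (γ : sl S →ₗ[k] A)
    (Q : A →ₐ[k] Module.End k (even k b d)) : Prop where
  adjoin : Algebra.adjoin k (Set.range γ) = ⊤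
  isHyp : IsHyp u b d K (onSl h γ)
  apply : ∀ x y, Q (onSl h γ x y) = evenL h.isCup K x y

variable {Q : A →ₐ[k] Module.End k (even k b d)} {h : IsCentralDet S u b d}

theorem IsModel.orbit_adjAction (hQ : IsModel h K γ Q) (hS : S ∘ₗ S = LinearMap.id) (X : sl S)
    (f : A) : orbit Q (adjAction h γ Q (X ⊗ₜ f)) = slField h X (orbit Q f) :=
  orbit_invOrbit h.isCup hQ.apply (slField_mem_even h hS X (orbit_mem f))

theorem IsModel.invOrbit_orbit (hQ : IsModel h K γ Q) (hS : S ∘ₗ S = LinearMap.id) (f : A) :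
    invOrbit h.isCup (onSl h γ) (orbit Q f) = f :=
  TwistedSym.invOrbit_orbit h.isCup hQ.isHyp (adjoin_onSl h hS hQ.adjoin) hQ.apply f

theorem IsModel.orbit_injective (hQ : IsModel h K γ Q) (hS : S ∘ₗ S = LinearMap.id) :
    Function.Injective (orbit Q) :=
  Function.LeftInverse.injective (hQ.invOrbit_orbit hS)

theorem IsModel.orbit_mul (hQ : IsModel h K γ Q) (x y : V) (f : A) :
    orbit Q (onSl h γ x y * f) = hypL h.isCup K x y (orbit Q f) :=
  TwistedSym.orbit_mul h.isCup hQ.apply x y f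

/-- The twisted Leibniz rule for the product of a generator and a function. -/
theorem IsModel.adjAction_generator_mul (hQ : IsModel h K γ Q) (hS : S ∘ₗ S = LinearMap.id)
    (X Y : sl S) (f : A) :
    adjAction h γ Q (X ⊗ₜ (γ Y * f)) =
      γ (bracketSl S (X ⊗ₜ Y)) * f +
        evalMul ((TensorProduct.curry (adjAction h γ Q)).flip f)
          (γ.rTensor (sl S) (braidSl S (X ⊗ₜ Y))) := by
  let mulF : A →ₗ[k] A := (LinearMap.mul k _).flip f
  refine ext_sl h hS
    (F := (TensorProduct.curry (adjAction h γ Q)).compl₂ (mulF ∘ₗ γ))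
    (G := TensorProduct.curry (mulF ∘ₗ γ ∘ₗ bracketSl S +
      evalMul ((TensorProduct.curry (adjAction h γ Q)).flip f) ∘ₗ
        γ.rTensor (sl S) ∘ₗ braidSl S)) (fun x y z w => ?_) X Y
  change adjAction h γ Q (toSl h (x ⊗ₜ y) ⊗ₜ (onSl h γ z w * f)) =
    γ (bracketSl S (toSl h (x ⊗ₜ y) ⊗ₜ toSl h (z ⊗ₜ w))) * f +
      evalMul ((TensorProduct.curry (adjAction h γ Q)).flip f)
        (γ.rTensor (sl S) (braidSl S (toSl h (x ⊗ₜ y) ⊗ₜ toSl h (z ⊗ₜ w))))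
  apply hQ.orbit_injective hS
  rw [hQ.orbit_adjAction hS, hQ.orbit_mul, slField_toSl h hS, field_hypL, bracketSl_toSl_tmul h hS,
    braidSl_toSl_tmul h hS]
  simp only [map_add, map_sub, map_smul, map_sum, LinearMap.rTensor_tmul, evalMul_tmul,
    ← onSl_apply h γ, add_mul, smul_mul_assoc, LinearMap.flip_apply, TensorProduct.curry_apply,
    hQ.orbit_mul, hQ.orbit_adjAction hS, slField_toSl h hS]

theorem IsModel.adjAction_one (hQ : IsModel h K γ Q) (hS : S ∘ₗ S = LinearMap.id) (X : sl S) :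
    adjAction h γ Q (X ⊗ₜ[k] 1) = 0 := by
  obtain ⟨t, rfl⟩ := toSl_surjective h hS X
  induction t with
  | zero => simp
  | add s t hs ht => rw [map_add, TensorProduct.add_tmul, map_add, hs, ht, add_zero]
  | tmul x y =>
    apply hQ.orbit_injective hS
    rw [hQ.orbit_adjAction hS, slField_toSl h hS, orbit_one, field_one, map_zero]

theorem IsModel.adjAction_generator (hQ : IsModel h K γ Q) (hS : S ∘ₗ S = LinearMap.id)
    (X Y : sl S) : adjAction h γ Q (X ⊗ₜ γ Y) = γ (bracketSl S (X ⊗ₜ Y)) := by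
  have h1 : ∀ m : A ⊗[k] sl S, evalMul ((TensorProduct.curry (adjAction h γ Q)).flip 1) m = 0 := by
    intro m
    induction m with
    | zero => simp
    | add s t hs ht => rw [map_add, hs, ht, add_zero]
    | tmul a X => simp [evalMul_tmul, hQ.adjAction_one hS]
  have := hQ.adjAction_generator_mul hS X Y 1
  rwa [mul_one, mul_one, h1, add_zero] at this

/-- The twisted Leibniz rule. -/
theorem IsModel.adjAction_mul (hQ : IsModel h K γ Q) (hS : S ∘ₗ S = LinearMap.id)
    {σ : sl S ⊗[k] A →ₗ[k] A ⊗[k] sl S} (h1 : ∀ X : sl S, σ (X ⊗ₜ[k] 1) = 1 ⊗ₜ[k] X)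
    (hgen : ∀ X Y : sl S, σ (X ⊗ₜ[k] γ Y) = γ.rTensor (sl S) (braidSl S (X ⊗ₜ[k] Y)))
    (hmul : ∀ (X : sl S) (f e : A),
      σ (X ⊗ₜ[k] (f * e)) = extend ((TensorProduct.curry σ).flip e) (σ (X ⊗ₜ[k] f)))
    (X : sl S) (f e : A) :
    adjAction h γ Q (X ⊗ₜ (f * e)) = adjAction h γ Q (X ⊗ₜ f) * e +
      evalMul ((TensorProduct.curry (adjAction h γ Q)).flip e) (σ (X ⊗ₜ f)) := by
  let M : Submodule k A :=
    { carrier := {f | ∀ X : sl S, adjAction h γ Q (X ⊗ₜ (f * e)) =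
        adjAction h γ Q (X ⊗ₜ f) * e +
          evalMul ((TensorProduct.curry (adjAction h γ Q)).flip e) (σ (X ⊗ₜ f))}
      zero_mem' := fun X => by simp
      add_mem' := fun {f f'} hf hf' X => by
        simp only [TensorProduct.tmul_add, map_add, add_mul, hf X, hf' X]; abel
      smul_mem' := fun r f hf X => by
        simp only [TensorProduct.tmul_smul, map_smul, smul_mul_assoc, hf X, smul_add] }
  have hM : M = ⊤ := by
    refine eq_top_of_left_stable γ hQ.adjoin M (fun X => ?_) fun Y f hf X => ?_
    · rw [one_mul, hQ.adjAction_one hS, zero_mul, zero_add, h1, evalMul_tmul, one_mul]; rfl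
    · rw [mul_assoc, hQ.adjAction_generator_mul hS, hQ.adjAction_generator_mul hS, hmul, hgen]
      generalize γ.rTensor (sl S) (braidSl S (X ⊗ₜ Y)) = m
      have key : evalMul ((TensorProduct.curry (adjAction h γ Q)).flip (f * e)) m =
          evalMul ((TensorProduct.curry (adjAction h γ Q)).flip f) m * e +
          evalMul ((TensorProduct.curry (adjAction h γ Q)).flip e)
            (extend ((TensorProduct.curry σ).flip f) m) := by
        induction m with
        | zero => simp
        | add s t hs ht => simp only [map_add, hs, ht, add_mul]; abel
        | tmul a Z =>
          simp only [evalMul_tmul, extend_tmul, evalMul_lact, LinearMap.flip_apply,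
            TensorProduct.curry_apply]
          rw [hf Z, mul_add, mul_assoc]
      rw [key, add_mul, mul_assoc, add_assoc]
  have : f ∈ M := by rw [hM]; trivial
  exact this X

end Existence

section Spectrum

open TwistedSym

variable {k V ι : Type*} [Field k] [CharZero k] [AddCommGroup V] [Module k V] [Fintype ι]
variable {u : V →ₗ[k] V →ₗ[k] k} {b d : ι → V}

/-! ### The spectrum of the Casimir operator -/

theorem sum_field_field_eq_num (h : IsCup u b d) (f : TwistedSym k b d) :
    (-4 : k) • ∑ i, ∑ l, field h (b i) (b l) (field h (d l) (d i) f) =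
      (2⁻¹ : k) • num h (num h f) + num h f := by
  have : (-4 : k) • ∑ i, ∑ l, field h (b i) (b l) ∘ₗ field h (d l) (d i) =
      (2⁻¹ : k) • (num h ∘ₗ num h) + num h := by
    refine linearMap_ext_grade fun m f hf => ?_
    have h1 := sum_field_field h hf
    simp only [LinearMap.smul_apply, LinearMap.sum_apply, LinearMap.comp_apply,
      LinearMap.add_apply, num_of_mem h hf, map_smul, h1]
    module
  have h2 := LinearMap.congr_fun this f
  simpa [LinearMap.sum_apply] using h2

/-- The eigenspaces of `N² / 2 + N` are homogeneous components. -/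
theorem mem_grade_iff_casimir (h : IsCup u b d) (m : ℕ) (f : TwistedSym k b d) :
    f ∈ grade k b d m ↔
      (2⁻¹ : k) • num h (num h f) + num h f = ((m : k) ^ 2 / 2 + m) • f := by
  refine ⟨fun hf => ?_, fun hf => ?_⟩
  · rw [num_of_mem h hf, map_smul, num_of_mem h hf]
    module
  · rw [mem_grade_iff_num h, ← sub_eq_zero]
    refine eq_zero_of_comp _ fun j => ?_
    -- `N² / 2 + N - m² / 2 - m = (N + m + 2) (N - m) / 2`
    have h1 : num h (num h f - (m : k) • f) + ((m : k) + 2) • (num h f - (m : k) • f) = 0 := by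
      rw [map_sub, map_smul]
      linear_combination (norm := module) (2 : k) • hf
    have h2 := congrArg (comp k b d j) h1
    rw [map_add, comp_num, map_smul, map_zero, ← add_smul, smul_eq_zero] at h2
    refine h2.resolve_left ?_
    exact_mod_cast (by omega : j + (m + 2) ≠ 0)

end Spectrum

section Final

open TwistedSym

variable {k V : Type*} [Field k] [CharZero k] [AddCommGroup V] [Module k V]
  [FiniteDimensional k V] {n : ℕ}
variable {S : V ⊗[k] V →ₗ[k] V ⊗[k] V} {u : V →ₗ[k] V →ₗ[k] k} {b : Module.Basis (Fin n) k V}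
  {d : Fin n → V}

section Generic

variable {A : Type*} [Ring A] [Algebra k A] {γ : sl S →ₗ[k] A} {K : k}
  {Q : A →ₐ[k] Module.End k (even k b d)} {h : IsCentralDet S u b d}

variable (S b) in
/-- The Casimir operator of an action `ρ`. -/
def casimirOf (ρ : sl S ⊗[k] A →ₗ[k] A) : Module.End k A :=
  ∑ i, ∑ j, ∑ l, matB S b i j •
    (TensorProduct.curry ρ (slGen S b l i) ∘ₗ TensorProduct.curry ρ (slGen S b j l))

theorem IsModel.orbit_casimirOf (hQ : IsModel h K γ Q) (hS : S ∘ₗ S = LinearMap.id) (f : A) :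
    orbit Q (casimirOf S b (adjAction h γ Q) f) =
      (2⁻¹ : k) • num h.isCup (num h.isCup (orbit Q f)) + num h.isCup (orbit Q f) := by
  have h1 := sum_matB_slGen h hS ((TensorProduct.curry (adjAction h γ Q)).compl₂
    ((TensorProduct.curry (adjAction h γ Q)).flip f))
  have h2 : casimirOf S b (adjAction h γ Q) f = (-4 : k) • ∑ i, ∑ l,
      adjAction h γ Q (toSl h (b i ⊗ₜ b l) ⊗ₜ
        adjAction h γ Q (toSl h (d l ⊗ₜ d i) ⊗ₜ f)) := by
    rw [casimirOf]
    simpa [LinearMap.sum_apply] using h1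
  rw [h2, ← sum_field_field_eq_num]
  simp only [map_smul, map_sum, hQ.orbit_adjAction hS, slField_toSl h hS]

theorem IsModel.mem_eigenspace_iff (hQ : IsModel h K γ Q) (hS : S ∘ₗ S = LinearMap.id) (l : ℕ)
    (f : A) :
    f ∈ (casimirOf S b (adjAction h γ Q)).eigenspace ((2 * (l : k)) ^ 2 / 2 + 2 * (l : k)) ↔
      orbit Q f ∈ grade k b d (2 * l) := by
  rw [Module.End.mem_eigenspace_iff, ← (hQ.orbit_injective hS).eq_iff, hQ.orbit_casimirOf hS,
    mem_grade_iff_casimir h.isCup, map_smul]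
  push_cast
  rfl

theorem IsModel.finrank_eigenspace (hQ : IsModel h K γ Q) (hS : S ∘ₗ S = LinearMap.id) (l : ℕ) :
    Module.finrank k ((casimirOf S b (adjAction h γ Q)).eigenspace
      ((2 * (l : k)) ^ 2 / 2 + 2 * (l : k))) = Module.finrank k (grade k b d (2 * l)) := by
  let F : (casimirOf S b (adjAction h γ Q)).eigenspace
      ((2 * (l : k)) ^ 2 / 2 + 2 * (l : k)) →ₗ[k] grade k b d (2 * l) :=
    LinearMap.restrict (orbit Q) fun f hf => (hQ.mem_eigenspace_iff hS l f).1 hf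
  refine (LinearEquiv.ofBijective F ⟨fun x y hxy => ?_, fun y => ?_⟩).finrank_eq
  · have hxy' : ((F x : grade k b d (2 * l)) : TwistedSym k b d) = F y := by rw [hxy]
    exact Subtype.ext (hQ.orbit_injective hS hxy')
  · have h1 := orbit_invOrbit h.isCup hQ.apply (mem_even y.2)
    refine ⟨⟨invOrbit h.isCup (onSl h γ) y, (hQ.mem_eigenspace_iff hS l _).2 ?_⟩, Subtype.ext h1⟩
    rw [h1]; exact y.2

theorem IsModel.iSup_eigenspace (hQ : IsModel h K γ Q) (hS : S ∘ₗ S = LinearMap.id) :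
    ⨆ l : ℕ, (casimirOf S b (adjAction h γ Q)).eigenspace
      ((2 * (l : k)) ^ 2 / 2 + 2 * (l : k)) = ⊤ := by
  rw [eq_top_iff]
  intro f _
  have h1 : even k b d ≤ (⨆ l : ℕ, (casimirOf S b (adjAction h γ Q)).eigenspace
      ((2 * (l : k)) ^ 2 / 2 + 2 * (l : k))).comap (invOrbit h.isCup (onSl h γ)) := by
    conv_lhs => rw [even]
    refine iSup_le fun l y hy => ?_
    refine Submodule.mem_iSup_of_mem l ((hQ.mem_eigenspace_iff hS l _).2 ?_)
    rw [orbit_invOrbit h.isCup hQ.apply (mem_even hy)]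
    exact hy
  have h2 := h1 (orbit_mem (Q := Q) f)
  rwa [Submodule.mem_comap, hQ.invOrbit_orbit hS] at h2

theorem IsModel.hasEigenvalue_iff (hQ : IsModel h K γ Q) (hS : S ∘ₗ S = LinearMap.id)
    (hne : ∀ l, Module.finrank k (grade k b d (2 * l)) ≠ 0) (μ : k) :
    (casimirOf S b (adjAction h γ Q)).HasEigenvalue μ ↔
      ∃ l : ℕ, μ = (2 * (l : k)) ^ 2 / 2 + 2 * (l : k) := by
  constructor
  · intro hμ
    by_contra! hl
    refine hμ ((Module.End.eigenspaces_iSupIndep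
      (casimirOf S b (adjAction h γ Q)) μ).eq_bot_of_le ?_)
    refine le_top.trans ((hQ.iSup_eigenspace hS).ge.trans (iSup_le fun l => ?_))
    exact le_iSup₂_of_le _ (hl l).symm le_rfl
  · rintro ⟨l, rfl⟩ hl
    have := hQ.finrank_eigenspace hS l
    change Module.End.eigenspace _ _ = ⊥ at hl
    rw [hl, finrank_bot] at this
    exact hne l this.symm

end Generic

variable {c : k}

/-- The hyperboloid `A_c` acts on the even part of the symmetric algebra. -/
theorem exists_model (h : IsCentralDet S u b d) (hS : S ∘ₗ S = LinearMap.id) :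
    ∃ Q, IsModel h (-c / 4) (hypGen S b c) Q := by
  obtain ⟨Q, hQ⟩ := exists_algHom_hyperboloid h hS (isHyp_evenL h.isCup (-c / 4))
  exact ⟨Q, adjoin_hypGen, isHyp_hypGen h hS, hQ⟩

theorem IsModel.exists_isAdjointAction {h : IsCentralDet S u b d} (hS : S ∘ₗ S = LinearMap.id)
    {Q : Hyperboloid S b c →ₐ[k] Module.End k (even k b d)}
    (hQ : IsModel h (-c / 4) (hypGen S b c) Q) :
    ∃ σ, IsAdjointAction S b c σ (adjAction h (hypGen S b c) Q) := by
  obtain ⟨τ, h1, hτ, hmul⟩ := exists_passHom h.isCup hQ.isHyp (adjoin_onSl h hS hQ.adjoin)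
    (fun hg' => exists_algHom_hyperboloid h hS hg')
  obtain ⟨σ, hσ1, hσ2, hσ3⟩ := exists_twist h hS hQ.adjoin hQ.isHyp h1 hτ hmul
  exact ⟨σ, {
    braid_one := hσ1
    braid_gen := hσ2
    braid_mul := fun X f g => (hσ3 X f g).trans (rTensor_mul_assoc σ _ g).symm
    act_one := hQ.adjAction_one hS
    act_gen := hQ.adjAction_generator hS
    leibniz := fun X f g => by
      rw [mul_lTensor_assoc]
      exact hQ.adjAction_mul hS hσ1 hσ2 hσ3 X f g }⟩

end Final

end TwistedHyperboloid

end

open TwistedHyperboloid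
theorem proposition5p2 {k : Type*} [RCLike k] {V : Type*} [AddCommGroup V] [Module k V]
    [FiniteDimensional k V] {n : ℕ} (hn : 2 < n) (b : Module.Basis (Fin n) k V)
    (S : V ⊗[k] V →ₗ[k] V ⊗[k] V) (hS : IsSymmetry S) (hrank : IsEvenOfRank S 2)
    (hdet : HasCentralDeterminant S) (c : k) (hc : c ≠ 0)
    (α₁ α₂ : ℝ) (hα : α₁ ≠ α₂) (hα₁ : 1 - (n : ℝ) * α₁ + α₁ ^ 2 = 0)
    (hα₂ : 1 - (n : ℝ) * α₂ + α₂ ^ 2 = 0) :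
    IsWellDefined S b ∧
    (∃! σρ : (sl S ⊗[k] Hyperboloid S b c →ₗ[k] Hyperboloid S b c ⊗[k] sl S) ×
        (sl S ⊗[k] Hyperboloid S b c →ₗ[k] Hyperboloid S b c),
      IsAdjointAction S b c σρ.1 σρ.2) ∧
    ∀ (σ : sl S ⊗[k] Hyperboloid S b c →ₗ[k] Hyperboloid S b c ⊗[k] sl S)
      (ρ : sl S ⊗[k] Hyperboloid S b c →ₗ[k] Hyperboloid S b c),
      IsAdjointAction S b c σ ρ →
        (∀ μ : k, (casimirOp S b c ρ).HasEigenvalue μ ↔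
          ∃ l : ℕ, μ = (2 * (l : k)) ^ 2 / 2 + 2 * (l : k)) ∧
        (∀ l : ℕ, (Module.finrank k ((casimirOp S b c ρ).eigenspace
            ((2 * (l : k)) ^ 2 / 2 + 2 * (l : k))) : ℝ) =
          (α₂ ^ (2 * l + 1) - α₁ ^ (2 * l + 1)) / (α₂ - α₁)) ∧
        (⨆ μ : k, (casimirOp S b c ρ).eigenspace μ) = ⊤ := by
  have hSS := hS.involutive
  obtain ⟨u, d, h⟩ := hdet.exists_isCentralDet b
  obtain ⟨Q, hQ⟩ := exists_model (c := c) h hSS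
  obtain ⟨σ₀, h₀⟩ := hQ.exists_isAdjointAction hSS
  refine ⟨⟨braidDualLeft_bijective h hSS, traceS_one h hSS, isUnit_det_matC h hSS,
    braid_mem h hSS, bracket_mem h hSS⟩, ⟨(σ₀, _), h₀, fun σρ h' => ?_⟩, fun σ ρ h' => ?_⟩
  · obtain ⟨e1, e2⟩ := h'.unique h₀
    exact Prod.ext e1 e2
  · obtain rfl := (h'.unique h₀).2
    have hdim : ∀ l : ℕ, (Module.finrank k (TwistedSym.grade k b d (2 * l)) : ℝ) =
        (α₂ ^ (2 * l + 1) - α₁ ^ (2 * l + 1)) / (α₂ - α₁) :=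
      fun l => TwistedSym.finrank_grade h.isCup h.isCup.pairing hα (by simpa using hα₁)
        (by simpa using hα₂) (2 * l)
    have hne : ∀ l, Module.finrank k (TwistedSym.grade k b d (2 * l)) ≠ 0 := by
      intro l hl
      have h1 := hdim l
      rw [hl, Nat.cast_zero, eq_comm, div_eq_zero_iff, sub_eq_zero, sub_eq_zero] at h1
      rcases h1 with h1 | h1
      · exact hα ((Odd.strictMono_pow ⟨l, rfl⟩).injective h1).symm
      · exact hα h1.symm
    have hcas : casimirOp S b c (adjAction h (hypGen S b c) Q) =
        casimirOf S b (adjAction h (hypGen S b c) Q) := rfl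
    rw [hcas]
    refine ⟨hQ.hasEigenvalue_iff hSS hne, fun l => ?_, ?_⟩
    · rw [hQ.finrank_eigenspace hSS l, hdim l]
    · rw [eq_top_iff, ← hQ.iSup_eigenspace hSS]
      exact iSup_le fun l => le_iSup (casimirOf S b (adjAction h (hypGen S b c) Q)).eigenspace _
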